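/- **Setting.** Let $n\ge 1$ and let $F$ be the closed oriented surface of genus $n$ obtained from a $4n$-gon by identifying its sides along the word $\prod_{i=1}^n A_iD_iA_i^{-1}D_i^{-1}$. Let $x$ be the base point (the image of the vertices); the sides give simple loops $A_i,D_i$ at $x$, with $\pi_1(F)=\langle A_i,D_i\mid\prod_{i=1}^n[A_i,D_i]=1\rangle$. Orient $F$ so that $A_i\cdot D_i=-1$, and put $B_i=D_iA_iD_i^{-1}$. Identify $SU(2)$ with the unit quaternions and write $e^{\alpha Q}=\cos\alpha+(\sin\alpha)Q$ for $Q$ a purely imaginary unit quaternion. Let $\mathcal M(F)=\operatorname{Hom}(\pi_1(F),SU(2))/\mathrm{conj}$. A representation is *abelian* if its stabilizer under conjugation is isomorphic to $U(1)$ (so central representations are not abelian); $\mathcal M(F)^{U(1)}$ is the set of classes of abelian representations. Let $T:\mathcal M(F)\to\mathbb R^n$, $T(\rho)=(\operatorname{Re}\rho(A_1),\dots,\operatorname{Re}\rho(A_n))$. **Special curves.** The curves $C_{I}(i),C_{II}(i),C_{III}(i)$ ($1\le i\le n$) and $C_{IV}(ij),\dots,C_{XI}(ij)$ ($i\ne j$)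 are embedded oriented closed curves in $F\setminus\{x\}$; there are $K=3n+8n(n-1)$ of them. Each $C$ meets each of the loops $E$ listed below exactly once, crossing it there, with intersection number $E\cdot C$ and longitude $\lambda_C(E)$ as listed. (The longitude $\lambda_C(E)\in\pi_1(F,x)$ follows $E$ up to the intersection point, runs once around $C$, and returns along the same part of $E$.) The curves of types I–III and VIII–XI miss all other loops $A_\ell,D_\ell$. Indices are cyclic; $p=\prod_{\ell=i+1}^{j-1}A_\ell B_\ell^{-1}$ and $q=\prod_{\ell=i}^{j}A_\ell B_\ell^{-1}$. The entries are $E:\lambda_C(E)\ (E\cdot C)$. - $C_I(i)$: $A_i:A_iD_iA_i^{-1}\ (-1)$. - $C_{II}(i)$: $D_i:D_iA_iD_i^{-1}\ (+1)$. - $C_{III}(i)$: $D_i:D_iA_i\ (+1)$; $A_i:A_iD_i\ (-1)$. - $C_{IV}(ij)$: $D_i:D_j^{-1}A_i\ (+1)$; $A_j:D_j^{-1}A_i\ (+1)$. - $C_V(ij)$: $A_i:D_jD_i\ (-1)$; $A_j:D_iD_j\ (-1)$. - $C_{VI}(ij)$: $A_i:A_iA_jA_iD_iA_i^{-1}\ (-1)$;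 $D_i:A_jA_iD_i\ (+1)$; $D_j:A_iD_iA_j\ (+1)$. - $C_{VII}(ij)$: $D_i:D_j^{-1}A_iD_i\ (+1)$; $A_i:A_iD_j^{-1}A_iD_iA_i^{-1}\ (-1)$; $A_j:D_j^{-1}A_iD_i\ (+1)$. - $C_{VIII}(ij)$: $D_i:pD_j^{-1}q^{-1}A_i\ (+1)$; $A_j:D_j^{-1}q^{-1}A_ip\ (+1)$. - $C_{IX}(ij)$: $D_i:pD_j^{-1}q^{-1}A_iD_i\ (+1)$; $A_j:D_j^{-1}q^{-1}A_iD_ip\ (+1)$; $A_i:A_ipD_j^{-1}q^{-1}A_iD_iA_i^{-1}\ (-1)$. - $C_X(ij)$: $A_i:qD_jp^{-1}D_i\ (-1)$; $A_j:p^{-1}D_iqD_j\ (-1)$. - $C_{XI}(ij)$: $D_i:pA_jq^{-1}A_iD_i\ (+1)$; $A_i:A_ipA_jq^{-1}A_iD_iA_i^{-1}\ (-1)$; $D_j:q^{-1}A_iD_ipA_j\ (+1)$. **The maps $\Phi_{\mathbf C}$.** Let $\mathbf C=(C_1,\dots,C_K)$ be any ordering of these curves. Let $N_k:S^1\times D^2\to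 F\times[0,1]$ be disjoint orientation-preserving tubular neighbourhoods of the curves $C_k\times\{\frac{k}{K+1}\}$, missing $\{x\}\times[0,1]$, such that the longitude $\lambda_k=N_k(S^1\times\{1\})$ is the push-off of $C_k$ in the $[0,1]$-direction; let $\mu_k=N_k(\{1\}\times\partial D^2)$ be the meridian. For $\mathbf t\in\mathbb R^K$ let $\mathcal M_{\mathbf t}(F\times[0,1])$ be the space of conjugacy classes of representations $\tilde\rho$ in $SU(2)$ of the fundamental group of the complement of these solid tori such that, for every $k$, $\tilde\rho(\lambda_k)=e^{\alpha Q}$ implies $\tilde\rho(\mu_k)=e^{t_k\sin(\alpha)Q}$. Restriction to $F\times\{0\}$ is a bijection $\mathcal M_{\mathbf t}(F\times[0,1])\to\mathcal M(F)$, and $\Phi_{\mathbf C}(-,\mathbf t):\mathcal M(F)\to\mathcal M(F)$ is its inverse followed by restriction to $F\times\{1\}$. **Proposition.** 1. If $\rho:\pi_1(F)\to SU(2)$ is abelian and $\operatorname{Re}\rho(A_i)=0$ for $i=1,\dots,n$, then the composite $T\circ\Phi_{\mathbf C}(\rho,-):\mathbb R^K\to\mathcal M(F)\to\mathbb R^n$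 is differentiable at $0$, with surjective differential at $0$. 2. The set $\mathcal M(F)^{U(1)}\cap T^{-1}(0)$ of conjugacy classes of such $\rho$ is compact. 3. There is a neighbourhood $U_3$ of $0$ in $\mathbb R^K$ such that $T\circ\Phi_{\mathbf C}(\rho,-):U_3\to\mathbb R^n$ is a (smooth) submersion for every $\rho\in\mathcal M(F)^{U(1)}\cap T^{-1}(0)$. -/

import Mathlib

open scoped Quaternion ContDiff Topology

noncomputable section

namespace TwistAbundance

/-! ### `SU(2)` as the unit quaternions; representations and character varieties -/

/-- `SU(2)`, identified with the group of unit quaternions. -/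
abbrev SU2 : Type := unitary ℍ[ℝ]

/-- `e^{α Q} = cos α + (sin α) Q`, for `Q` a purely imaginary unit quaternion. -/
def expIm (α : ℝ) (Q : ℍ[ℝ]) : ℍ[ℝ] := (Real.cos α : ℍ[ℝ]) + Real.sin α • Q

/-- The fundamental group in which the product `[p] * [q]` is the class of "first `p`, then `q`".
(Mathlib's `FundamentalGroup` multiplies in the opposite order.) -/
abbrev Pi1 (X : Type) [TopologicalSpace X] (x : X) : Type := (FundamentalGroup X x)ᵐᵒᵖ

/-- The class of a based loop. -/
def loopClass {X : Type} [TopologicalSpace X] {x : X} (p : Path x x) : Pi1 X x :=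
  MulOpposite.op (FundamentalGroup.fromPath (Path.Homotopic.Quotient.mk p))

/-- The space `Hom(G, SU(2))`. -/
def Rep (G : Type) [Group G] : Type := G →* SU2

/-- `Hom(G, SU(2))` carries the topology of pointwise convergence. -/
instance (G : Type) [Group G] : TopologicalSpace (Rep G) :=
  TopologicalSpace.induced (fun (ρ : G →* SU2) (a : G) => ρ a) inferInstance

/-- Two representations are conjugate if they differ by an inner automorphism of `SU(2)`. -/
def Conjugate {G : Type} [Group G] (ρ σ : G →* SU2) : Prop :=
  ∃ g : SU2, ∀ a : G, σ a = g * ρ a * g⁻¹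

theorem conjugate_refl {G : Type} [Group G] (ρ : G →* SU2) : Conjugate ρ ρ :=
  ⟨1, fun a => by simp⟩

theorem conjugate_symm {G : Type} [Group G] {ρ σ : G →* SU2} (h : Conjugate ρ σ) :
    Conjugate σ ρ := by
  obtain ⟨g, hg⟩ := h
  exact ⟨g⁻¹, fun a => by rw [hg a]; group⟩

theorem conjugate_trans {G : Type} [Group G] {ρ σ τ : G →* SU2} (h : Conjugate ρ σ)
    (h' : Conjugate σ τ) : Conjugate ρ τ := by
  obtain ⟨g, hg⟩ := h
  obtain ⟨g', hg'⟩ := h'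
  exact ⟨g' * g, fun a => by rw [hg' a, hg a]; group⟩

/-- The conjugation relation on `Hom(G, SU(2))`. -/
def conjSetoid (G : Type) [Group G] : Setoid (Rep G) where
  r ρ σ := Conjugate (G := G) ρ σ
  iseqv := ⟨conjugate_refl, conjugate_symm, conjugate_trans⟩

/-- The character variety `Hom(G, SU(2)) / conj`. -/
def CharVar (G : Type) [Group G] : Type := Quotient (conjSetoid G)

/-- The character variety carries the quotient topology. -/
instance (G : Type) [Group G] : TopologicalSpace (CharVar G) :=
  inferInstanceAs (TopologicalSpace (Quotient (conjSetoid G)))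

/-- The conjugacy class of a representation. -/
def CharVar.mk {G : Type} [Group G] (ρ : G →* SU2) : CharVar G :=
  Quotient.mk (conjSetoid G) ρ

/-- The stabilizer of a representation under the conjugation action of `SU(2)`. -/
def stabilizer {G : Type} [Group G] (ρ : G →* SU2) : Subgroup SU2 where
  carrier := {g | ∀ a, g * ρ a * g⁻¹ = ρ a}
  one_mem' := fun a => by simp
  mul_mem' := by
    intro g h hg hh a
    have : g * h * ρ a * (g * h)⁻¹ = g * (h * ρ a * h⁻¹) * g⁻¹ := by group
    rw [this, hh a, hg a]
  inv_mem' := by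
    intro g hg a
    have h1 : g⁻¹ * ρ a * g⁻¹⁻¹ = g⁻¹ * (g * ρ a * g⁻¹) * g := by
      rw [hg a]; group
    rw [h1]; group

/-- A representation is called abelian if its stabilizer is a circle `U(1)`. (A central
representation, whose stabilizer is all of `SU(2)`, is not called abelian.) -/
def IsAbelianRep {G : Type} [Group G] (ρ : G →* SU2) : Prop :=
  Nonempty (stabilizer ρ ≃* Circle)

/-- The stratum of conjugacy classes of representations with stabilizer `U(1)`. -/
def abelianStratum (G : Type) [Group G] : Set (CharVar G) :=
  {m | ∃ ρ : G →* SU2, IsAbelianRep ρ ∧ CharVar.mk ρ = m}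

/-! ### The closed surface `F` of genus `n` with its standard generators -/

/-- The closed unit disc, regarded as a `4n`-gon. -/
abbrev Disc : Type := Metric.closedBall (0 : ℂ) 1

/-- The boundary of the `4n`-gon, parametrized so that the integers are the vertices. -/
def bd (n : ℕ) (u : ℝ) : Disc :=
  ⟨(Circle.exp (2 * Real.pi * u / (4 * n)) : ℂ),
    mem_closedBall_zero_iff.2 (Circle.norm_coe _).le⟩

/-- The side identification of the `4n`-gon along the boundary word `∏ A_i D_i A_i⁻¹ D_i⁻¹`:
`A_i` runs along `[4i, 4i+1]` and along `[4i+2, 4i+3]` backwards, and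
`D_i` runs along `[4i+1, 4i+2]` and along `[4i+3, 4i+4]` backwards. -/
inductive Glue (n : ℕ) : Disc → Disc → Prop
  | sideA (i : Fin n) (s : ℝ) (hs : s ∈ Set.Icc (0 : ℝ) 1) :
      Glue n (bd n (4 * (i : ℕ) + s)) (bd n (4 * (i : ℕ) + 3 - s))
  | sideD (i : Fin n) (s : ℝ) (hs : s ∈ Set.Icc (0 : ℝ) 1) :
      Glue n (bd n (4 * (i : ℕ) + 1 + s)) (bd n (4 * (i : ℕ) + 4 - s))

/-- The closed oriented surface `F` of genus `n ≥ 1`: the `4n`-gon with its sides identified. -/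
def Surface (n : ℕ) : Type := Quot (Glue n)

instance (n : ℕ) : TopologicalSpace (Surface n) :=
  inferInstanceAs (TopologicalSpace (Quot (Glue n)))

/-- The image in `F` of the boundary point with parameter `u`. -/
def bdPt (n : ℕ) (u : ℝ) : Surface n := Quot.mk (Glue n) (bd n u)

/-- The base point of `F`: the common image of all the vertices of the polygon. -/
def base (n : ℕ) : Surface n := bdPt n 0

theorem continuous_bdPt (n : ℕ) : Continuous (bdPt n) := by
  refine continuous_quot_mk.comp ?_
  unfold bd
  refine Continuous.subtype_mk ?_ _
  fun_prop

theorem bdPt_step (n : ℕ) (i : Fin n) :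
    bdPt n (4 * (i : ℕ)) = bdPt n (4 * (i : ℕ) + 1) ∧
    bdPt n (4 * (i : ℕ)) = bdPt n (4 * (i : ℕ) + 2) ∧
    bdPt n (4 * (i : ℕ)) = bdPt n (4 * (i : ℕ) + 4) := by
  have h1 : bdPt n (4 * (i : ℕ) + 0) = bdPt n (4 * (i : ℕ) + 3 - 0) :=
    Quot.sound (Glue.sideA i 0 (by simp))
  have h2 : bdPt n (4 * (i : ℕ) + 1) = bdPt n (4 * (i : ℕ) + 3 - 1) :=
    Quot.sound (Glue.sideA i 1 (by simp))
  have h3 : bdPt n (4 * (i : ℕ) + 1 + 0) = bdPt n (4 * (i : ℕ) + 4 - 0) :=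
    Quot.sound (Glue.sideD i 0 (by simp))
  have h4 : bdPt n (4 * (i : ℕ) + 1 + 1) = bdPt n (4 * (i : ℕ) + 4 - 1) :=
    Quot.sound (Glue.sideD i 1 (by simp))
  have e1 : (4 * (i : ℕ) + 3 - 1 : ℝ) = 4 * (i : ℕ) + 2 := by ring
  have e2 : (4 * (i : ℕ) + 1 + 1 : ℝ) = 4 * (i : ℕ) + 2 := by ring
  have e3 : (4 * (i : ℕ) + 4 - 1 : ℝ) = 4 * (i : ℕ) + 3 := by ring
  rw [add_zero, sub_zero] at h1 h3
  rw [e1] at h2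
  rw [e2, e3] at h4
  exact ⟨(h1.trans h4.symm).trans h2.symm, h1.trans h4.symm,
    ((h1.trans h4.symm).trans h2.symm).trans h3⟩

theorem bdPt_four_mul (n : ℕ) : ∀ k : ℕ, k ≤ n → bdPt n (4 * k) = base n := by
  intro k
  induction k with
  | zero => intro _; simp [base]
  | succ k ih =>
    intro hk
    have h := (bdPt_step n ⟨k, hk⟩).2.2
    simp only at h
    rw [← ih (by omega), h]
    congr 1
    push_cast
    ring

/-- The indices of the standard generators `A_i`, `D_i`. -/
inductive Edge (n : ℕ) : Type
  | A (i : Fin n) : Edge n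
  | D (i : Fin n) : Edge n

/-- The parameter on the boundary of the polygon where the edge starts. -/
def Edge.start {n : ℕ} : Edge n → ℝ
  | .A i => 4 * (i : ℕ)
  | .D i => 4 * (i : ℕ) + 1

/-- The simple based loops `A_i` and `D_i` in `F`, given by the sides of the polygon. They stand
for the loops `γ_E * E * γ_E⁻¹` that consist of a simple closed curve and an arc to it. -/
def Edge.loop {n : ℕ} (E : Edge n) : Path (base n) (base n) where
  toFun s := bdPt n (E.start + s)
  continuous_toFun := (continuous_bdPt n).comp (by fun_prop)
  source' := by
    cases E with
    | A i => simpa [Edge.start] using bdPt_four_mul n i i.2.le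
    | D i =>
      simpa [Edge.start, ← (bdPt_step n i).1] using bdPt_four_mul n i i.2.le
  target' := by
    cases E with
    | A i =>
      simpa [Edge.start, ← (bdPt_step n i).1] using bdPt_four_mul n i i.2.le
    | D i =>
      have e : (4 * (i : ℕ) + 1 + 1 : ℝ) = 4 * (i : ℕ) + 2 := by ring
      simpa [Edge.start, e, ← (bdPt_step n i).2.1] using bdPt_four_mul n i i.2.le

/-- `π₁(F)`. -/
abbrev PiF (n : ℕ) : Type := Pi1 (Surface n) (base n)

/-- The generator `A_i` of `π₁(F)`. -/
def genA {n : ℕ} (i : Fin n) : PiF n := loopClass (Edge.A i).loop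

/-- The generator `D_i` of `π₁(F)`. -/
def genD {n : ℕ} (i : Fin n) : PiF n := loopClass (Edge.D i).loop

/-- The element `B_i = D_i A_i D_i⁻¹` of `π₁(F)`. -/
def genB {n : ℕ} (i : Fin n) : PiF n := genD i * genA i * (genD i)⁻¹

/-- The character variety `M(F)`. -/
abbrev MF (n : ℕ) : Type := CharVar (PiF n)

theorem re_conj (g q : SU2) : ((g * q * g⁻¹ : SU2) : ℍ[ℝ]).re = (q : ℍ[ℝ]).re := by
  have h : ∀ a b : ℍ[ℝ], (a * b).re = (b * a).re := by
    intro a b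
    simp only [Quaternion.re_mul]
    ring
  have h2 : ((g * q * g⁻¹ : SU2) : ℍ[ℝ]).re = ((g⁻¹ * (g * q) : SU2) : ℍ[ℝ]).re := by
    exact h ((g * q : SU2) : ℍ[ℝ]) ((g⁻¹ : SU2) : ℍ[ℝ])
  rw [h2, inv_mul_cancel_left]

/-- The trace map `T : M(F) → ℝⁿ`, `T(ρ) = (Re ρ(A_1), …, Re ρ(A_n))`. -/
def traceMap {n : ℕ} : MF n → (Fin n → ℝ) :=
  Quotient.lift (s := conjSetoid (PiF n))
    (fun (ρ : PiF n →* SU2) (i : Fin n) => ((ρ (genA i) : SU2) : ℍ[ℝ]).re) (by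
      rintro ρ σ ⟨g, hg⟩
      funext i
      exact ((congrArg (fun q : SU2 => (q : ℍ[ℝ]).re) (hg (genA i))).trans (re_conj g _)).symm)

/-! ### Framed simple closed curves in `F` -/

/-- An oriented embedded closed curve in `F` missing the base point, together with a tubular
neighbourhood `collar : S¹ × ℝ → F` of it, which also misses the base point. The curve itself is
`θ ↦ collar (θ, 0)`. -/
structure FramedCurve (n : ℕ) : Type where
  collar : Circle × ℝ → Surface n
  isOpenEmbedding : Topology.IsOpenEmbedding collar
  base_notMem : base n ∉ Set.range collar

/-- The curve, as a subset of `F`. -/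
def FramedCurve.core {n : ℕ} (C : FramedCurve n) : Set (Surface n) :=
  Set.range fun θ => C.collar (θ, 0)

/-- The loop that runs once around the curve in its direction, starting at `collar (θ, 0)`. -/
def FramedCurve.around {n : ℕ} (C : FramedCurve n) (θ : Circle) :
    Path (C.collar (θ, 0)) (C.collar (θ, 0)) where
  toFun s := C.collar (θ * Circle.exp (2 * Real.pi * s), 0)
  continuous_toFun := C.isOpenEmbedding.continuous.comp (by fun_prop)
  source' := by simp
  target' := by simp

/-- The loop `E` meets the curve `C` in exactly one point `E(τ) = collar (θ, 0)`, where it crosses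
from one side of the curve to the other, with `E · C = σ = ±1`. The sides are those of the collar.
For `F` oriented by the frame (direction of `S¹`, direction of `ℝ`) of the collar, `E · C = 1`
means that `E` crosses from the positive to the negative side. -/
def FramedCurve.CrossesOnceAt {n : ℕ} (C : FramedCurve n) (E : Path (base n) (base n))
    (σ : ℝ) (τ : unitInterval) (θ : Circle) : Prop :=
  E τ = C.collar (θ, 0) ∧ (∀ s, E s ∈ C.core → s = τ) ∧
  (∀ᶠ s in 𝓝[<] τ, ∃ θ' r, E s = C.collar (θ', r) ∧ 0 < σ * r) ∧
  (∀ᶠ s in 𝓝[>] τ, ∃ θ' r, E s = C.collar (θ', r) ∧ σ * r < 0)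

/-- The longitude of `C` with respect to `E`, at a common point `E(τ) = collar (θ, 0)`: travel
along `E` to the point, then once around `C`, then back along the same portion of `E`. -/
def FramedCurve.longitudeAt {n : ℕ} (C : FramedCurve n) (E : Path (base n) (base n))
    (τ : unitInterval) (θ : Circle) (h : E τ = C.collar (θ, 0)) : PiF n :=
  let p : Path (base n) (C.collar (θ, 0)) := (E.subpath 0 τ).cast E.source.symm h.symm
  loopClass (p.trans ((C.around θ).trans p.symm))

/-! ### The special perturbation curves -/

/-- Names of the special perturbation curves
`C_I(i), C_II(i), C_III(i)` and `C_IV(ij), …, C_XI(ij)` for `i ≠ j`. -/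
inductive CurveLabel (n : ℕ) : Type
  | I (i : Fin n) : CurveLabel n
  | II (i : Fin n) : CurveLabel n
  | III (i : Fin n) : CurveLabel n
  | IV (i j : Fin n) (h : i ≠ j) : CurveLabel n
  | V (i j : Fin n) (h : i ≠ j) : CurveLabel n
  | VI (i j : Fin n) (h : i ≠ j) : CurveLabel n
  | VII (i j : Fin n) (h : i ≠ j) : CurveLabel n
  | VIII (i j : Fin n) (h : i ≠ j) : CurveLabel n
  | IX (i j : Fin n) (h : i ≠ j) : CurveLabel n
  | X (i j : Fin n) (h : i ≠ j) : CurveLabel n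
  | XI (i j : Fin n) (h : i ≠ j) : CurveLabel n

/-- The index `i + k`, in the cyclic order of the sectors. -/
def cycAdd {n : ℕ} (i : Fin n) (k : ℕ) : Fin n :=
  ⟨((i : ℕ) + k) % n, Nat.mod_lt _ (Nat.lt_of_le_of_lt (Nat.zero_le _) i.2)⟩

/-- The number of steps from `i` to `j` in the cyclic order of the sectors. -/
def cycDist {n : ℕ} (i j : Fin n) : ℕ := ((j : ℕ) + n - (i : ℕ)) % n

/-- The ordered product `∏_{ℓ=i}^{j} A_ℓ B_ℓ⁻¹` over the cyclic interval from `i` to `j`. -/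
def prodClosed {n : ℕ} (i j : Fin n) : PiF n :=
  ((List.range (cycDist i j + 1)).map fun k =>
    genA (cycAdd i k) * (genB (cycAdd i k))⁻¹).prod

/-- The ordered product `∏_{ℓ=i+1}^{j-1} A_ℓ B_ℓ⁻¹` over the open cyclic interval. -/
def prodOpen {n : ℕ} (i j : Fin n) : PiF n :=
  ((List.range (cycDist i j - 1)).map fun k =>
    genA (cycAdd i (k + 1)) * (genB (cycAdd i (k + 1)))⁻¹).prod

/-- A standard generator `E` met by a curve `C`, the longitude `λ_C(E)`, and the sign `E · C`. -/
structure Row (n : ℕ) : Type where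
  edge : Edge n
  longitude : PiF n
  sign : ℝ

open Edge in
/-- For each special perturbation curve, the list of the standard generators that meet it (each in
one transverse point), with longitudes and signs. -/
def CurveLabel.rows {n : ℕ} : CurveLabel n → List (Row n)
  | .I i => [⟨A i, genA i * genD i * (genA i)⁻¹, -1⟩]
  | .II i => [⟨D i, genD i * genA i * (genD i)⁻¹, 1⟩]
  | .III i => [⟨D i, genD i * genA i, 1⟩, ⟨A i, genA i * genD i, -1⟩]
  | .IV i j _ => [⟨D i, (genD j)⁻¹ * genA i, 1⟩, ⟨A j, (genD j)⁻¹ * genA i, 1⟩]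
  | .V i j _ => [⟨A i, genD j * genD i, -1⟩, ⟨A j, genD i * genD j, -1⟩]
  | .VI i j _ =>
    [⟨A i, genA i * genA j * genA i * genD i * (genA i)⁻¹, -1⟩,
     ⟨D i, genA j * genA i * genD i, 1⟩,
     ⟨D j, genA i * genD i * genA j, 1⟩]
  | .VII i j _ =>
    [⟨D i, (genD j)⁻¹ * genA i * genD i, 1⟩,
     ⟨A i, genA i * (genD j)⁻¹ * genA i * genD i * (genA i)⁻¹, -1⟩,
     ⟨A j, (genD j)⁻¹ * genA i * genD i, 1⟩]
  | .VIII i j _ =>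
    [⟨D i, prodOpen i j * (genD j)⁻¹ * (prodClosed i j)⁻¹ * genA i, 1⟩,
     ⟨A j, (genD j)⁻¹ * (prodClosed i j)⁻¹ * genA i * prodOpen i j, 1⟩]
  | .IX i j _ =>
    [⟨D i, prodOpen i j * (genD j)⁻¹ * (prodClosed i j)⁻¹ * genA i * genD i, 1⟩,
     ⟨A j, (genD j)⁻¹ * (prodClosed i j)⁻¹ * genA i * genD i * prodOpen i j, 1⟩,
     ⟨A i, genA i * prodOpen i j * (genD j)⁻¹ * (prodClosed i j)⁻¹ * genA i * genD i *
       (genA i)⁻¹, -1⟩]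
  | .X i j _ =>
    [⟨A i, prodClosed i j * genD j * (prodOpen i j)⁻¹ * genD i, -1⟩,
     ⟨A j, (prodOpen i j)⁻¹ * genD i * prodClosed i j * genD j, -1⟩]
  | .XI i j _ =>
    [⟨D i, prodOpen i j * genA j * (prodClosed i j)⁻¹ * genA i * genD i, 1⟩,
     ⟨A i, genA i * prodOpen i j * genA j * (prodClosed i j)⁻¹ * genA i * genD i *
       (genA i)⁻¹, -1⟩,
     ⟨D j, (prodClosed i j)⁻¹ * genA i * genD i * prodOpen i j * genA j, 1⟩]

/-- The curves `C_IV(ij), …, C_VII(ij)` pass next to the base point, and cross the arcs that join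
the base point to the curves `A_ℓ`, `D_ℓ`, for `ℓ ≠ i, j`. -/
def CurveLabel.NearBase {n : ℕ} : CurveLabel n → Prop
  | .IV _ _ _ | .V _ _ _ | .VI _ _ _ | .VII _ _ _ => True
  | _ => False

/-- `C` is the special perturbation curve with the given name: an embedded curve that meets each
listed generator exactly once, with the listed sign and longitude, and that (except for the curves
that pass next to the base point) misses all the other standard generators. A longitude is in the
free homotopy class of `C`, so this determines the simple closed curve `C` up to isotopy. -/
def FramedCurve.IsSpecial {n : ℕ} (C : FramedCurve n) (l : CurveLabel n) : Prop :=
  (∀ R ∈ l.rows, ∃ (τ : unitInterval) (θ : Circle) (h : R.edge.loop τ = C.collar (θ, 0)),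
    C.CrossesOnceAt R.edge.loop R.sign τ θ ∧ C.longitudeAt R.edge.loop τ θ h = R.longitude) ∧
  (¬ l.NearBase → ∀ E : Edge n, (∀ R ∈ l.rows, R.edge ≠ E) → ∀ s, E.loop s ∉ C.core)

/-! ### Perturbations in the cylinder `F × I` along curves pushed in from `F` -/

variable {n K : ℕ}

/-- Height of the point `z` of the unit disc in the `k`-th solid torus: the curve `C_k`,
`k = 1, …, K`, is pushed to the height `k / (K + 1)`, so with `k` counted from `0` this is
`(k + 1) / (K + 1)`, and the real axis of the unit disc is vertical. -/
def height (K : ℕ) (k : Fin K) (z : Disc) : ℝ :=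
  ((k : ℕ) + 1 + (z : ℂ).re / 4) / (K + 1)

theorem abs_re_le (z : Disc) : |(z : ℂ).re| ≤ 1 :=
  (Complex.abs_re_le_norm _).trans (mem_closedBall_zero_iff.1 z.2)

theorem height_pos (k : Fin K) (z : Disc) : 0 < height K k z := by
  have h := abs_le.1 (abs_re_le z)
  have : (0 : ℝ) ≤ (k : ℕ) := Nat.cast_nonneg _
  unfold height
  apply div_pos <;> [linarith; positivity]

theorem height_lt_one (k : Fin K) (z : Disc) : height K k z < 1 := by
  have h := abs_le.1 (abs_re_le z)
  have hk : ((k : ℕ) : ℝ) + 1 ≤ K := by exact_mod_cast k.2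
  unfold height
  rw [div_lt_one (by positivity)]
  linarith

/-- The embedded solid tori `N_k : S¹ × D² → F × I`, tubular neighbourhoods of the curves pushed
into the cylinder. The point `1 ∈ ∂D²` is the vertical direction, so that the longitude is
the push off in the direction of `I`; the minus sign makes `N_k` orientation preserving (for `F`
oriented by the collar, and `F × I` with the product orientation). -/
def torus (C : Fin K → FramedCurve n) (k : Fin K) (θ : Circle) (z : Disc) :
    Surface n × unitInterval :=
  ((C k).collar (θ, -(z : ℂ).im), ⟨height K k z, (height_pos k z).le, (height_lt_one k z).le⟩)

/-- The complement in `F × I` of the interiors of the solid tori. -/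
def Exterior (C : Fin K → FramedCurve n) : Type :=
  {p : Surface n × unitInterval // ∀ k θ (z : Disc), ‖(z : ℂ)‖ < 1 → torus C k θ z ≠ p}

instance (C : Fin K → FramedCurve n) : TopologicalSpace (Exterior C) :=
  inferInstanceAs (TopologicalSpace {p : Surface n × unitInterval //
    ∀ k θ (z : Disc), ‖(z : ℂ)‖ < 1 → torus C k θ z ≠ p})

theorem torus_boundary (C : Fin K → FramedCurve n) (k : Fin K) (θ : Circle) (z : Disc)
    (hz : ‖(z : ℂ)‖ = 1) (k' : Fin K) (θ' : Circle) (z' : Disc) (hz' : ‖(z' : ℂ)‖ < 1) :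
    torus C k' θ' z' ≠ torus C k θ z := by
  intro h
  have h2 : height K k' z' = height K k z := congrArg (fun p => (p.2 : ℝ)) h
  have h1 : (C k').collar (θ', -(z' : ℂ).im) = (C k).collar (θ, -(z : ℂ).im) :=
    congrArg Prod.fst h
  have hK : (0 : ℝ) < K + 1 := by positivity
  unfold height at h2
  rw [div_left_inj' hK.ne'] at h2
  have a := abs_le.1 (abs_re_le z)
  have a' := abs_le.1 (abs_re_le z')
  have hk : k' = k := by
    apply Fin.ext
    rcases lt_trichotomy (k' : ℕ) (k : ℕ) with hlt | heq | hlt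
    · have : ((k' : ℕ) : ℝ) + 1 ≤ (k : ℕ) := by exact_mod_cast hlt
      linarith
    · exact heq
    · have : ((k : ℕ) : ℝ) + 1 ≤ (k' : ℕ) := by exact_mod_cast hlt
      linarith
  subst hk
  have h3 := (C k').isOpenEmbedding.injective h1
  have him : (z' : ℂ).im = (z : ℂ).im := by
    have := congrArg Prod.snd h3
    simpa using this
  have hre : (z' : ℂ).re = (z : ℂ).re := by linarith
  rw [Complex.ext hre him, hz] at hz'
  exact lt_irrefl _ hz'

/-- A point of the boundary of the `k`-th solid torus, with coordinates `(θ, w) ∈ S¹ × ∂D²`. -/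
def torusPt (C : Fin K → FramedCurve n) (k : Fin K) (θ w : Circle) : Exterior C :=
  ⟨torus C k θ ⟨(w : ℂ), mem_closedBall_zero_iff.2 (Circle.norm_coe w).le⟩,
    torus_boundary C k θ _ (Circle.norm_coe w)⟩

theorem continuous_torusPt (C : Fin K → FramedCurve n) (k : Fin K) :
    Continuous fun p : Circle × Circle => torusPt C k p.1 p.2 := by
  refine Continuous.subtype_mk ?_ _
  refine Continuous.prodMk ?_ (Continuous.subtype_mk ?_ _)
  · refine (C k).isOpenEmbedding.continuous.comp ?_
    fun_prop
  · simp only [height]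
    fun_prop

/-- The meridian `μ_k = N_k({1} × ∂D²)`. -/
def meridian (C : Fin K → FramedCurve n) (k : Fin K) :
    Path (torusPt C k 1 1) (torusPt C k 1 1) where
  toFun s := torusPt C k 1 (Circle.exp (2 * Real.pi * s))
  continuous_toFun := (continuous_torusPt C k).comp
    (by fun_prop : Continuous fun s : unitInterval =>
      ((1 : Circle), Circle.exp (2 * Real.pi * s)))
  source' := by simp
  target' := by simp

/-- The longitude `λ_k = N_k(S¹ × {1})`. -/
def longitude (C : Fin K → FramedCurve n) (k : Fin K) :
    Path (torusPt C k 1 1) (torusPt C k 1 1) where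
  toFun s := torusPt C k (Circle.exp (2 * Real.pi * s)) 1
  continuous_toFun := (continuous_torusPt C k).comp
    (by fun_prop : Continuous fun s : unitInterval =>
      (Circle.exp (2 * Real.pi * s), (1 : Circle)))
  source' := by simp
  target' := by simp

/-- The inclusion of `F × {0}`. -/
def inclBottom (C : Fin K → FramedCurve n) : C(Surface n, Exterior C) where
  toFun y := ⟨(y, 0), fun k θ z _ h =>
    (height_pos k z).ne' (congrArg (fun p => (p.2 : ℝ)) h)⟩
  continuous_toFun := Continuous.subtype_mk (by fun_prop) _

/-- The inclusion of `F × {1}`. -/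
def inclTop (C : Fin K → FramedCurve n) : C(Surface n, Exterior C) where
  toFun y := ⟨(y, 1), fun k θ z _ h =>
    (height_lt_one k z).ne (congrArg (fun p => (p.2 : ℝ)) h)⟩
  continuous_toFun := Continuous.subtype_mk (by fun_prop) _

/-- The path `{x} × I` from `(x, 0)` to `(x, 1)`, for `x` the base point of `F`. -/
def vertical (C : Fin K → FramedCurve n) :
    Path (inclBottom C (base n)) (inclTop C (base n)) where
  toFun s := ⟨(base n, s), fun k θ z _ h =>
    (C k).base_notMem ⟨_, congrArg (fun p => p.1) h⟩⟩
  continuous_toFun := Continuous.subtype_mk (by fun_prop) _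
  source' := rfl
  target' := rfl

/-- `π₁` of the complement of the solid tori, based at `(x, 0)`. -/
abbrev PiExt (C : Fin K → FramedCurve n) : Type := Pi1 (Exterior C) (inclBottom C (base n))

/-- The perturbation condition `ρ(μ_k) = F_k(ρ(λ_k))` for all `k`, where
`F_k(e^{α Q}) = e^{f_k(α) Q}` for `Q` a purely imaginary unit quaternion; the meridian and the
longitude are joined to the base point by the same path `w`. -/
def Perturbed (C : Fin K → FramedCurve n) (f : Fin K → ℝ → ℝ) (ρ : PiExt C →* SU2) : Prop :=
  ∀ (k : Fin K) (w : Path (inclBottom C (base n)) (torusPt C k 1 1)) (α : ℝ) (Q : ℍ[ℝ]),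
    Q.re = 0 → ‖Q‖ = 1 →
    ((ρ (loopClass (w.trans ((longitude C k).trans w.symm))) : SU2) : ℍ[ℝ]) = expIm α Q →
    ((ρ (loopClass (w.trans ((meridian C k).trans w.symm))) : SU2) : ℍ[ℝ]) = expIm (f k α) Q

/-- The conjugation relation on perturbed representations. -/
def pertSetoid (C : Fin K → FramedCurve n) (f : Fin K → ℝ → ℝ) :
    Setoid {ρ : PiExt C →* SU2 // Perturbed C f ρ} where
  r ρ σ := Conjugate ρ.1 σ.1
  iseqv := ⟨fun _ => conjugate_refl _, conjugate_symm, conjugate_trans⟩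

/-- The perturbed character variety `M_π(F × I)`. -/
def PertVar (C : Fin K → FramedCurve n) (f : Fin K → ℝ → ℝ) : Type :=
  Quotient (pertSetoid C f)

/-- Homomorphism of fundamental groups induced by the inclusion of `F × {0}`. -/
def bottomHom (C : Fin K → FramedCurve n) : PiF n →* PiExt C :=
  MonoidHom.op (FundamentalGroup.map (inclBottom C) (base n))

/-- Homomorphism of fundamental groups induced by the inclusion of `F × {1}`: a loop `e` goes to
the loop that travels along `{x} × I`, then along `e × {1}`, then back along `{x} × I`. -/
def topHom (C : Fin K → FramedCurve n) : PiF n →* PiExt C :=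
  MonoidHom.op
    ((FundamentalGroup.fundamentalGroupMulEquivOfPath (vertical C)).symm.toMonoidHom.comp
      (FundamentalGroup.map (inclTop C) (base n)))

/-- Restriction `M_π(F × I) → M(F × {0}) = M(F)`. -/
def restrictBottom (C : Fin K → FramedCurve n) (f : Fin K → ℝ → ℝ) : PertVar C f → MF n :=
  Quotient.lift (s := pertSetoid C f) (fun ρ => CharVar.mk (ρ.1.comp (bottomHom C))) (by
    rintro ρ σ ⟨g, hg⟩
    exact Quotient.sound (s := conjSetoid (PiF n)) ⟨g, fun a => hg (bottomHom C a)⟩)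

/-- Restriction `M_π(F × I) → M(F × {1}) = M(F)`. -/
def restrictTop (C : Fin K → FramedCurve n) (f : Fin K → ℝ → ℝ) : PertVar C f → MF n :=
  Quotient.lift (s := pertSetoid C f) (fun ρ => CharVar.mk (ρ.1.comp (topHom C))) (by
    rintro ρ σ ⟨g, hg⟩
    exact Quotient.sound (s := conjSetoid (PiF n)) ⟨g, fun a => hg (topHom C a)⟩)

open Classical in
/-- The map `Φ_π : M(F) → M(F)`: the inverse of the restriction to the bottom of the cylinder,
followed by the restriction to the top. (The restriction to the bottom is a bijection, so the
alternative in the definition never occurs.) -/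
def PhiPert (C : Fin K → FramedCurve n) (f : Fin K → ℝ → ℝ) (m : MF n) : MF n :=
  if h : ∃ y : PertVar C f, restrictBottom C f y = m then restrictTop C f h.choose else m

/-- `Φ_𝐂 : M(F) × ℝ^K → M(F)`: the map `Φ_π` for the perturbation data that consist of the curves
`C_1, …, C_K` pushed to the heights `k / (K + 1)`, with the functions `t_k sin α`. -/
def Phi (C : Fin K → FramedCurve n) (m : MF n) (t : Fin K → ℝ) : MF n :=
  PhiPert C (fun k α => t k * Real.sin α) m

end TwistAbundance

end

open TwistAbundance

/-! An abelian representation takes values in one circle `e^{αQ}`, so it is a character `χ` to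
`Circle`, and the problem becomes one about angles: `a_i` for `A_i` and `c_k` for the curve `C_k`.

Existence of the extension. For each `k` the exterior of the solid tori has a map to the circle,
`annulusMap`, dual to the vertical annulus joining the `k`-th torus to the top. Its winding number
is additive on loops and picks out the `k`-th meridian. Multiplying the pullback of `χ` under the
projection to `F` by the exponential of `∑ β_k ·` (winding number) therefore extends `χ` with value
`e^{iβ_k}` on the `k`-th meridian (`extendChar`). The extension is perturbed as soon as `β_k = t_k
sin(c_k + ∑_j L_{jk} β_j)`, where `L_{jk}` counts how often the `k`-th longitude crosses the `j`-th
annulus. Only curves above `C_j` cross that annulus, so the system is strictly triangular and `K`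
substitutions solve it, smoothly in `t` and `c`. On the top surface the angle of `A_i` becomes `a_i
+ ∑_k (A_i · C_k) β_k`, which gives an explicit formula for `T ∘ Φ` (`traceMap_Phi`).

Uniqueness of the extension. That this is the value of `Φ` requires a perturbed representation to be
determined by its restriction to the bottom. By `subgroup_exterior_eq_top`, a subgroup of the
fundamental group of the exterior is everything if it contains the loops of the bottom and contains
each meridian whose longitude it contains; this is applied to the equalizer of two perturbed
representations. In place of van Kampen's theorem, a section of the covering whose fibres are the
cosets of the subgroup is extended upwards, one solid torus at a time (`layer_step`); the only
obstruction is the monodromy around a meridian.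

Surjectivity. To first order `β_k = t_k sin c_k`, and `sin a_i = ±1` because `cos a_i = 0`. Each of
`C_I(i)` and `C_III(i)` meets `A_i` once and no other `A_ℓ`. Their values under `χ` are `χ(D_i)` and
`χ(A_i)χ(D_i)`, a quarter turn apart, so the squares of their sines add up to `1` and at least one
of the two curves moves the `i`-th trace.

Compactness and uniformity. Commuting image and vanishing real parts are closed conditions in a
product of copies of the compact group `SU(2)`. The angles that occur lie in the compact set
`angleSet`, the traces are jointly smooth in angles and parameters, and surjectivity of a linear map
is an open condition, so one neighbourhood of `0` serves all `ρ`. -/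

noncomputable section

namespace TwistAbundance

open CategoryTheory unitInterval

/-! ### Paths in the fundamental groupoid -/

section Groupoid

variable {X Y : Type} [TopologicalSpace X] [TopologicalSpace Y]

/-- The morphism of the fundamental groupoid given by a path. -/
def cls {p q : X} (a : Path p q) : FundamentalGroupoid.mk p ⟶ FundamentalGroupoid.mk q :=
  Path.Homotopic.Quotient.mk a

theorem cls_surjective {p q : X} (f : FundamentalGroupoid.mk p ⟶ FundamentalGroupoid.mk q) :
    ∃ a : Path p q, cls a = f :=
  Path.Homotopic.Quotient.mk_surjective f

theorem cls_trans {p q r : X} (a : Path p q) (b : Path q r) : cls (a.trans b) = cls a ≫ cls b :=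
  rfl

theorem cls_symm {p q : X} (a : Path p q) : cls a.symm = inv (cls a) := by
  rw [← Groupoid.inv_eq_inv]; rfl

theorem cls_refl (p : X) : cls (Path.refl p) = 𝟙 _ := rfl

theorem cls_eq_of_homotopic {p q : X} {a b : Path p q} (h : a.Homotopic b) : cls a = cls b :=
  Path.Homotopic.Quotient.eq.2 h

/-- The two ways around the boundary of a square are homotopic. -/
theorem cls_square {p q r s : X} (H : C(I × I, X)) (a : Path p q) (b : Path q r) (c : Path p s)
    (d : Path s r) (ha : ∀ t, a t = H (t, 0)) (hb : ∀ t, b t = H (1, t))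
    (hc : ∀ t, c t = H (0, t)) (hd : ∀ t, d t = H (t, 1)) :
    cls a ≫ cls b = cls c ≫ cls d := by
  have hp : H (0, 0) = p := by rw [← ha 0, a.source]
  have hq : H (1, 0) = q := by rw [← ha 1, a.target]
  have hr : H (1, 1) = r := by rw [← hb 1, b.target]
  have hs : H (0, 1) = s := by rw [← hc 1, c.target]
  subst hp hq hr hs
  let a' : Path ((0, 0) : I × I) (1, 0) := ⟨⟨fun t => (t, 0), by fun_prop⟩, rfl, rfl⟩
  let b' : Path ((1, 0) : I × I) (1, 1) := ⟨⟨fun t => (1, t), by fun_prop⟩, rfl, rfl⟩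
  let c' : Path ((0, 0) : I × I) (0, 1) := ⟨⟨fun t => (0, t), by fun_prop⟩, rfl, rfl⟩
  let d' : Path ((0, 1) : I × I) (1, 1) := ⟨⟨fun t => (t, 1), by fun_prop⟩, rfl, rfl⟩
  have : ContractibleSpace I := (convex_Icc (0 : ℝ) 1).contractibleSpace ⟨0, by simp⟩
  -- The square is simply connected, so its two boundary routes are already homotopic before `H` is
  -- applied.
  have h : (a'.trans b').Homotopic (c'.trans d') := SimplyConnectedSpace.paths_homotopic _ _
  have h2 := cls_eq_of_homotopic (h.map H)
  rw [Path.map_trans, Path.map_trans, cls_trans, cls_trans] at h2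
  have ea : a = a'.map H.continuous := Path.ext (funext ha)
  have eb : b = b'.map H.continuous := Path.ext (funext hb)
  have ec : c = c'.map H.continuous := Path.ext (funext hc)
  have ed : d = d'.map H.continuous := Path.ext (funext hd)
  rw [ea, eb, ec, ed]
  exact h2

/-! ### Labellings of subsets by cosets of a subgroup of the fundamental group -/

/-- A choice of a morphism from the base point to each point. -/
abbrev Labelling (x₀ : X) : Type := ∀ p : X, FundamentalGroupoid.mk x₀ ⟶ FundamentalGroupoid.mk p

variable {x₀ : X} (E : Subgroup (FundamentalGroup X x₀))

/-- Composition in the groupoid is multiplication in the opposite order in `FundamentalGroup`, hence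
the swapped arguments. -/
theorem comp_mem {f g : FundamentalGroupoid.mk x₀ ⟶ FundamentalGroupoid.mk x₀}
    (hf : f ∈ E) (hg : g ∈ E) : f ≫ g ∈ E :=
  E.mul_mem hg hf

theorem inv_mem' {f : FundamentalGroupoid.mk x₀ ⟶ FundamentalGroupoid.mk x₀}
    (hf : f ∈ E) : inv f ∈ E := by
  rw [← Groupoid.inv_eq_inv]
  exact E.inv_mem hf

/-- Two morphisms from the base point represent the same coset of `E`. -/
def SameCoset {p : X} (f g : FundamentalGroupoid.mk x₀ ⟶ FundamentalGroupoid.mk p) : Prop :=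
  f ≫ inv g ∈ E

variable {E}

theorem SameCoset.refl {p : X} (f : FundamentalGroupoid.mk x₀ ⟶ FundamentalGroupoid.mk p) :
    SameCoset E f f := by
  unfold SameCoset
  rw [IsIso.hom_inv_id]
  exact E.one_mem

theorem SameCoset.symm {p : X} {f g : FundamentalGroupoid.mk x₀ ⟶ FundamentalGroupoid.mk p}
    (h : SameCoset E f g) : SameCoset E g f := by
  have := inv_mem' E h
  unfold SameCoset
  simpa using this

theorem SameCoset.trans {p : X} {f g h : FundamentalGroupoid.mk x₀ ⟶ FundamentalGroupoid.mk p}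
    (h₁ : SameCoset E f g) (h₂ : SameCoset E g h) : SameCoset E f h := by
  have := comp_mem E h₁ h₂
  unfold SameCoset
  simpa using this

theorem SameCoset.comp {p q : X} {f g : FundamentalGroupoid.mk x₀ ⟶ FundamentalGroupoid.mk p}
    (h : SameCoset E f g) (a : FundamentalGroupoid.mk p ⟶ FundamentalGroupoid.mk q) :
    SameCoset E (f ≫ a) (g ≫ a) := by
  unfold SameCoset at h ⊢
  simpa using h

/-- The common factor cancels in `f ≫ inv g`, so two labels at a point may be compared at the far
end of any path. -/
theorem SameCoset.of_comp {p q : X} {f g : FundamentalGroupoid.mk x₀ ⟶ FundamentalGroupoid.mk p}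
    (a : FundamentalGroupoid.mk p ⟶ FundamentalGroupoid.mk q)
    (h : SameCoset E (f ≫ a) (g ≫ a)) : SameCoset E f g := by
  unfold SameCoset at h ⊢
  simpa using h

variable (E)

/-- Transport along paths in `A` preserves the cosets given by the labels. -/
def Flat (c : Labelling x₀) (A : Set X) : Prop :=
  ∀ ⦃p q : X⦄ (a : Path p q), (∀ t, a t ∈ A) → SameCoset E (c p ≫ cls a) (c q)

variable {E}

theorem Flat.mono {c : Labelling x₀} {A B : Set X} (h : Flat E c A) (hB : B ⊆ A) : Flat E c B :=
  fun _ _ a ha => h a fun t => hB (ha t)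

theorem Flat.congr {c c' : Labelling x₀} {A : Set X} (h : Flat E c A)
    (hc : ∀ p ∈ A, SameCoset E (c' p) (c p)) : Flat E c' A := by
  intro p q a ha
  have hp : p ∈ A := by simpa using ha 0
  have hq : q ∈ A := by simpa using ha 1
  exact (((hc p hp).comp (cls a)).trans (h a ha)).trans (hc q hq).symm

/-- Flatness is a local property. -/
theorem Flat.glue {c : Labelling x₀} {A U V OU OV : Set X} (hU : Flat E c U) (hV : Flat E c V)
    (hOU : IsOpen OU) (hOV : IsOpen OV) (hA : A ⊆ OU ∪ OV) (hAU : A ∩ OU ⊆ U)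
    (hAV : A ∩ OV ⊆ V) : Flat E c A := by
  intro p q a ha
  let O : Bool → Set I := fun b => a ⁻¹' (bif b then OU else OV)
  have hO : ∀ b, IsOpen (O b) := by
    rintro (_ | _)
    · exact hOV.preimage a.continuous
    · exact hOU.preimage a.continuous
  have hcov : Set.univ ⊆ ⋃ b, O b := by
    intro t _
    rcases hA (ha t) with h | h
    · exact Set.mem_iUnion.2 ⟨true, h⟩
    · exact Set.mem_iUnion.2 ⟨false, h⟩
  -- Lebesgue number: each piece of the subdivided path stays in one of the two open sets, where
  -- flatness is known.
  obtain ⟨t, t0, tm, ⟨N, hN⟩, ht⟩ := exists_monotone_Icc_subset_open_cover_unitInterval hO hcov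
  have key : ∀ k, SameCoset E (c (a 0) ≫ cls (a.subpath 0 (t k))) (c (a (t k))) := by
    intro k
    induction k with
    | zero =>
      rw [t0, Path.subpath_self, cls_refl, Category.comp_id]
      exact SameCoset.refl _
    | succ k ih =>
      have h1 := cls_eq_of_homotopic ⟨Path.Homotopy.subpathTransSubpath a 0 (t k) (t (k + 1))⟩
      rw [← h1, cls_trans, ← Category.assoc]
      refine (ih.comp _).trans ?_
      obtain ⟨b, hb⟩ := ht k
      have hr : ∀ s, ∃ r ∈ O b, a.subpath (t k) (t (k + 1)) s = a r := by
        intro s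
        have : a.subpath (t k) (t (k + 1)) s ∈ Set.range (a.subpath (t k) (t (k + 1))) := ⟨s, rfl⟩
        rw [Path.range_subpath_of_le _ _ _ (tm (Nat.le_succ k))] at this
        obtain ⟨r, hr, hr'⟩ := this
        exact ⟨r, hb hr, hr'.symm⟩
      cases b
      · refine hV _ fun s => ?_
        obtain ⟨r, hr, e⟩ := hr s
        rw [e]
        exact hAV ⟨ha r, hr⟩
      · refine hU _ fun s => ?_
        obtain ⟨r, hr, e⟩ := hr s
        rw [e]
        exact hAU ⟨ha r, hr⟩
  have h := key N
  rw [hN N le_rfl] at h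
  -- `subpath 0 1` has the type of the path only once the end points are replaced by the values at
  -- `0` and `1`.
  obtain ⟨f, h0, h1⟩ := a
  subst h0 h1
  have e : Path.subpath (⟨f, rfl, rfl⟩ : Path (f 0) (f 1)) 0 1 = ⟨f, rfl, rfl⟩ := by
    rw [Path.subpath_zero_one]; rfl
  rw [e] at h
  exact h

-- Labels have types depending on the point, so the chosen preimage is transported by `eqToHom`;
-- injectivity of `κ` makes that preimage the intended one.
open Classical in
theorem exists_labelling {Z : Type} (c : Labelling x₀) {κ : Z → X} (hκ : Function.Injective κ)
    (g : ∀ w, FundamentalGroupoid.mk x₀ ⟶ FundamentalGroupoid.mk (κ w)) :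
    ∃ c' : Labelling x₀, ∀ w, c' (κ w) = g w := by
  refine ⟨fun p => if hp : ∃ w, κ w = p then g hp.choose ≫ eqToHom (by rw [hp.choose_spec])
    else c p, fun w => ?_⟩
  have hp : ∃ w', κ w' = κ w := ⟨w, rfl⟩
  simp only [hp, dite_true]
  have aux : ∀ w' (_ : w' = w) (hh : FundamentalGroupoid.mk (κ w') = .mk (κ w)),
      g w' ≫ eqToHom hh = g w := by
    rintro w' rfl hh
    rw [eqToHom_refl, Category.comp_id]
  exact aux _ (hκ hp.choose_spec) _

theorem exists_lift_of_isEmbedding {κ : Y → X} (hκ : Topology.IsEmbedding κ) {p q : X}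
    (a : Path p q) (ha : ∀ t, a t ∈ Set.range κ) : ∃ b : C(I, Y), ∀ t, κ (b t) = a t :=
  ⟨⟨fun t => hκ.toHomeomorph.symm ⟨a t, ha t⟩, by fun_prop⟩, fun t =>
    congrArg Subtype.val (hκ.toHomeomorph.apply_symm_apply ⟨a t, ha t⟩)⟩

/-- The image of a path connected space is flat if the images of loops lie in `E`. -/
theorem exists_flat_range [PathConnectedSpace Y] (c : Labelling x₀) {κ : C(Y, X)}
    (hκ : Topology.IsEmbedding κ) {y₀ : Y} (hy : κ y₀ = x₀)
    (h : ∀ a : Path y₀ y₀, cls ((a.map κ.continuous).cast hy.symm hy.symm) ∈ E) :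
    ∃ c' : Labelling x₀, Flat E c' (Set.range κ) ∧ SameCoset E (c' x₀) (𝟙 _) := by
  subst hy
  let s : ∀ y, Path y₀ y := fun y => PathConnectedSpace.somePath y₀ y
  obtain ⟨c', hc'⟩ := exists_labelling c hκ.injective fun y => cls ((s y).map κ.continuous)
  refine ⟨c', ?_, ?_⟩
  · intro p q a ha
    obtain ⟨b, hb⟩ := exists_lift_of_isEmbedding hκ a ha
    have hp : κ (b 0) = p := by rw [hb, a.source]
    have hq : κ (b 1) = q := by rw [hb, a.target]
    subst hp hq
    let b' : Path (b 0) (b 1) := ⟨b, rfl, rfl⟩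
    have e : a = b'.map κ.continuous := Path.ext (funext fun t => (hb t).symm)
    -- The two labels differ by the image of this loop at `y₀`.
    have := h (((s _).trans b').trans (s _).symm)
    rw [Path.cast_rfl_rfl, Path.map_trans, Path.map_trans, cls_trans, cls_trans, ← Path.map_symm,
      cls_symm] at this
    rw [hc', hc', e]
    exact this
  · have := h (s y₀)
    unfold SameCoset
    rw [hc']
    rw [Path.cast_rfl_rfl] at this
    simpa using this

/-- Flatness is pulled back by a deformation of a set `range κ` into `A`. -/
theorem Flat.pull {c : Labelling x₀} {A : Set X} (h : Flat E c A) {κ : Y → X}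
    (hκ : Topology.IsEmbedding κ) (H : C(Y × I, X)) (h0 : ∀ w, H (w, 0) = κ w) (h1 : ∀ w, H (w, 1) ∈ A) :
    ∃ c' : Labelling x₀, Flat E c' (Set.range κ) ∧
      ∀ (w : Y) (g : Path (κ w) (H (w, 1))), (∀ t, g t = H (w, t)) →
        SameCoset E (c' (κ w) ≫ cls g) (c (H (w, 1))) := by
  let g : ∀ w, Path (κ w) (H (w, 1)) := fun w =>
    ⟨⟨fun t => H (w, t), by fun_prop⟩, h0 w, rfl⟩
  -- The new label is the old one at the end of the deformation, carried back along the track of the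
  -- point.
  obtain ⟨c', hc'⟩ := exists_labelling c hκ.injective fun w => c (H (w, 1)) ≫ inv (cls (g w))
  refine ⟨c', ?_, ?_⟩
  · intro p q a ha
    obtain ⟨b, hb⟩ := exists_lift_of_isEmbedding hκ a ha
    have hp : κ (b 0) = p := by rw [hb, a.source]
    have hq : κ (b 1) = q := by rw [hb, a.target]
    subst hp hq
    let d : Path (H (b 0, 1)) (H (b 1, 1)) := ⟨⟨fun t => H (b t, 1), by fun_prop⟩, rfl, rfl⟩
    have sq : cls a ≫ cls (g (b 1)) = cls (g (b 0)) ≫ cls d :=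
      cls_square ⟨fun st => H (b st.1, st.2), by fun_prop⟩ a _ _ d
        (fun t => by simp [h0, hb]) (fun t => rfl) (fun t => rfl) (fun t => rfl)
    have hd := h d fun t => h1 (b t)
    rw [hc', hc']
    refine SameCoset.of_comp (cls (g (b 1))) ?_
    simp only [Category.assoc, sq, IsIso.inv_hom_id_assoc, IsIso.inv_hom_id, Category.comp_id]
    exact hd
  · intro w g' hg'
    have : g' = g w := Path.ext (funext hg')
    rw [this, hc']
    simp only [Category.assoc, IsIso.inv_hom_id, Category.comp_id]
    exact SameCoset.refl _

/-- Where the deformation of `Flat.pull` is constant, the coset does not change. -/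
theorem SameCoset.of_pull {c c' : Labelling x₀} {κ : Y → X} {H : C(Y × I, X)}
    (h : ∀ (w : Y) (g : Path (κ w) (H (w, 1))), (∀ t, g t = H (w, t)) →
        SameCoset E (c' (κ w) ≫ cls g) (c (H (w, 1)))) (w : Y) (hfix : ∀ t, H (w, t) = κ w) :
    SameCoset E (c' (κ w)) (c (κ w)) := by
  have h1 := h w ((Path.refl (κ w)).cast rfl (hfix 1)) fun t => (hfix t).symm
  have h2 : ∀ (z : X) (hz : z = κ w),
      SameCoset E (c' (κ w) ≫ cls ((Path.refl (κ w)).cast rfl hz)) (c z) →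
      SameCoset E (c' (κ w)) (c (κ w)) := by
    rintro z rfl h
    have e : cls ((Path.refl (κ w)).cast rfl rfl) = 𝟙 _ := rfl
    rw [e, Category.comp_id] at h
    exact h
  exact h2 _ (hfix 1) h1

end Groupoid

open CategoryTheory unitInterval

/-! ### Winding numbers of circle-valued maps along paths -/

section Winding

variable {X Y : Type} [TopologicalSpace X] [TopologicalSpace Y]

/-- The total variation, in full turns, of the angle of `u` along a path. -/
def turn (u : C(X, Circle)) {p q : X} (f : FundamentalGroupoid.mk p ⟶ FundamentalGroupoid.mk q) :
    ℝ :=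
  ((Circle.isCoveringMap_exp.monodromy (Path.Homotopic.Quotient.map f u)
    ⟨Complex.arg (u p), Circle.exp_arg _⟩ : ℝ) - Complex.arg (u p)) / (2 * Real.pi)

/-- Shifting a lift by a constant makes it start at the principal argument, and by uniqueness it is
then the lift in the definition; hence any lift computes the winding. -/
theorem turn_cls (u : C(X, Circle)) {p q : X} (a : Path p q) (L : C(I, ℝ))
    (hL : ∀ t, Circle.exp (L t) = u (a t)) :
    turn u (cls a) = (L 1 - L 0) / (2 * Real.pi) := by
  let L' : C(I, ℝ) := ⟨fun t => L t - L 0 + Complex.arg (u p), by fun_prop⟩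
  have h0 : L' 0 = Complex.arg (u p) := by simp [L']
  have hp : Circle.exp (L 0) = u p := by rw [hL, a.source]
  have h : L' = Circle.isCoveringMap_exp.liftPath (a.map u.continuous) (Complex.arg (u p))
      (by simp) := by
    rw [Circle.isCoveringMap_exp.eq_liftPath_iff']
    refine ⟨funext fun t => ?_, h0⟩
    simp only [L', ContinuousMap.coe_mk, Function.comp_apply, Circle.exp_add, Circle.exp_sub, hL,
      Circle.exp_arg, a.source]
    simp
  have e : (Circle.isCoveringMap_exp.monodromy (Path.Homotopic.Quotient.map (cls a) u)
    ⟨Complex.arg (u p), Circle.exp_arg _⟩ : ℝ) = L' 1 := by rw [h]; rfl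
  rw [turn, e]
  simp [L']

theorem exists_angle (u : C(X, Circle)) {p q : X} (a : Path p q) (e : ℝ) (he : Circle.exp e = u p) :
    ∃ L : C(I, ℝ), L 0 = e ∧ ∀ t, Circle.exp (L t) = u (a t) := by
  have h0 : (a.map u.continuous : C(I, Circle)) 0 = Circle.exp e := by simp [he]
  refine ⟨Circle.isCoveringMap_exp.liftPath (a.map u.continuous) e h0,
    Circle.isCoveringMap_exp.liftPath_zero _ _ _, fun t => ?_⟩
  exact congrFun (Circle.isCoveringMap_exp.liftPath_lifts _ e h0) t

theorem turn_comp (u : C(X, Circle)) {p q r : X}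
    (f : FundamentalGroupoid.mk p ⟶ FundamentalGroupoid.mk q)
    (g : FundamentalGroupoid.mk q ⟶ FundamentalGroupoid.mk r) :
    turn u (f ≫ g) = turn u f + turn u g := by
  obtain ⟨a, rfl⟩ := cls_surjective f
  obtain ⟨b, rfl⟩ := cls_surjective g
  obtain ⟨L, -, hL⟩ := exists_angle u a _ (Circle.exp_arg _)
  obtain ⟨M, hM0, hM⟩ := exists_angle u b (L 1) (by rw [hL, a.target])
  let L' : Path (L 0) (L 1) := ⟨L, rfl, rfl⟩
  let M' : Path (L 1) (M 1) := ⟨M, hM0, rfl⟩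
  rw [← cls_trans, turn_cls u _ (L'.trans M' : C(I, ℝ)), turn_cls u a L hL, turn_cls u b M hM, hM0]
  · simp only [ContinuousMap.coe_coe, Path.source, Path.target]
    ring
  · intro t
    simp only [ContinuousMap.coe_coe, Path.trans_apply]
    split_ifs
    · exact hL _
    · exact hM _

theorem turn_id (u : C(X, Circle)) (p : X) : turn u (𝟙 (FundamentalGroupoid.mk p)) = 0 := by
  have := turn_comp u (𝟙 (FundamentalGroupoid.mk p)) (𝟙 _)
  rw [Category.comp_id] at this
  linarith

/-- The target `ℝ` is commutative, so the connecting path drops out. -/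
theorem turn_conj (u : C(X, Circle)) {p q : X}
    (f : FundamentalGroupoid.mk p ⟶ FundamentalGroupoid.mk q)
    (g : FundamentalGroupoid.mk q ⟶ FundamentalGroupoid.mk q) :
    turn u (f ≫ g ≫ inv f) = turn u g := by
  have h := turn_comp u f (inv f)
  rw [IsIso.hom_inv_id, turn_id] at h
  rw [turn_comp, turn_comp]
  linarith

theorem turn_cls_of_const (u : C(X, Circle)) {p q : X} (a : Path p q) (z : Circle)
    (h : ∀ t, u (a t) = z) : turn u (cls a) = 0 := by
  rw [turn_cls u a (ContinuousMap.const _ (Complex.arg z)) fun t => by simp [h, Circle.exp_arg]]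
  simp

theorem mem_slitPlane_of_ne_neg_one {z : Circle} (h : z ≠ -1) : (z : ℂ) ∈ Complex.slitPlane := by
  rw [Complex.mem_slitPlane_iff]
  by_contra! hc
  have h1 := Circle.normSq_coe z
  rw [Complex.normSq_apply, hc.2] at h1
  have h2 : (z : ℂ).re = -1 := by nlinarith [hc.1]
  apply h
  apply Circle.ext
  rw [Circle.coe_neg, Circle.coe_one]
  apply Complex.ext <;> simp [h2, hc.2]

/-- A loop in the circle that avoids `-1` has winding number zero. -/
theorem turn_cls_of_ne (u : C(X, Circle)) {p q : X} (a : Path p q) (h : ∀ t, u (a t) ≠ -1)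
    (hp : u p = 1) (hq : u q = 1) : turn u (cls a) = 0 := by
  have hc : Continuous fun t => Complex.arg (u (a t)) := by
    rw [continuous_iff_continuousAt]
    intro t
    exact (Complex.continuousAt_arg (mem_slitPlane_of_ne_neg_one (h t))).comp (f := fun t => (u (a t) : ℂ))
      (by fun_prop : Continuous fun t => (u (a t) : ℂ)).continuousAt
  rw [turn_cls u a ⟨_, hc⟩ fun t => by simp [Circle.exp_arg]]
  simp [hp, hq]

-- The principal argument is continuous away from `-1`. The one-sided signs of the imaginary part
-- say that it climbs to `π` at `τ` and resumes from `-π`, so adding `2π` after `τ` turns it into a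
-- continuous lift.
open Filter in
theorem exists_angle_of_crosses (v : C(I, Circle)) (τ : I) (h0 : v 0 = 1) (h1 : v 1 = 1)
    (hτ : v τ = -1) (h : ∀ s, v s = -1 → s = τ) (hl : ∀ᶠ s in 𝓝[<] τ, 0 < (v s : ℂ).im)
    (hr : ∀ᶠ s in 𝓝[>] τ, (v s : ℂ).im < 0) :
    ∃ L : C(I, ℝ), L 0 = 0 ∧ L 1 = 2 * Real.pi ∧ ∀ t, Circle.exp (L t) = v t := by
  classical
  have hne : (1 : Circle) ≠ -1 := by
    intro e
    have := congrArg (fun z : Circle => (z : ℂ).re) e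
    norm_num at this
  have hτ0 : 0 < τ := lt_of_le_of_ne τ.2.1 (by rintro rfl; exact hne (h0.symm.trans hτ))
  have hτ1 : τ < 1 := lt_of_le_of_ne τ.2.2 (by rintro rfl; exact hne (h1.symm.trans hτ))
  have hv : Continuous fun t => (v t : ℂ) := by fun_prop
  let L : I → ℝ := fun s => if s ≤ τ then Complex.arg (v s) else Complex.arg (v s) + 2 * Real.pi
  have hc : ∀ s, s ≠ τ → ContinuousAt (fun t => Complex.arg (v t)) s := fun s hs =>
    (Complex.continuousAt_arg (mem_slitPlane_of_ne_neg_one fun e => hs (h s e))).comp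
      (f := fun t => (v t : ℂ)) hv.continuousAt
  have vτ : (v τ : ℂ) = -1 := by rw [hτ]; simp
  have hL : Continuous L := by
    rw [continuous_iff_continuousAt]
    intro s
    rcases lt_trichotomy s τ with hs | rfl | hs
    · refine (hc s hs.ne).congr ?_
      filter_upwards [Iio_mem_nhds hs] with t ht
      simp [L, le_of_lt (show t < τ from ht)]
    · rw [continuousAt_iff_continuous_left'_right']
      have e : L s = Real.pi := by simp [L, vτ]
      constructor
      · have t1 : Tendsto (fun t => (v t : ℂ)) (𝓝[<] s) (𝓝[{z : ℂ | 0 ≤ z.im}] (-1)) := by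
          rw [tendsto_nhdsWithin_iff]
          refine ⟨vτ ▸ hv.continuousAt.continuousWithinAt, ?_⟩
          filter_upwards [hl] with t ht using ht.le
        have t2 := (Complex.continuousWithinAt_arg_of_re_neg_of_im_zero (z := -1)
          (by simp) (by simp)).tendsto.comp t1
        rw [Complex.arg_neg_one] at t2
        unfold ContinuousWithinAt
        rw [e]
        refine t2.congr' ?_
        filter_upwards [self_mem_nhdsWithin] with t ht
        simp [L, le_of_lt (show t < s from ht)]
      · have t1 : Tendsto (fun t => (v t : ℂ)) (𝓝[>] s) (𝓝[{z : ℂ | z.im < 0}] (-1)) := by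
          rw [tendsto_nhdsWithin_iff]
          exact ⟨vτ ▸ hv.continuousAt.continuousWithinAt, hr⟩
        have t2 := (Complex.tendsto_arg_nhdsWithin_im_neg_of_re_neg_of_im_zero (z := -1)
          (by simp) (by simp)).comp t1
        have t3 := t2.add_const (2 * Real.pi)
        unfold ContinuousWithinAt
        rw [e, show Real.pi = -Real.pi + 2 * Real.pi by ring]
        refine t3.congr' ?_
        filter_upwards [self_mem_nhdsWithin] with t ht
        simp [L, not_le_of_gt (show s < t from ht)]
    · refine ((hc s hs.ne').add_const (2 * Real.pi)).congr ?_
      filter_upwards [Ioi_mem_nhds hs] with t ht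
      simp [L, not_le_of_gt (show τ < t from ht)]
  refine ⟨⟨L, hL⟩, ?_, ?_, fun t => ?_⟩
  · simp [L, hτ0.le, h0]
  · simp [L, not_le_of_gt hτ1, h1]
  · simp only [L, ContinuousMap.coe_mk]
    split_ifs
    · exact Circle.exp_arg _
    · rw [Circle.exp_add_two_pi, Circle.exp_arg]

/-- A loop in the circle that crosses `-1` once has winding number `±1`. -/
theorem turn_cls_of_crosses (u : C(X, Circle)) {p q : X} (a : Path p q) (τ : I) (ε : ℝ)
    (hε : ε = 1 ∨ ε = -1) (hp : u p = 1) (hq : u q = 1) (hτ : u (a τ) = -1)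
    (h : ∀ s, u (a s) = -1 → s = τ) (hl : ∀ᶠ s in 𝓝[<] τ, 0 < ε * (u (a s) : ℂ).im)
    (hr : ∀ᶠ s in 𝓝[>] τ, ε * (u (a s) : ℂ).im < 0) : turn u (cls a) = ε := by
  have hpi := Real.pi_pos
  rcases hε with rfl | rfl
  · obtain ⟨L, L0, L1, hL⟩ := exists_angle_of_crosses ⟨fun s => u (a s), by fun_prop⟩ τ
      (by simp [hp]) (by simp [hq]) hτ h (by simpa using hl) (by simpa using hr)
    rw [turn_cls u a L hL, L0, L1]
    field_simp
    ring
  -- Inversion is complex conjugation on the circle, so it reduces the negative crossing to the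
  -- positive one.
  · obtain ⟨L, L0, L1, hL⟩ := exists_angle_of_crosses ⟨fun s => (u (a s))⁻¹, by fun_prop⟩ τ
      (by simp [hp]) (by simp [hq]) (by simp [hτ]) (fun s hs => h s (by
        simpa using congrArg (fun z => z⁻¹) hs))
      (by simpa [← Circle.coe_inv_eq_conj, Circle.coe_inv_eq_conj] using hl)
      (by simpa [← Circle.coe_inv_eq_conj, Circle.coe_inv_eq_conj] using hr)
    rw [turn_cls u a (-L) fun t => by simp [Circle.exp_neg, hL]]
    simp only [ContinuousMap.coe_neg, Pi.neg_apply, L0, L1]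
    field_simp
    ring

end Winding

open unitInterval

/-! ### The surface is Hausdorff and path connected -/

/-- Over a compact space a closed relation has closed saturations of closed sets, so `f` is a closed
map with compact fibres, that is, proper. Then `f × f` is closed too, and it maps the relation onto
the diagonal of `S`. -/
theorem t2Space_of_isQuotientMap {D S : Type} [TopologicalSpace D] [TopologicalSpace S]
    [CompactSpace D] [T2Space D] {f : D → S} (hf : Topology.IsQuotientMap f)
    (hR : IsClosed {p : D × D | f p.1 = f p.2}) : T2Space S := by
  have hc : IsClosedMap f := by
    intro A hA
    rw [← hf.isClosed_preimage]
    have e : f ⁻¹' (f '' A) = Prod.snd '' ({p : D × D | f p.1 = f p.2} ∩ Prod.fst ⁻¹' A) := by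
      ext z
      constructor
      · rintro ⟨w, hw, h⟩
        exact ⟨(w, z), ⟨h, hw⟩, rfl⟩
      · rintro ⟨⟨w, z'⟩, ⟨h, hw⟩, rfl⟩
        exact ⟨w, hw, h⟩
    rw [e]
    exact isClosedMap_snd_of_compactSpace _ (hR.inter (hA.preimage continuous_fst))
  have hp : IsProperMap f := by
    rw [isProperMap_iff_isClosedMap_and_compact_fibers]
    refine ⟨hf.continuous, hc, fun y => ?_⟩
    obtain ⟨x, rfl⟩ := hf.surjective y
    have : f ⁻¹' {f x} = {z | (z, x) ∈ {p : D × D | f p.1 = f p.2}} := rfl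
    rw [this]
    exact (hR.preimage (by fun_prop : Continuous fun z : D => (z, x))).isCompact
  rw [t2_iff_isClosed_diagonal]
  have e : Set.diagonal S = Prod.map f f '' {p : D × D | f p.1 = f p.2} := by
    ext ⟨a, b⟩
    constructor
    · intro (h : a = b)
      subst h
      obtain ⟨x, rfl⟩ := hf.surjective a
      exact ⟨(x, x), rfl, rfl⟩
    · rintro ⟨⟨x, y⟩, h, he⟩
      rw [← he]
      exact h
  rw [e]
  exact (hp.prodMap hp).isClosedMap _ hR

section

variable {n : ℕ}

theorem continuous_bd (n : ℕ) : Continuous (bd n) := by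
  unfold bd
  refine Continuous.subtype_mk ?_ _
  fun_prop

theorem bd_eq_bd (hn : 1 ≤ n) {u v : ℝ} : bd n u = bd n v ↔ ∃ m : ℤ, u = v + 4 * n * m := by
  have hn' : (0 : ℝ) < n := by exact_mod_cast hn
  have hpi := Real.pi_pos
  unfold bd
  rw [Subtype.mk.injEq, Circle.coe_inj, Circle.exp_eq_exp]
  refine exists_congr fun m => ?_
  constructor
  · intro h
    field_simp at h
    linarith
  · rintro rfl
    field_simp

/-- The vertices of the polygon. -/
def IsVertex (n : ℕ) (z : Disc) : Prop := ∃ k : ℕ, k < 4 * n ∧ z = bd n k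

theorem isVertex_bd_int (hn : 1 ≤ n) (m : ℤ) : IsVertex n (bd n m) := by
  have h4 : (0 : ℤ) < 4 * n := by omega
  refine ⟨(m % (4 * n)).toNat, ?_, ?_⟩
  · have := Int.emod_lt_of_pos m h4
    omega
  · rw [bd_eq_bd hn]
    refine ⟨m / (4 * n), ?_⟩
    have h1 : (((m % (4 * n)).toNat : ℕ) : ℤ) = m % (4 * n) :=
      Int.toNat_of_nonneg (Int.emod_nonneg _ h4.ne')
    have h2 := Int.emod_add_mul_ediv m (4 * n)
    rw [← h1] at h2
    exact_mod_cast h2.symm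

/-- The boundary parameter of the point with which the boundary point with parameter `u` is
identified. -/
def mate (u : ℝ) : ℝ := if ⌊u⌋ % 4 < 2 then 2 * ⌊u⌋ + 3 - u else 2 * ⌊u⌋ - 1 - u

theorem mate_add (u : ℝ) (m : ℤ) : mate (u + 4 * n * m) = mate u + 4 * n * m := by
  have h : ⌊u + 4 * n * m⌋ = ⌊u⌋ + 4 * n * m := by
    have := Int.floor_add_intCast u (4 * n * m)
    push_cast at this
    exact this
  have h2 : (⌊u⌋ + 4 * n * m) % 4 = ⌊u⌋ % 4 := by
    rw [mul_assoc]; omega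
  unfold mate
  rw [h, h2]
  push_cast
  split_ifs <;> ring

/-- The open sides of a sector are paired two apart with reversed direction, so the second
application uses the other branch. At an integer the floor of the image is off by one and the
argument breaks down. -/
theorem mate_mate {u : ℝ} (h : ∀ k : ℤ, u ≠ k) : mate (mate u) = u := by
  have h1 : (⌊u⌋ : ℝ) < u := lt_of_le_of_ne (Int.floor_le u) (h _).symm
  have h2 := Int.lt_floor_add_one u
  by_cases hm : ⌊u⌋ % 4 < 2
  · have e : mate u = 2 * ⌊u⌋ + 3 - u := by simp [mate, hm]
    have f : ⌊mate u⌋ = ⌊u⌋ + 2 := by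
      rw [Int.floor_eq_iff, e]
      push_cast
      constructor <;> linarith
    rw [mate, f, if_neg (by omega), e]
    push_cast
    ring
  · have e : mate u = 2 * ⌊u⌋ - 1 - u := by simp [mate, hm]
    have f : ⌊mate u⌋ = ⌊u⌋ - 2 := by
      rw [Int.floor_eq_iff, e]
      push_cast
      constructor <;> linarith
    rw [mate, f, if_pos (by omega), e]
    push_cast
    ring

theorem mate_ne_int {u : ℝ} (h : ∀ k : ℤ, u ≠ k) (k : ℤ) : mate u ≠ k := by
  unfold mate
  split_ifs
  · intro e
    apply h (2 * ⌊u⌋ + 3 - k)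
    push_cast
    linarith
  · intro e
    apply h (2 * ⌊u⌋ - 1 - k)
    push_cast
    linarith

/-- End points of sides are vertices, and in the interior of a side the identification is `mate`.
Both families of sides fit the scheme `key`: a side starting at `m`, parameter `s`, partner `v`. -/
theorem glue_cases (hn : 1 ≤ n) {z w : Disc} (h : Glue n z w) :
    (IsVertex n z ∧ IsVertex n w) ∨ ∃ u : ℝ, (∀ k : ℤ, u ≠ k) ∧ z = bd n u ∧ w = bd n (mate u) := by
  have key : ∀ (m : ℤ) (s : ℝ) (v : ℝ), s ∈ Set.Icc (0 : ℝ) 1 → (s = 0 → ∃ k : ℤ, v = k) →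
      (s = 1 → ∃ k : ℤ, v = k) → (0 < s → s < 1 → v = mate (m + s)) →
      (IsVertex n (bd n (m + s)) ∧ IsVertex n (bd n v)) ∨
        ∃ u : ℝ, (∀ k : ℤ, u ≠ k) ∧ bd n (m + s) = bd n u ∧ bd n v = bd n (mate u) := by
    intro m s v hs h0 h1 hv
    rcases eq_or_lt_of_le hs.1 with rfl | hs0
    · obtain ⟨k, rfl⟩ := h0 rfl
      left
      rw [add_zero]
      exact ⟨isVertex_bd_int hn _, isVertex_bd_int hn _⟩
    rcases eq_or_lt_of_le hs.2 with rfl | hs1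
    · obtain ⟨k, rfl⟩ := h1 rfl
      left
      have := isVertex_bd_int hn (m + 1)
      push_cast at this
      exact ⟨this, isVertex_bd_int hn _⟩
    right
    refine ⟨m + s, fun k hk => ?_, rfl, by rw [hv hs0 hs1]⟩
    have a : (m : ℝ) < k := by linarith
    have b : (k : ℝ) < m + 1 := by linarith
    norm_cast at a b
    omega
  have fl : ∀ (m : ℤ) (s : ℝ), 0 < s → s < 1 → ⌊(m : ℝ) + s⌋ = m := by
    intro m s h0 h1
    rw [Int.floor_eq_iff]
    constructor <;> linarith
  cases h with
  | sideA i s hs =>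
    have := key (4 * (i : ℕ)) s (4 * (i : ℕ) + 3 - s) hs
      (fun h => ⟨4 * (i : ℕ) + 3, by push_cast; rw [h]; ring⟩)
      (fun h => ⟨4 * (i : ℕ) + 2, by push_cast; rw [h]; ring⟩)
      (fun h0 h1 => by
        rw [mate, fl _ _ h0 h1, if_pos (by omega)]; push_cast; ring)
    push_cast at this
    exact this
  | sideD i s hs =>
    have := key (4 * (i : ℕ) + 1) s (4 * (i : ℕ) + 4 - s) hs
      (fun h => ⟨4 * (i : ℕ) + 4, by push_cast; rw [h]; ring⟩)
      (fun h => ⟨4 * (i : ℕ) + 3, by push_cast; rw [h]; ring⟩)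
      (fun h0 h1 => by
        rw [mate, fl _ _ h0 h1, if_pos (by omega)]; push_cast; ring)
    push_cast at this
    exact this

/-- The symmetric closure of the side identification. -/
def GlueSymm (n : ℕ) (z w : Disc) : Prop := Glue n z w ∨ Glue n w z

theorem glueSymm_cases (hn : 1 ≤ n) {z w : Disc} (h : GlueSymm n z w) :
    (IsVertex n z ∧ IsVertex n w) ∨ ∃ u : ℝ, (∀ k : ℤ, u ≠ k) ∧ z = bd n u ∧ w = bd n (mate u) := by
  rcases h with h | h
  · exact glue_cases hn h
  · rcases glue_cases hn h with h | ⟨u, hu, rfl, rfl⟩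
    · exact Or.inl h.symm
    · exact Or.inr ⟨mate u, mate_ne_int hu, rfl, by rw [mate_mate hu]⟩

/-- Identification of points of the polygon, made explicit. -/
def GlueEq (n : ℕ) (z w : Disc) : Prop :=
  z = w ∨ GlueSymm n z w ∨ (IsVertex n z ∧ IsVertex n w)

theorem bd_ne_int {u : ℝ} (hn : 1 ≤ n) (hu : ∀ k : ℤ, u ≠ k) : ¬ IsVertex n (bd n u) := by
  rintro ⟨k, -, h⟩
  obtain ⟨m, hm⟩ := (bd_eq_bd hn).1 h
  apply hu (k + 4 * n * m)
  rw [hm]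
  push_cast
  ring

/-- An interior point of a side has exactly one partner, since `mate` is an involution commuting
with full turns, and it is never a vertex. So chains of identifications collapse, except at
vertices, where the third alternative of `GlueEq` absorbs them. -/
theorem GlueEq.trans (hn : 1 ≤ n) {x y z : Disc} (h : GlueEq n x y) (h' : GlueEq n y z) :
    GlueEq n x z := by
  rcases h with rfl | h | ⟨hx, hy⟩
  · exact h'
  · rcases h' with rfl | h' | ⟨hy, hz⟩
    · exact Or.inr (Or.inl h)
    · rcases glueSymm_cases hn h.symm with ⟨hy, hx⟩ | ⟨u, hu, rfl, rfl⟩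
      · rcases glueSymm_cases hn h' with ⟨_, hz⟩ | ⟨v, hv, rfl, rfl⟩
        · exact Or.inr (Or.inr ⟨hx, hz⟩)
        · exact absurd hy (bd_ne_int hn hv)
      · rcases glueSymm_cases hn h' with ⟨hy, _⟩ | ⟨v, hv, e, rfl⟩
        · exact absurd hy (bd_ne_int hn hu)
        · obtain ⟨m, rfl⟩ := (bd_eq_bd hn).1 e
          left
          rw [mate_add, bd_eq_bd hn]
          exact ⟨m, rfl⟩
    · rcases glueSymm_cases hn h with ⟨hx, _⟩ | ⟨u, hu, rfl, rfl⟩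
      · exact Or.inr (Or.inr ⟨hx, hz⟩)
      · exact absurd hy (bd_ne_int hn (mate_ne_int hu))
  · rcases h' with rfl | h' | ⟨hy, hz⟩
    · exact Or.inr (Or.inr ⟨hx, hy⟩)
    · rcases glueSymm_cases hn h' with ⟨_, hz⟩ | ⟨u, hu, rfl, rfl⟩
      · exact Or.inr (Or.inr ⟨hx, hz⟩)
      · exact absurd hy (bd_ne_int hn hu)
    · exact Or.inr (Or.inr ⟨hx, hz⟩)

theorem GlueEq.symm {x y : Disc} (h : GlueEq n x y) : GlueEq n y x := by
  rcases h with rfl | h | h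
  · exact Or.inl rfl
  · exact Or.inr (Or.inl (Or.symm h))
  · exact Or.inr (Or.inr (And.symm h))

/-- The projection of the polygon onto the surface. -/
def toSurface (n : ℕ) (z : Disc) : Surface n := Quot.mk (Glue n) z

theorem mk_eq_base_of_isVertex {z : Disc} (h : IsVertex n z) :
    toSurface n z = base n := by
  obtain ⟨k, hk, rfl⟩ := h
  change bdPt n k = base n
  have hi : k / 4 < n := by omega
  have h4 := bdPt_four_mul n (k / 4) hi.le
  have hs := bdPt_step n ⟨k / 4, hi⟩
  simp only at hs
  -- `bdPt_step` covers only the offsets 1, 2 and 4 in a sector; offset 3 is the other end of the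
  -- side glued to `A`.
  have h3 : bdPt n (4 * (k / 4 : ℕ) + 0) = bdPt n (4 * (k / 4 : ℕ) + 3 - 0) :=
    Quot.sound (Glue.sideA ⟨k / 4, hi⟩ 0 (by simp))
  rw [add_zero, sub_zero] at h3
  have hk' : k = 4 * (k / 4) + k % 4 := (Nat.div_add_mod k 4).symm
  have hr : k % 4 = 0 ∨ k % 4 = 1 ∨ k % 4 = 2 ∨ k % 4 = 3 := by omega
  have e : (k : ℝ) = 4 * (k / 4 : ℕ) + (k % 4 : ℕ) := by exact_mod_cast hk'
  rw [e]
  rcases hr with h | h | h | h <;> rw [h]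
  · rw [Nat.cast_zero, add_zero, h4]
  · rw [Nat.cast_one, ← hs.1, h4]
  · rw [Nat.cast_two, ← hs.2.1, h4]
  · rw [show ((3 : ℕ) : ℝ) = 3 by norm_num, ← h3, h4]

theorem mk_eq_mk_iff (hn : 1 ≤ n) {z w : Disc} :
    toSurface n z = toSurface n w ↔ GlueEq n z w := by
  constructor
  · intro h
    have h' := Quot.eqvGen_exact h
    clear h
    induction h' with
    | rel x y h => exact Or.inr (Or.inl (Or.inl h))
    | refl x => exact Or.inl rfl
    | symm x y h ih => exact ih.symm
    | trans x y z h h' ih ih' =>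
      exact ih.trans hn ih'
  · rintro (rfl | (h | h) | ⟨h, h'⟩)
    · rfl
    · exact Quot.sound h
    · exact (Quot.sound h).symm
    · rw [mk_eq_base_of_isVertex h, mk_eq_base_of_isVertex h']

/-- The relation is a finite union of continuous images of `[0, 1]`. -/
theorem isClosed_glue (n : ℕ) : IsClosed {p : Disc × Disc | Glue n p.1 p.2} := by
  have e : {p : Disc × Disc | Glue n p.1 p.2} =
      (⋃ i : Fin n, (fun s : ℝ => (bd n (4 * (i : ℕ) + s), bd n (4 * (i : ℕ) + 3 - s))) ''
        Set.Icc 0 1) ∪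
      ⋃ i : Fin n, (fun s : ℝ => (bd n (4 * (i : ℕ) + 1 + s), bd n (4 * (i : ℕ) + 4 - s))) ''
        Set.Icc 0 1 := by
    ext ⟨z, w⟩
    simp only [Set.mem_ofPred_eq, Set.mem_union, Set.mem_iUnion, Set.mem_image, Prod.mk.injEq]
    constructor
    · intro h
      cases h with
      | sideA i s hs => exact Or.inl ⟨i, s, hs, rfl, rfl⟩
      | sideD i s hs => exact Or.inr ⟨i, s, hs, rfl, rfl⟩
    · rintro (⟨i, s, hs, rfl, rfl⟩ | ⟨i, s, hs, rfl, rfl⟩)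
      · exact Glue.sideA i s hs
      · exact Glue.sideD i s hs
  have hb := continuous_bd n
  rw [e]
  refine IsClosed.union ?_ ?_ <;>
  exact isClosed_iUnion_of_finite fun i => (isCompact_Icc.image (by fun_prop)).isClosed

theorem t2Space_surface (hn : 1 ≤ n) : T2Space (Surface n) := by
  refine t2Space_of_isQuotientMap (f := toSurface n) isQuotientMap_quot_mk ?_
  have hV : IsClosed {z : Disc | IsVertex n z} := by
    refine Set.Finite.isClosed (((Set.finite_lt_nat (4 * n)).image fun k : ℕ => bd n k).subset ?_)
    rintro z ⟨k, hk, rfl⟩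
    exact ⟨k, hk, rfl⟩
  have e : {p : Disc × Disc | toSurface n p.1 = toSurface n p.2} =
      Set.diagonal Disc ∪ ({p : Disc × Disc | Glue n p.1 p.2} ∪
        Prod.swap ⁻¹' {p : Disc × Disc | Glue n p.1 p.2} ∪
        {z : Disc | IsVertex n z} ×ˢ {z : Disc | IsVertex n z}) := by
    ext ⟨z, w⟩
    simp only [Set.mem_ofPred_eq, mk_eq_mk_iff hn, GlueEq, GlueSymm]
    simp [or_assoc]
  rw [e]
  exact isClosed_diagonal.union (((isClosed_glue n).union
    ((isClosed_glue n).preimage continuous_swap)).union (hV.prod hV))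

theorem pathConnectedSpace_surface (n : ℕ) : PathConnectedSpace (Surface n) := by
  have : PathConnectedSpace Disc := by
    have h : IsPathConnected (Metric.closedBall (0 : ℂ) 1) :=
      (convex_closedBall _ _).isPathConnected ⟨0, by simp⟩
    exact isPathConnected_iff_pathConnectedSpace.1 h
  exact (Quot.mk_surjective (r := Glue n)).pathConnectedSpace continuous_quot_mk

/-- The closed collar of width one is a closed subset of the surface. -/
theorem FramedCurve.isClosed_collar (hn : 1 ≤ n) (C : FramedCurve n) :
    IsClosed (C.collar '' {p | |p.2| ≤ 1}) := by
  have := t2Space_surface hn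
  have e : {p : Circle × ℝ | |p.2| ≤ 1} = Set.univ ×ˢ Set.Icc (-1) 1 := by
    ext p
    simp [abs_le]
  rw [e]
  exact ((isCompact_univ.prod isCompact_Icc).image C.isOpenEmbedding.continuous).isClosed

end

open CategoryTheory unitInterval

/-! ### The Pontryagin–Thom map of a framed curve -/

section ThomMap

variable {n : ℕ}

/-- Truncation to `[-1, 1]`. -/
def clamp (r : ℝ) : ℝ := max (-1) (min 1 r)

theorem continuous_clamp : Continuous clamp := by
  unfold clamp
  fun_prop

theorem abs_clamp_le (r : ℝ) : |clamp r| ≤ 1 := by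
  rw [abs_le]
  unfold clamp
  exact ⟨le_max_left _ _, max_le (by norm_num) (min_le_left _ _)⟩

theorem clamp_of_abs_le {r : ℝ} (h : |r| ≤ 1) : clamp r = r := by
  rw [abs_le] at h
  unfold clamp
  rw [min_eq_right h.2, max_eq_right h.1]

theorem clamp_of_one_le {r : ℝ} (h : 1 ≤ r) : clamp r = 1 := by
  unfold clamp
  rw [min_eq_left h, max_eq_right (by norm_num)]

theorem clamp_of_le_neg_one {r : ℝ} (h : r ≤ -1) : clamp r = -1 := by
  unfold clamp
  rw [min_eq_right (by linarith), max_eq_left h]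

theorem abs_clamp_eq_one {r : ℝ} (h : 1 ≤ |r|) : |clamp r| = 1 := by
  rcases le_abs'.1 h with h | h
  · rw [clamp_of_le_neg_one h]; norm_num
  · rw [clamp_of_one_le h]; norm_num

theorem mul_clamp_pos {e r : ℝ} (h : 0 < e * r) : 0 < e * clamp r := by
  rcases mul_pos_iff.1 h with ⟨he, hr⟩ | ⟨he, hr⟩
  · exact mul_pos he (lt_max_of_lt_right (lt_min one_pos hr))
  · refine mul_pos_of_neg_of_neg he (max_lt (by norm_num) (min_lt_of_right_lt hr))

open Classical in
/-- The map to the circle that wraps the collar of a framed curve around the circle, with the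
curve going to `-1`, and sends everything else to `1`. -/
def FramedCurve.thom (C : FramedCurve n) (y : Surface n) : Circle :=
  if h : ∃ p, C.collar p = y then Circle.exp (Real.pi * (1 - clamp h.choose.2)) else 1

theorem FramedCurve.thom_collar (C : FramedCurve n) (θ : Circle) (r : ℝ) :
    C.thom (C.collar (θ, r)) = Circle.exp (Real.pi * (1 - clamp r)) := by
  have h : ∃ p, C.collar p = C.collar (θ, r) := ⟨_, rfl⟩
  have e : h.choose = (θ, r) := C.isOpenEmbedding.injective h.choose_spec
  rw [thom, dif_pos h, e]

theorem FramedCurve.thom_of_notMem (C : FramedCurve n) {y : Surface n}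
    (h : y ∉ Set.range C.collar) : C.thom y = 1 :=
  dif_neg h

theorem FramedCurve.thom_base (C : FramedCurve n) : C.thom (base n) = 1 :=
  C.thom_of_notMem C.base_notMem

theorem exp_pi_eq_one {c : ℝ} (h : |c| = 1) : Circle.exp (Real.pi * (1 - c)) = 1 := by
  rcases eq_or_eq_neg_of_abs_eq h with rfl | rfl
  · simp
  · rw [show Real.pi * (1 - -1) = 2 * Real.pi by ring, Circle.exp_two_pi]

theorem FramedCurve.thom_collar_of_one_le (C : FramedCurve n) (θ : Circle) {r : ℝ} (h : 1 ≤ |r|) :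
    C.thom (C.collar (θ, r)) = 1 := by
  rw [C.thom_collar, exp_pi_eq_one (abs_clamp_eq_one h)]

/-- On the open collar there is a formula. At a point off the collar one uses that the closed collar
of width one is compact, hence closed in the Hausdorff surface, and that the map is `1` outside it.
-/
theorem FramedCurve.continuous_thom (hn : 1 ≤ n) (C : FramedCurve n) : Continuous C.thom := by
  rw [continuous_iff_continuousAt]
  intro y
  by_cases hy : y ∈ Set.range C.collar
  · obtain ⟨p, rfl⟩ := hy
    rw [← C.isOpenEmbedding.continuousAt_iff]
    have e : C.thom ∘ C.collar = fun p => Circle.exp (Real.pi * (1 - clamp p.2)) :=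
      funext fun p => C.thom_collar p.1 p.2
    rw [e]
    have := continuous_clamp
    exact Continuous.continuousAt (by fun_prop)
  · have hO : (C.collar '' {p | |p.2| ≤ 1})ᶜ ∈ 𝓝 y :=
      (C.isClosed_collar hn).isOpen_compl.mem_nhds fun ⟨p, _, hp⟩ => hy ⟨p, hp⟩
    refine (continuousAt_const (y := (1 : Circle))).congr ?_
    filter_upwards [hO] with z hz
    by_cases h : z ∈ Set.range C.collar
    · obtain ⟨p, rfl⟩ := h
      have hp : 1 ≤ |p.2| := by
        by_contra! hlt
        exact hz ⟨p, hlt.le, rfl⟩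
      exact (C.thom_collar_of_one_le p.1 hp).symm
    · exact (C.thom_of_notMem h).symm

theorem circle_exp_pi : Circle.exp Real.pi = -1 := by
  apply Circle.ext
  rw [Circle.coe_exp, Complex.exp_pi_mul_I, Circle.coe_neg, Circle.coe_one]

theorem FramedCurve.mem_core_of_thom_eq (C : FramedCurve n) {y : Surface n} (h : C.thom y = -1) :
    y ∈ C.core := by
  by_cases hy : y ∈ Set.range C.collar
  · obtain ⟨⟨θ, r⟩, rfl⟩ := hy
    rw [C.thom_collar, ← circle_exp_pi, Circle.exp_eq_exp] at h
    obtain ⟨m, hm⟩ := h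
    have hpi := Real.pi_pos
    have hc : clamp r = -(2 * m) := by
      have : Real.pi * (clamp r + 2 * m) = 0 := by linarith
      rcases mul_eq_zero.1 this with h | h <;> linarith
    have ha := abs_le.1 (abs_clamp_le r)
    rw [hc] at ha
    have h1 : (m : ℝ) < 1 := by linarith [ha.1]
    have h2 : (-1 : ℝ) < m := by linarith [ha.2]
    have hm0 : m = 0 := by
      have h1' : m < 1 := by exact_mod_cast h1
      have h2' : -1 < m := by exact_mod_cast h2
      omega
    rw [hm0] at hc
    have hr : r = 0 := by
      by_contra hr
      rcases lt_or_gt_of_ne hr with h0 | h0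
      · have := mul_clamp_pos (e := -1) (r := r) (by linarith)
        rw [hc] at this
        norm_num at this
      · have := mul_clamp_pos (e := 1) (r := r) (by linarith)
        rw [hc] at this
        norm_num at this
    exact ⟨θ, by rw [hr]⟩
  · rw [C.thom_of_notMem hy] at h
    have := congrArg (fun z : Circle => (z : ℂ).re) h
    norm_num at this

theorem FramedCurve.thom_core (C : FramedCurve n) (θ : Circle) : C.thom (C.collar (θ, 0)) = -1 := by
  rw [C.thom_collar, clamp_of_abs_le (by simp), sub_zero, mul_one, circle_exp_pi]

/-- The Pontryagin–Thom map, as a continuous map. -/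
def FramedCurve.thomMap (hn : 1 ≤ n) (C : FramedCurve n) : C(Surface n, Circle) :=
  ⟨C.thom, C.continuous_thom hn⟩

theorem FramedCurve.turn_thom_of_disjoint (hn : 1 ≤ n) (C : FramedCurve n)
    (E : Path (base n) (base n)) (h : ∀ s, E s ∉ C.core) : turn (C.thomMap hn) (cls E) = 0 :=
  turn_cls_of_ne _ _ (fun t ht => h t (C.mem_core_of_thom_eq ht)) C.thom_base C.thom_base

theorem sin_sign {e c : ℝ} (he : 0 < e * c) (hc : |c| < 1) : 0 < e * Real.sin (Real.pi * c) := by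
  have hpi := Real.pi_pos
  rw [abs_lt] at hc
  rcases mul_pos_iff.1 he with ⟨h1, h2⟩ | ⟨h1, h2⟩
  · exact mul_pos h1 (Real.sin_pos_of_pos_of_lt_pi (by positivity) (by nlinarith))
  · exact mul_pos_of_neg_of_neg h1 (Real.sin_neg_of_neg_of_neg_pi_lt (by nlinarith) (by nlinarith))

/-- In the collar the imaginary part of the Thom map is `sin (π · clamp r)`, which near the curve
has the sign of `r`. A change of side is thus a crossing of `-1` from one half plane to the other.
-/
theorem FramedCurve.turn_thom_of_crosses (hn : 1 ≤ n) (C : FramedCurve n)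
    (E : Path (base n) (base n)) {e : ℝ} (he : e = 1 ∨ e = -1) {τ : I} {θ : Circle}
    (h : C.CrossesOnceAt E e τ θ) : turn (C.thomMap hn) (cls E) = e := by
  obtain ⟨hτ, huniq, hl, hr⟩ := h
  have hτ' : C.thom (E τ) = -1 := by rw [hτ, C.thom_core]
  have hcont : Continuous fun s => C.thom (E s) := (C.continuous_thom hn).comp E.continuous
  -- This keeps `|clamp r| < 1`; at radius one the imaginary part would vanish.
  have hne : ∀ᶠ s in 𝓝 τ, C.thom (E s) ≠ 1 := by
    refine hcont.continuousAt.eventually_ne ?_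
    rw [hτ']
    intro h
    have := congrArg (fun z : Circle => (z : ℂ).re) h
    norm_num at this
  have him : ∀ (d : ℝ) (y : Surface n), C.thom y ≠ 1 → (∃ θ' r, y = C.collar (θ', r) ∧ 0 < d * r) →
      0 < d * (C.thom y : ℂ).im := by
    rintro d y hy ⟨θ', r, rfl, hr⟩
    rw [C.thom_collar] at hy ⊢
    have h1 : |clamp r| < 1 := lt_of_le_of_ne (abs_clamp_le r) fun h => hy (exp_pi_eq_one h)
    have h2 : ((Circle.exp (Real.pi * (1 - clamp r)) : Circle) : ℂ).im
        = Real.sin (Real.pi * clamp r) := by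
      rw [Circle.coe_exp, Complex.exp_ofReal_mul_I_im, mul_sub, mul_one, Real.sin_pi_sub]
    rw [h2]
    exact sin_sign (mul_clamp_pos hr) h1
  refine turn_cls_of_crosses _ _ τ e he C.thom_base C.thom_base hτ'
    (fun s hs => huniq s (C.mem_core_of_thom_eq hs)) ?_ ?_
  · filter_upwards [hl, hne.filter_mono nhdsWithin_le_nhds] with s h1 h2
    exact him e _ h2 h1
  · filter_upwards [hr, hne.filter_mono nhdsWithin_le_nhds] with s h1 h2
    obtain ⟨θ', r, h3, h4⟩ := h1
    have := him (-e) _ h2 ⟨θ', r, h3, by linarith⟩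
    change e * (C.thom (E s) : ℂ).im < 0
    linarith

end ThomMap

/-! ### The exterior of the solid tori and its maps to the circle -/

section Exterior

variable {n K : ℕ}

/-- The height coordinate, normalized so that the `k`-th solid torus is `a² + b² < 1`. -/
def lev (k : Fin K) (s : ℝ) : ℝ := 4 * ((K + 1) * s - ((k : ℕ) + 1))

theorem continuous_lev (k : Fin K) : Continuous (lev k) := by
  unfold lev
  fun_prop

theorem height_eq_iff (k : Fin K) (z : Disc) (s : ℝ) : height K k z = s ↔ (z : ℂ).re = lev k s := by
  have hK : (0 : ℝ) < K + 1 := by positivity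
  unfold height lev
  rw [div_eq_iff hK.ne']
  constructor <;> intro h <;> linarith

theorem lev_height (j k : Fin K) (z : Disc) :
    lev k (height K j z) = 4 * ((j : ℕ) - (k : ℕ)) + (z : ℂ).re := by
  have hK : (0 : ℝ) < K + 1 := by positivity
  unfold height lev
  field_simp
  ring

/-- The points outside of the solid tori, in coordinates. -/
theorem mem_exterior_iff (C : Fin K → FramedCurve n) (p : Surface n × I) :
    (∀ k θ (z : Disc), ‖(z : ℂ)‖ < 1 → torus C k θ z ≠ p) ↔
      ∀ k θ r, p.1 = (C k).collar (θ, r) → 1 ≤ lev k p.2 ^ 2 + r ^ 2 := by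
  constructor
  · intro h k θ r hr
    by_contra! hlt
    let z : ℂ := ⟨lev k p.2, -r⟩
    have hz : ‖z‖ < 1 := by
      rw [Complex.norm_eq_sqrt_sq_add_sq, Real.sqrt_lt' one_pos]
      simpa [z] using hlt
    refine h k θ ⟨z, mem_closedBall_zero_iff.2 hz.le⟩ hz (Prod.ext ?_ (Subtype.ext ?_))
    · simp only [torus, hr, z, neg_neg]
    · exact (height_eq_iff k _ _).2 rfl
  · rintro h k θ z hz rfl
    have := h k θ (-(z : ℂ).im) rfl
    have e : lev k (torus C k θ z).2 = (z : ℂ).re := ((height_eq_iff k z _).1 rfl).symm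
    rw [e] at this
    rw [Complex.norm_eq_sqrt_sq_add_sq, Real.sqrt_lt' one_pos] at hz
    nlinarith

/-- A point of the exterior. -/
def Exterior.mk' (C : Fin K → FramedCurve n) (y : Surface n) (s : I)
    (h : ∀ k θ r, y = (C k).collar (θ, r) → 1 ≤ lev k s ^ 2 + r ^ 2) : Exterior C :=
  ⟨(y, s), (mem_exterior_iff C (y, s)).2 h⟩

theorem Exterior.one_le {C : Fin K → FramedCurve n} (p : Exterior C) {k : Fin K} {θ : Circle}
    {r : ℝ} (h : p.1.1 = (C k).collar (θ, r)) : 1 ≤ lev k p.1.2 ^ 2 + r ^ 2 :=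
  (mem_exterior_iff C p.1).1 p.2 k θ r h

/-- The projection of the exterior to the surface. -/
def projMap (C : Fin K → FramedCurve n) : C(Exterior C, Surface n) :=
  ⟨fun p => p.1.1, continuous_fst.comp continuous_subtype_val⟩

/-- The map dual to the vertical annulus that joins the `k`-th torus to the top. -/
def annulusMap (hn : 1 ≤ n) (C : Fin K → FramedCurve n) (k : Fin K) : C(Exterior C, Circle) where
  toFun p := if lev k p.1.2 ≤ 0 then 1 else (C k).thom p.1.1
  continuous_toFun := by
    have hv : Continuous fun p : Exterior C => p.1 := continuous_subtype_val
    refine Continuous.if_le continuous_const ?_ ?_ continuous_const ?_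
    · exact ((C k).continuous_thom hn).comp (continuous_fst.comp hv)
    · exact (continuous_lev k).comp (continuous_subtype_val.comp (continuous_snd.comp hv))
    -- On level `0` a point of the collar outside the torus has `|r| ≥ 1`, where the Thom map is
    -- already `1`.
    · intro p hp
      by_cases h : p.1.1 ∈ Set.range (C k).collar
      · obtain ⟨⟨θ, r⟩, h⟩ := h
        have h1 := p.one_le h.symm
        rw [hp] at h1
        rw [← h, FramedCurve.thom_collar_of_one_le]
        rw [← sq_le_sq₀ (by norm_num) (abs_nonneg r), sq_abs]
        linarith
      · rw [(C k).thom_of_notMem h]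

theorem annulusMap_of_nonpos (hn : 1 ≤ n) (C : Fin K → FramedCurve n) (k : Fin K) (p : Exterior C)
    (h : lev k p.1.2 ≤ 0) : annulusMap hn C k p = 1 := if_pos h

theorem annulusMap_of_pos (hn : 1 ≤ n) (C : Fin K → FramedCurve n) (k : Fin K) (p : Exterior C)
    (h : 0 < lev k p.1.2) : annulusMap hn C k p = (C k).thom p.1.1 := if_neg (not_le.2 h)

theorem lev_torusPt (C : Fin K → FramedCurve n) (j k : Fin K) (θ w : Circle) :
    lev k (torusPt C j θ w).1.2 = 4 * ((j : ℕ) - (k : ℕ)) + (w : ℂ).re :=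
  lev_height j k _

theorem torusPt_fst (C : Fin K → FramedCurve n) (j : Fin K) (θ w : Circle) :
    (torusPt C j θ w).1.1 = (C j).collar (θ, -(w : ℂ).im) := rfl

theorem turn_congr {X Y : Type} [TopologicalSpace X] [TopologicalSpace Y] (u : C(X, Circle))
    (v : C(Y, Circle)) {p q : X} {p' q' : Y} (a : Path p q) (b : Path p' q')
    (h : ∀ t, u (a t) = v (b t)) : turn u (cls a) = turn v (cls b) := by
  obtain ⟨L, -, hL⟩ := exists_angle u a _ (Circle.exp_arg _)
  rw [turn_cls u a L hL, turn_cls v b L fun t => by rw [hL, h]]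

theorem abs_re_coe_le (w : Circle) : |(w : ℂ).re| ≤ 1 :=
  (Complex.abs_re_le_norm (w : ℂ)).trans_eq (Circle.norm_coe w)

/-- The projected meridian runs back and forth in one fibre of the collar; scaling the radial
coordinate contracts it. -/
theorem cls_map_meridian (C : Fin K → FramedCurve n) (j : Fin K) :
    cls ((meridian C j).map (projMap C).continuous) = 𝟙 _ := by
  have h : cls ((meridian C j).map (projMap C).continuous) ≫ cls (Path.refl _) =
      cls (Path.refl _) ≫ cls (Path.refl _) := by
    refine cls_square ⟨fun st => (C j).collar (1, -(1 - (st.2 : ℝ)) *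
      ((Circle.exp (2 * Real.pi * (st.1 : ℝ)) : Circle) : ℂ).im), ?_⟩ _ _ _ _ ?_ ?_ ?_ ?_
    · exact (C j).isOpenEmbedding.continuous.comp (by fun_prop)
    · intro t
      change (C j).collar (1, -((Circle.exp (2 * Real.pi * (t : ℝ)) : Circle) : ℂ).im) =
        (C j).collar (1, -(1 - ((0 : I) : ℝ)) * _)
      simp
    all_goals
      intro t
      change (C j).collar (1, -((1 : Circle) : ℂ).im) = (C j).collar (1, _)
      simp
  rw [cls_refl, Category.comp_id, Category.comp_id] at h
  exact h

/-- This is where the framing enters: the vertical push-off lies in the annulus over its own curve,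
so the map is constantly `-1` on it. -/
theorem turn_annulusMap_longitude_self (hn : 1 ≤ n) (C : Fin K → FramedCurve n) (k : Fin K) :
    turn (annulusMap hn C k) (cls (longitude C k)) = 0 := by
  refine turn_cls_of_const _ _ (-1) fun t => ?_
  rw [annulusMap_of_pos]
  · change (C k).thom (torusPt C k _ 1).1.1 = _
    rw [torusPt_fst]
    simpa using (C k).thom_core _
  · change 0 < lev k (torusPt C k _ 1).1.2
    rw [lev_torusPt]
    simp

/-- A lower torus lies entirely below the `k`-th annulus. -/
theorem turn_annulusMap_torus_of_lt (hn : 1 ≤ n) (C : Fin K → FramedCurve n) {j k : Fin K}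
    (h : j < k) {p q : Exterior C} (a : Path p q) (ha : ∀ t, ∃ θ w, a t = torusPt C j θ w) :
    turn (annulusMap hn C k) (cls a) = 0 := by
  refine turn_cls_of_const _ _ 1 fun t => annulusMap_of_nonpos _ _ _ _ ?_
  obtain ⟨θ, w, e⟩ := ha t
  rw [e, lev_torusPt]
  have h1 : ((j : ℕ) : ℝ) + 1 ≤ (k : ℕ) := by exact_mod_cast h
  have := (abs_le.1 (abs_re_coe_le w)).2
  linarith

/-- Above the `k`-th torus the map factors through the projection to `F`, which kills meridians. -/
theorem turn_annulusMap_meridian_of_gt (hn : 1 ≤ n) (C : Fin K → FramedCurve n) {j k : Fin K}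
    (h : k < j) : turn (annulusMap hn C k) (cls (meridian C j)) = 0 := by
  rw [turn_congr (annulusMap hn C k) ((C k).thomMap hn) (meridian C j)
    ((meridian C j).map (projMap C).continuous), cls_map_meridian, turn_id]
  intro t
  refine annulusMap_of_pos _ _ _ _ ?_
  change 0 < lev k (torusPt C j _ _).1.2
  rw [lev_torusPt]
  have h1 : ((k : ℕ) : ℝ) + 1 ≤ (j : ℕ) := by exact_mod_cast h
  have := (abs_le.1 (abs_re_coe_le (Circle.exp (2 * Real.pi * t)))).1
  linarith

/-- The lift `L` goes from `π` up to `2π` while the meridian descends to level `0`, rests there on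
the lower half of the circle, and continues to `3π` on the way back up. -/
theorem turn_annulusMap_meridian_self (hn : 1 ≤ n) (C : Fin K → FramedCurve n) (k : Fin K) :
    turn (annulusMap hn C k) (cls (meridian C k)) = 1 := by
  have hpi := Real.pi_pos
  let L : I → ℝ := fun s => if (s : ℝ) ≤ 1 / 4 then Real.pi + Real.pi * Real.sin (2 * Real.pi * s)
    else if (s : ℝ) ≤ 3 / 4 then 2 * Real.pi else 3 * Real.pi + Real.pi * Real.sin (2 * Real.pi * s)
  have e1 : 2 * Real.pi * (1 / 4) = Real.pi / 2 := by ring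
  have e3 : Real.sin (2 * Real.pi * (3 / 4)) = -1 := by
    rw [show 2 * Real.pi * (3 / 4) = Real.pi / 2 + Real.pi by ring, Real.sin_add_pi,
      Real.sin_pi_div_two]
  have hL : Continuous L := by
    refine Continuous.if_le (by fun_prop) (Continuous.if_le (by fun_prop) (by fun_prop)
      (by fun_prop) (by fun_prop) ?_) (by fun_prop) (by fun_prop) ?_
    · intro s hs
      rw [hs, e3]
      ring
    · intro s hs
      rw [hs, e1, Real.sin_pi_div_two, if_pos (by norm_num)]
      ring
  rw [turn_cls _ _ ⟨L, hL⟩]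
  · have h1 : ¬ (1 : ℝ) ≤ 1 / 4 := by norm_num
    have h2 : ¬ (1 : ℝ) ≤ 3 / 4 := by norm_num
    simp only [ContinuousMap.coe_mk, L, Set.Icc.coe_one, Set.Icc.coe_zero, if_neg h1, if_neg h2]
    norm_num
    field_simp
    ring
  · intro s
    have hlev : lev k (meridian C k s).1.2 = Real.cos (2 * Real.pi * s) := by
      change lev k (torusPt C k _ _).1.2 = _
      rw [lev_torusPt, Circle.coe_exp, Complex.exp_ofReal_mul_I_re]
      ring
    have hth : (C k).thom (meridian C k s).1.1 =
        Circle.exp (Real.pi * (1 + Real.sin (2 * Real.pi * s))) := by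
      change (C k).thom (torusPt C k _ _).1.1 = _
      rw [torusPt_fst, (C k).thom_collar, clamp_of_abs_le, Circle.coe_exp,
        Complex.exp_ofReal_mul_I_im, sub_neg_eq_add]
      rw [abs_neg, Circle.coe_exp, Complex.exp_ofReal_mul_I_im]
      exact Real.abs_sin_le_one _
    have hs0 := s.2.1
    have hs1 := s.2.2
    simp only [ContinuousMap.coe_mk, L]
    split_ifs with h1 h2
    · rcases eq_or_lt_of_le h1 with h1 | h1
      · rw [annulusMap_of_nonpos]
        · rw [h1, e1, Real.sin_pi_div_two, show Real.pi + Real.pi * 1 = 2 * Real.pi by ring,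
            Circle.exp_two_pi]
        · rw [hlev, h1, e1, Real.cos_pi_div_two]
      · rw [annulusMap_of_pos, hth]
        · ring_nf
        · rw [hlev]
          exact Real.cos_pos_of_mem_Ioo ⟨by nlinarith, by nlinarith⟩
    · rw [annulusMap_of_nonpos, Circle.exp_two_pi]
      rw [hlev]
      exact Real.cos_nonpos_of_pi_div_two_le_of_le (by nlinarith) (by nlinarith)
    · rw [annulusMap_of_pos, hth]
      · rw [show 3 * Real.pi + Real.pi * Real.sin (2 * Real.pi * s) =
          Real.pi * (1 + Real.sin (2 * Real.pi * s)) + 2 * Real.pi by ring, Circle.exp_add_two_pi]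
      · rw [hlev, ← Real.cos_sub_two_pi]
        exact Real.cos_pos_of_mem_Ioo ⟨by nlinarith, by nlinarith⟩

theorem turn_annulusMap_bottom (hn : 1 ≤ n) (C : Fin K → FramedCurve n) (k : Fin K)
    (g : PiF n) : turn (annulusMap hn C k) (bottomHom C g).unop = 0 := by
  obtain ⟨a, ha⟩ := cls_surjective (X := Surface n) (p := base n) (q := base n) g.unop
  have e : (bottomHom C g).unop = cls (a.map (inclBottom C).continuous) := by
    change Path.Homotopic.Quotient.map g.unop (inclBottom C) = _
    rw [← ha]
    rfl
  rw [e]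
  refine turn_cls_of_const _ _ 1 fun t => annulusMap_of_nonpos _ _ _ _ ?_
  change lev k ((0 : I) : ℝ) ≤ 0
  unfold lev
  simp only [Set.Icc.coe_zero]
  have : (0 : ℝ) ≤ (k : ℕ) := Nat.cast_nonneg _
  linarith

theorem topHom_loopClass (C : Fin K → FramedCurve n) (a : Path (base n) (base n)) :
    (topHom C (loopClass a)).unop =
      cls (vertical C) ≫ cls (a.map (inclTop C).continuous) ≫ inv (cls (vertical C)) := by
  rw [← Groupoid.inv_eq_inv]
  rfl

theorem turn_annulusMap_top (hn : 1 ≤ n) (C : Fin K → FramedCurve n) (k : Fin K)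
    (a : Path (base n) (base n)) :
    turn (annulusMap hn C k) (topHom C (loopClass a)).unop = turn ((C k).thomMap hn) (cls a) := by
  rw [topHom_loopClass, turn_conj]
  refine turn_congr _ _ _ _ fun t => annulusMap_of_pos _ _ _ _ ?_
  change 0 < lev k ((1 : I) : ℝ)
  unfold lev
  simp only [Set.Icc.coe_one]
  have : ((k : ℕ) : ℝ) + 1 ≤ K := by exact_mod_cast k.2
  linarith

end Exterior

open CategoryTheory unitInterval

/-! ### Generators of the fundamental group of the exterior -/

section Layers

variable {n K : ℕ}

/-- The height with given level coordinate. -/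
def lvl (k : Fin K) (a : ℝ) : I :=
  Set.projIcc 0 1 zero_le_one (((k : ℕ) + 1 + a / 4) / (K + 1))

theorem continuous_lvl (k : Fin K) : Continuous (lvl k) := by
  unfold lvl
  exact continuous_projIcc.comp (by fun_prop)

/-- Consecutive tori are four levels apart, so `|a| ≤ 2` is the slab belonging to the `k`-th torus;
it lies inside `[0, 1]`, and the truncation in `lvl` has no effect there. -/
theorem lev_lvl (k : Fin K) {a : ℝ} (h1 : -2 ≤ a) (h2 : a ≤ 2) : lev k (lvl k a) = a := by
  have hK : (0 : ℝ) < K + 1 := by positivity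
  have hk : ((k : ℕ) : ℝ) + 1 ≤ K := by exact_mod_cast k.2
  have hk0 : (0 : ℝ) ≤ (k : ℕ) := Nat.cast_nonneg _
  have hm : ((k : ℕ) + 1 + a / 4) / ((K : ℝ) + 1) ∈ Set.Icc (0 : ℝ) 1 := by
    constructor
    · apply div_nonneg _ hK.le
      linarith
    · rw [div_le_one hK]
      linarith
  rw [lvl, Set.projIcc_of_mem _ hm]
  unfold lev
  field_simp
  ring

theorem lvl_lev (k : Fin K) (s : I) : lvl k (lev k s) = s := by
  have hK : (0 : ℝ) < K + 1 := by positivity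
  have : ((k : ℕ) + 1 + lev k s / 4) / ((K : ℝ) + 1) = s := by
    unfold lev
    field_simp
    ring
  rw [lvl, this, Set.projIcc_val]

theorem lev_eq_add (j k : Fin K) (s : ℝ) : lev j s = lev k s + 4 * ((k : ℕ) - (j : ℕ)) := by
  unfold lev
  ring

theorem one_le_sq_of_two_le {a r : ℝ} (h : a ≤ -2 ∨ 2 ≤ a) : 1 ≤ a ^ 2 + r ^ 2 := by
  rcases h with h | h <;> nlinarith [sq_nonneg r]

/-- Inside the slab of the `k`-th torus every other torus has its centre at least two levels away,
so only the `k`-th one must be avoided. -/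
theorem band_mem (C : Fin K → FramedCurve n) (k : Fin K) (y : Surface n) {a : ℝ} (h1 : -2 ≤ a)
    (h2 : a ≤ 2) (h : ∀ θ r, y = (C k).collar (θ, r) → 1 ≤ a ^ 2 + r ^ 2) (j : Fin K) (θ : Circle)
    (r : ℝ) (hy : y = (C j).collar (θ, r)) : 1 ≤ lev j (lvl k a) ^ 2 + r ^ 2 := by
  rcases lt_trichotomy j k with hj | rfl | hj
  · apply one_le_sq_of_two_le
    right
    have : ((j : ℕ) : ℝ) + 1 ≤ (k : ℕ) := by exact_mod_cast hj
    rw [lev_eq_add j k, lev_lvl k h1 h2]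
    linarith
  · rw [lev_lvl j h1 h2]
    exact h θ r hy
  · apply one_le_sq_of_two_le
    left
    have : ((k : ℕ) : ℝ) + 1 ≤ (j : ℕ) := by exact_mod_cast hj
    rw [lev_eq_add j k, lev_lvl k h1 h2]
    linarith

theorem collar_band_mem (C : Fin K → FramedCurve n) (k : Fin K) (θ : Circle) {r a : ℝ}
    (h1 : -2 ≤ a) (h2 : a ≤ 2) (h : 1 ≤ a ^ 2 + r ^ 2) (j : Fin K) (θ' : Circle)
    (r' : ℝ) (hy : (C k).collar (θ, r) = (C j).collar (θ', r')) :
    1 ≤ lev j (lvl k a) ^ 2 + r' ^ 2 := by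
  refine band_mem C k _ h1 h2 ?_ j θ' r' hy
  intro θ₁ r₁ h'
  have := (C k).isOpenEmbedding.injective h'
  simp only [Prod.mk.injEq] at this
  rw [← this.2]
  exact h

theorem Exterior.ext' {C : Fin K → FramedCurve n} {p q : Exterior C} (h1 : p.1.1 = q.1.1)
    (h2 : p.1.2 = q.1.2) : p = q :=
  Subtype.ext (Prod.ext h1 h2)

theorem continuous_exterior_mk {Z : Type} [TopologicalSpace Z] {C : Fin K → FramedCurve n}
    {y : Z → Surface n} {s : Z → I} (hy : Continuous y) (hs : Continuous s)
    (h : ∀ z k θ r, y z = (C k).collar (θ, r) → 1 ≤ lev k (s z) ^ 2 + r ^ 2) :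
    Continuous fun z => Exterior.mk' C (y z) (s z) (h z) :=
  Continuous.subtype_mk (hy.prodMk hs) _

theorem Exterior.continuous_val (C : Fin K → FramedCurve n) :
    Continuous fun p : Exterior C => p.1 :=
  continuous_subtype_val

/-- The points near the `k`-th torus that do not lie above it. -/
def beside (C : Fin K → FramedCurve n) (k : Fin K) : Set (Exterior C) :=
  {p | lev k p.1.2 ≤ 2 ∧ (lev k p.1.2 < 0 ∨ p.1.1 ∉ (C k).collar '' {q | |q.2| ≤ 1})}

/-- Coordinates on the part of the exterior that lies in the `k`-th collar, above or beside the
`k`-th torus. -/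
def Above (k : Fin K) : Type :=
  {w : (Circle × ℝ) × I // -(1 / 4) < lev k w.2 ∧ lev k w.2 ≤ 2 ∧ 1 ≤ lev k w.2 ^ 2 + w.1.2 ^ 2}

instance (k : Fin K) : TopologicalSpace (Above k) := inferInstanceAs (TopologicalSpace {w : (Circle × ℝ) × I //
  -(1 / 4) < lev k w.2 ∧ lev k w.2 ≤ 2 ∧ 1 ≤ lev k w.2 ^ 2 + w.1.2 ^ 2})

theorem above_mem (C : Fin K → FramedCurve n) (k : Fin K) (w : Above k) (j : Fin K)
    (θ : Circle) (r : ℝ) (h : (C k).collar w.1.1 = (C j).collar (θ, r)) :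
    1 ≤ lev j w.1.2 ^ 2 + r ^ 2 := by
  have := collar_band_mem C k w.1.1.1 (by linarith [w.2.1]) w.2.2.1 w.2.2.2 j θ r h
  rwa [lvl_lev] at this

/-- The inclusion into the exterior. -/
def aboveIncl (C : Fin K → FramedCurve n) (k : Fin K) (w : Above k) : Exterior C :=
  Exterior.mk' C ((C k).collar w.1.1) w.1.2 (above_mem C k w)

theorem isEmbedding_aboveIncl (C : Fin K → FramedCurve n) (k : Fin K) :
    Topology.IsEmbedding (aboveIncl C k) := by
  have h1 : Topology.IsEmbedding (Prod.map (C k).collar id : (Circle × ℝ) × I → Surface n × I) :=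
    (C k).isOpenEmbedding.isEmbedding.prodMap Topology.IsEmbedding.id
  have h2 : Topology.IsEmbedding (fun w : Above k => w.1) := Topology.IsEmbedding.subtypeVal
  have h3 : Topology.IsEmbedding (fun p : Exterior C => p.1) := Topology.IsEmbedding.subtypeVal
  exact (h3.of_comp_iff (f := aboveIncl C k)).1 (h1.comp h2)

theorem mem_range_aboveIncl (C : Fin K → FramedCurve n) (k : Fin K) (p : Exterior C) :
    p ∈ Set.range (aboveIncl C k) ↔
      -(1 / 4) < lev k p.1.2 ∧ lev k p.1.2 ≤ 2 ∧ p.1.1 ∈ Set.range (C k).collar := by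
  constructor
  · rintro ⟨w, rfl⟩
    exact ⟨w.2.1, w.2.2.1, _, rfl⟩
  · rintro ⟨h1, h2, q, h3⟩
    exact ⟨⟨(q, p.1.2), h1, h2, p.one_le h3.symm⟩, Exterior.ext' h3 rfl⟩

/-- A point beside the torus can descend vertically to level `-2`: below level `0` this increases
the distance from the torus, and outside the collar of width one it never meets the torus. -/
theorem exists_push_down (C : Fin K → FramedCurve n) (k : Fin K) :
    ∃ H : C(beside C k × I, Exterior C), (∀ w, H (w, 0) = w.1) ∧
      (∀ w, lev k (H (w, 1)).1.2 ≤ -2) ∧ ∀ w, lev k w.1.1.2 ≤ -2 → ∀ t, H (w, t) = w.1 := by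
  let lv : beside C k × I → ℝ := fun z =>
    (1 - (z.2 : ℝ)) * lev k z.1.1.1.2 + z.2 * min (lev k z.1.1.1.2) (-2)
  have hlow : ∀ z, lev k z.1.1.1.2 ≤ -2 → lv z = lev k z.1.1.1.2 := by
    intro z hz
    simp only [lv, min_eq_left hz]
    ring
  have hhigh : ∀ z, -2 ≤ lev k z.1.1.1.2 → -2 ≤ lv z ∧ lv z ≤ lev k z.1.1.1.2 := by
    intro z hz
    simp only [lv, min_eq_right hz]
    have := z.2.2.1
    have := z.2.2.2
    constructor <;> nlinarith
  have hv : Continuous fun z : beside C k × I => z.1.1.1 :=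
    (Exterior.continuous_val C).comp (continuous_subtype_val.comp continuous_fst)
  have hl : Continuous fun z : beside C k × I => lev k z.1.1.1.2 :=
    (continuous_lev k).comp (continuous_subtype_val.comp (continuous_snd.comp hv))
  have hlv : Continuous lv := by
    simp only [lv]
    fun_prop
  have hmem : ∀ z j θ r, z.1.1.1.1 = (C j).collar (θ, r) →
      1 ≤ lev j (lvl k (lv z)) ^ 2 + r ^ 2 := by
    intro z j θ r h
    rcases le_total (lev k z.1.1.1.2) (-2) with hz | hz
    · rw [hlow z hz, lvl_lev]
      exact z.1.1.one_le h
    · obtain ⟨h1, h2⟩ := hhigh z hz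
      refine band_mem C k _ h1 (h2.trans z.1.2.1) ?_ j θ r h
      intro θ' r' h'
      rcases z.1.2.2 with h0 | h0
      · have := z.1.1.one_le h'
        nlinarith
      · have : 1 < |r'| := by
          by_contra! hle
          exact h0 ⟨_, hle, h'.symm⟩
        have : 1 < r' ^ 2 := by
          rw [← sq_abs]
          nlinarith
        nlinarith [sq_nonneg (lv z)]
  refine ⟨⟨_, continuous_exterior_mk (C := C) (y := fun z => z.1.1.1.1) (s := fun z => lvl k (lv z))
    (continuous_fst.comp hv) ((continuous_lvl k).comp hlv) hmem⟩, fun w => ?_, fun w => ?_,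
    fun w hw t => ?_⟩
  · refine Exterior.ext' rfl ?_
    change lvl k (lv (w, 0)) = _
    have : lv (w, 0) = lev k w.1.1.2 := by simp [lv]
    rw [this, lvl_lev]
  · change lev k (lvl k (lv (w, 1))) ≤ -2
    rcases le_total (lev k w.1.1.2) (-2) with hz | hz
    · rw [hlow (w, 1) hz, lvl_lev]
      exact hz
    · have : lv (w, 1) = -2 := by simp [lv, min_eq_right hz]
      rw [this, lev_lvl k le_rfl (by norm_num)]
  · refine Exterior.ext' rfl ?_
    change lvl k (lv (w, t)) = _
    rw [hlow (w, t) hw, lvl_lev]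

/-- For `a ≥ 0` both coordinates grow in absolute value. For `a < 0` the loss in the level is paid
for by stretching the radius: the coefficient of `2τ` is `a (3/2 - a) + (1 - a²)`, which is positive
for `a > -1/4`; this is the reason for that bound in `Above`. -/
theorem push_estimate {a r τ : ℝ} (ha : -(1 / 4) < a) (h : 1 ≤ a ^ 2 + r ^ 2) (h0 : 0 ≤ τ) : 1 ≤ ((1 - τ) * a + τ * max a (3 / 2)) ^ 2 + ((1 + τ) * r) ^ 2 := by
  have hm1 : a ≤ max a (3 / 2) := le_max_left _ _
  rcases le_total 0 a with h2 | h2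
  · have h3 : a ≤ (1 - τ) * a + τ * max a (3 / 2) := by nlinarith
    nlinarith [sq_nonneg r, mul_nonneg h0 (sq_nonneg r)]
  · rw [max_eq_right (by linarith)]
    have h3 : 0 ≤ a * (3 / 2 - a) + (1 - a ^ 2) := by nlinarith
    have h4 : (1 + τ) ^ 2 * (1 - a ^ 2) ≤ (1 + τ) ^ 2 * r ^ 2 :=
      mul_le_mul_of_nonneg_left (by linarith) (sq_nonneg _)
    have h5 : 0 ≤ τ * (a * (3 / 2 - a) + (1 - a ^ 2)) := mul_nonneg h0 h3
    have h6 : 0 ≤ τ ^ 2 * (1 - a ^ 2) := mul_nonneg (sq_nonneg _) (by nlinarith)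
    nlinarith [sq_nonneg (τ * (3 / 2 - a))]

/-- During `t₁` the point rises to level at least `3/2` while its radius is doubled, staying outside
the torus. Above level `1` the radius is free, and during `t₂` it is moved to at least `3/2`, over
the top to the right of the torus. Points already at radius more than `1` stay there, so they remain
beside the torus throughout. -/
theorem exists_push_up (C : Fin K → FramedCurve n) (k : Fin K) :
    ∃ H : C(Above k × I, Exterior C), (∀ w, H (w, 0) = aboveIncl C k w) ∧
      (∀ w, H (w, 1) ∈ beside C k) ∧
      ∀ w, 1 < w.1.1.2 → ∀ t, H (w, t) ∈ beside C k := by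
  let t₁ : I → ℝ := fun t => min (2 * t) 1
  let t₂ : I → ℝ := fun t => max (2 * t - 1) 0
  have ht₁ : ∀ t, 0 ≤ t₁ t ∧ t₁ t ≤ 1 := fun t =>
    ⟨le_min (by linarith [t.2.1]) zero_le_one, min_le_right _ _⟩
  have ht₂ : ∀ t, 0 ≤ t₂ t ∧ t₂ t ≤ 1 := fun t =>
    ⟨le_max_right _ _, max_le (by linarith [t.2.2]) zero_le_one⟩
  have ht : ∀ t, t₂ t = 0 ∨ t₁ t = 1 := by
    intro t
    rcases le_total (2 * (t : ℝ)) 1 with h | h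
    · exact Or.inl (max_eq_right (by linarith))
    · exact Or.inr (min_eq_right h)
  let lv : Above k × I → ℝ := fun z =>
    (1 - t₁ z.2) * lev k z.1.1.2 + t₁ z.2 * max (lev k z.1.1.2) (3 / 2)
  let rr : Above k × I → ℝ := fun z => (1 + t₁ z.2) * z.1.1.1.2
  let rd : Above k × I → ℝ := fun z => (1 - t₂ z.2) * rr z + t₂ z.2 * max (rr z) (3 / 2)
  have hv : Continuous fun z : Above k × I => z.1.1 := continuous_subtype_val.comp continuous_fst
  have hl : Continuous fun z : Above k × I => lev k z.1.1.2 :=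
    (continuous_lev k).comp (continuous_subtype_val.comp (continuous_snd.comp hv))
  have hc₁ : Continuous t₁ := by fun_prop
  have hc₂ : Continuous t₂ := by fun_prop
  have hlv : Continuous lv := by
    simp only [lv]
    fun_prop
  have hrr : Continuous rr := by
    simp only [rr]
    fun_prop
  have hrd : Continuous rd := by
    simp only [rd]
    fun_prop
  have hband : ∀ z, -2 ≤ lv z ∧ lv z ≤ 2 := by
    intro z
    have h1 := z.1.2.1
    have h2 := z.1.2.2.1
    have h3 := ht₁ z.2
    have h4 : max (lev k z.1.1.2) (3 / 2) ≤ 2 := max_le h2 (by norm_num)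
    have h5 : 3 / 2 ≤ max (lev k z.1.1.2) (3 / 2) := le_max_right _ _
    simp only [lv]
    constructor <;> nlinarith
  have hout : ∀ z, 1 ≤ lv z ^ 2 + rd z ^ 2 := by
    intro z
    rcases ht z.2 with h | h
    · have : rd z = (1 + t₁ z.2) * z.1.1.1.2 := by simp only [rd, rr, h]; ring
      rw [this]
      exact push_estimate z.1.2.1 z.1.2.2.2 (ht₁ _).1
    · have : 3 / 2 ≤ lv z := by
        simp only [lv, h]
        linarith [le_max_right (lev k z.1.1.2) (3 / 2)]
      nlinarith [sq_nonneg (rd z)]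
  have hbes : ∀ z (_ : 1 < rd z) (h : _), Exterior.mk' C ((C k).collar (z.1.1.1.1, rd z))
      (lvl k (lv z)) h ∈ beside C k := by
    intro z hz h
    refine ⟨?_, Or.inr ?_⟩
    · change lev k (lvl k (lv z)) ≤ 2
      rw [lev_lvl k (hband z).1 (hband z).2]
      exact (hband z).2
    · rintro ⟨q, hq, e⟩
      have := (C k).isOpenEmbedding.injective e
      rw [this] at hq
      exact absurd hq (not_le.2 (lt_of_lt_of_le hz (le_abs_self _)))
  refine ⟨⟨_, continuous_exterior_mk (C := C)
    (y := fun z : Above k × I => (C k).collar (z.1.1.1.1, rd z))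
    (s := fun z => lvl k (lv z))
    ((C k).isOpenEmbedding.continuous.comp (by fun_prop)) ((continuous_lvl k).comp hlv)
    fun z => collar_band_mem C k _ (hband z).1 (hband z).2 (hout z)⟩, fun w => ?_, fun w => ?_,
    fun w hw t => ?_⟩
  · have h1 : t₁ 0 = 0 := by simp [t₁]
    have h2 : t₂ 0 = 0 := by simp [t₂]
    refine Exterior.ext' ?_ ?_
    · change (C k).collar (w.1.1.1, rd (w, 0)) = (C k).collar w.1.1
      have : rd (w, 0) = w.1.1.2 := by simp [rd, rr, h1, h2]
      rw [this]
    · change lvl k (lv (w, 0)) = w.1.2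
      have : lv (w, 0) = lev k w.1.2 := by simp [lv, h1]
      rw [this, lvl_lev]
  · refine hbes (w, 1) ?_ (collar_band_mem C k _ (hband (w, 1)).1 (hband (w, 1)).2 (hout (w, 1)))
    have h2 : t₂ 1 = 1 := by norm_num [t₂]
    simp only [rd, h2]
    linarith [le_max_right (rr (w, 1)) (3 / 2)]
  · refine hbes (w, t) ?_ (collar_band_mem C k _ (hband (w, t)).1 (hband (w, t)).2 (hout (w, t)))
    have h1 : 1 < rr (w, t) := by
      simp only [rr]
      nlinarith [(ht₁ t).1]
    have h2 := mul_nonneg (ht₂ t).1 (sub_nonneg.2 (le_max_left (rr (w, t)) (3 / 2)))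
    simp only [rd]
    linarith

end Layers

open CategoryTheory unitInterval

/-! ### Extending a flat labelling past one solid torus -/

section Generation

variable {n K : ℕ}

theorem pathConnectedSpace_above_left : PathConnectedSpace
    (Circle × Set.Iio (-1 : ℝ) × Set.Ioc (-(1 / 4) : ℝ) 2) := by
  have h1 : PathConnectedSpace (Set.Iio (-1 : ℝ)) := isPathConnected_iff_pathConnectedSpace.1
    ((convex_Iio (-1 : ℝ)).isPathConnected ⟨-2, by norm_num⟩)
  have h2 : PathConnectedSpace (Set.Ioc (-(1 / 4) : ℝ) 2) := isPathConnected_iff_pathConnectedSpace.1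
    ((convex_Ioc (-(1 / 4) : ℝ) 2).isPathConnected ⟨2, by norm_num⟩)
  infer_instance

theorem mem_beside_of_collar (C : Fin K → FramedCurve n) (k : Fin K) {p : Exterior C} {θ : Circle}
    {r : ℝ} (hp : p.1.1 = (C k).collar (θ, r)) :
    p ∈ beside C k ↔ lev k p.1.2 ≤ 2 ∧ (lev k p.1.2 < 0 ∨ 1 < |r|) := by
  have : p.1.1 ∉ (C k).collar '' {q | |q.2| ≤ 1} ↔ 1 < |r| := by
    rw [← not_le, not_iff_not, hp]
    constructor
    · rintro ⟨q, hq, e⟩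
      rw [(C k).isOpenEmbedding.injective e] at hq
      exact hq
    · intro h
      exact ⟨_, h, rfl⟩
  unfold beside
  rw [← this]
  rfl

/-- The disc bundle of radii between `1` and `3/2`, restricted to one fibre. -/
theorem exists_radial (C : Fin K → FramedCurve n) (k : Fin K) :
    ∃ R : C(I × I, Exterior C), (∀ s t : I, (R (s, t)).1.1 =
        (C k).collar (1, -((1 + (t : ℝ) / 2) * Real.sin (2 * Real.pi * s)))) ∧
      (∀ s t : I, lev k (R (s, t)).1.2 = (1 + (t : ℝ) / 2) * Real.cos (2 * Real.pi * s)) ∧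
      ∀ s : I, R (s, 0) = meridian C k s := by
  have hb : ∀ z : I × I, -2 ≤ (1 + (z.2 : ℝ) / 2) * Real.cos (2 * Real.pi * z.1) ∧
      (1 + (z.2 : ℝ) / 2) * Real.cos (2 * Real.pi * z.1) ≤ 2 := by
    intro z
    have h1 := Real.neg_one_le_cos (2 * Real.pi * z.1)
    have h2 := Real.cos_le_one (2 * Real.pi * z.1)
    have h3 := z.2.2.1
    have h4 := z.2.2.2
    constructor <;> nlinarith
  have ho : ∀ z : I × I, 1 ≤ ((1 + (z.2 : ℝ) / 2) * Real.cos (2 * Real.pi * z.1)) ^ 2 +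
      (-((1 + (z.2 : ℝ) / 2) * Real.sin (2 * Real.pi * z.1))) ^ 2 := by
    intro z
    have h1 := Real.sin_sq_add_cos_sq (2 * Real.pi * z.1)
    have h3 := z.2.2.1
    have e : ((1 + (z.2 : ℝ) / 2) * Real.cos (2 * Real.pi * z.1)) ^ 2 +
      (-((1 + (z.2 : ℝ) / 2) * Real.sin (2 * Real.pi * z.1))) ^ 2 = (1 + (z.2 : ℝ) / 2) ^ 2 *
        (Real.sin (2 * Real.pi * z.1) ^ 2 + Real.cos (2 * Real.pi * z.1) ^ 2) := by ring
    rw [e, h1]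
    nlinarith
  refine ⟨⟨_, continuous_exterior_mk (C := C)
    (y := fun z : I × I => (C k).collar (1, -((1 + (z.2 : ℝ) / 2) * Real.sin (2 * Real.pi * z.1))))
    (s := fun z => lvl k ((1 + (z.2 : ℝ) / 2) * Real.cos (2 * Real.pi * z.1)))
    ((C k).isOpenEmbedding.continuous.comp (by fun_prop))
    ((continuous_lvl k).comp (by fun_prop))
    fun z => collar_band_mem C k _ (hb z).1 (hb z).2 (ho z)⟩, fun s t => rfl, fun s t => ?_,
    fun s => ?_⟩
  · exact lev_lvl k (hb (s, t)).1 (hb (s, t)).2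
  · refine Exterior.ext' ?_ ?_
    · change (C k).collar (1, -((1 + ((0 : I) : ℝ) / 2) * Real.sin (2 * Real.pi * s))) =
        (C k).collar (1, -((Circle.exp (2 * Real.pi * (s : ℝ)) : Circle) : ℂ).im)
      rw [Circle.coe_exp, Complex.exp_ofReal_mul_I_im]
      simp
    · change lvl k ((1 + ((0 : I) : ℝ) / 2) * Real.cos (2 * Real.pi * s)) =
        (torusPt C k 1 (Circle.exp (2 * Real.pi * (s : ℝ)))).1.2
      rw [← lvl_lev k (torusPt C k 1 (Circle.exp (2 * Real.pi * (s : ℝ)))).1.2, lev_torusPt,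
        Circle.coe_exp, Complex.exp_ofReal_mul_I_re]
      simp

theorem cls_eq_subpaths {X : Type} [TopologicalSpace X] {p : X} (M : Path p p) (s t : I) :
    cls M = cls ((M.subpath 0 s).cast M.source.symm rfl) ≫ cls (M.subpath s t) ≫
      cls ((M.subpath t 1).cast rfl M.target.symm) := by
  have gen : ∀ {a b : X} (M : Path a b), cls M =
      cls ((M.subpath 0 s).cast M.source.symm rfl) ≫ cls (M.subpath s t) ≫
      cls ((M.subpath t 1).cast rfl M.target.symm) := by
    rintro a b ⟨f, rfl, rfl⟩
    set M : Path (f 0) (f 1) := ⟨f, rfl, rfl⟩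
    have h1 := cls_eq_of_homotopic ⟨Path.Homotopy.subpathTransSubpath M s t 1⟩
    have h2 := cls_eq_of_homotopic ⟨Path.Homotopy.subpathTransSubpath M 0 s 1⟩
    rw [cls_trans] at h1 h2
    have e : M.subpath 0 1 = M := by rw [Path.subpath_zero_one]; rfl
    rw [e] at h2
    exact h2.symm.trans (congrArg (fun x => cls (M.subpath 0 s) ≫ x) h1.symm)
  exact gen M

theorem exists_subpath_eq {X : Type} [TopologicalSpace X] {a b : X} (M : Path a b) {s t : I}
    (h : s ≤ t) (r : I) : ∃ u, s ≤ u ∧ u ≤ t ∧ M.subpath s t r = M u := by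
  have : M.subpath s t r ∈ Set.range (M.subpath s t) := ⟨r, rfl⟩
  rw [Path.range_subpath_of_le _ _ _ h] at this
  obtain ⟨u, hu, hu'⟩ := this
  exact ⟨u, hu.1, hu.2, hu'.symm⟩

/-- The slab is covered by `U = beside C k`, which is pushed down to the part already labelled, and
by `V`, the part of the collar above level `-1/4`, which is pushed over the torus to its right side
and so into `U`. The pulled back labels `cU` and `cV` agree on the right by construction. To the
left of the torus they differ by the monodromy around the meridian, and `hE` makes that trivial,
because the longitude lies in `V`, where `cV` is flat. -/
theorem layer_step (hn : 1 ≤ n) (C : Fin K → FramedCurve n) (k : Fin K) {x₀ : Exterior C}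
    (hx₀ : lev k x₀.1.2 ≤ -2) {E : Subgroup (FundamentalGroup (Exterior C) x₀)}
    (hE : ∀ w : Path x₀ (torusPt C k 1 1),
      SameCoset E (cls w ≫ cls (longitude C k)) (cls w) →
      SameCoset E (cls w ≫ cls (meridian C k)) (cls w))
    {c : Labelling x₀} (hc : Flat E c {p | lev k p.1.2 ≤ -2}) (hcx : SameCoset E (c x₀) (𝟙 _)) :
    ∃ c' : Labelling x₀, Flat E c' {p | lev k p.1.2 ≤ 2} ∧ SameCoset E (c' x₀) (𝟙 _) := by
  classical
  obtain ⟨H, H0, H1, Hfix⟩ := exists_push_down C k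
  obtain ⟨cU, hU, hcU⟩ := hc.pull (κ := (Subtype.val : beside C k → Exterior C))
    Topology.IsEmbedding.subtypeVal H H0 H1
  rw [Subtype.range_val] at hU
  obtain ⟨G, G0, G1, Gright⟩ := exists_push_up C k
  obtain ⟨cV, hV, hcV⟩ := hU.pull (isEmbedding_aboveIncl C k) G G0 G1
  set V := Set.range (aboveIncl C k) with hVdef
  obtain ⟨R, R1, R2, R0⟩ := exists_radial C k
  -- the two labellings agree along paths
  have transport : ∀ {p q : Exterior C} (a : Path p q), (∀ t, a t ∈ beside C k ∩ V) →
      SameCoset E (cU q) (cV q) → SameCoset E (cU p) (cV p) := by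
    intro p q a ha h
    refine SameCoset.of_comp (cls a) ?_
    exact ((hU a fun t => (ha t).1).trans h).trans (hV a fun t => (ha t).2).symm
  have right : ∀ w : Above k, 1 < w.1.1.2 →
      SameCoset E (cU (aboveIncl C k w)) (cV (aboveIncl C k w)) := by
    intro w hw
    let g : Path (aboveIncl C k w) (G (w, 1)) := ⟨⟨fun t => G (w, t), by fun_prop⟩, G0 w, rfl⟩
    refine SameCoset.of_comp (cls g) ?_
    exact (hU g fun t => Gright w hw t).trans (hcV w g fun t => rfl).symm
  -- A parallel of the meridian at distance `3/2`. It starts at the top, is leftmost (`r = -3/2`) at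
  -- `s = 1/4` and rightmost at `s = 3/4`; its upper half lies in `V` and its lower half in `U`.
  let M : Path (R (0, 1)) (R (0, 1)) :=
    ⟨⟨fun s => R (s, 1), by fun_prop⟩, rfl, Exterior.ext' (by rw [R1, R1]; simp) (by
      rw [← lvl_lev k (R _).1.2, R2, ← lvl_lev k (R _).1.2, R2]; simp)⟩
  have hM : ∀ s, M s = R (s, 1) := fun s => rfl
  let ν : Path (torusPt C k 1 1) (R (0, 1)) :=
    ⟨⟨fun t => R (0, t), by fun_prop⟩, by
      change R (0, 0) = _
      rw [R0]
      exact (meridian C k).source, rfl⟩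
  have memV : ∀ s t : I, 0 ≤ Real.cos (2 * Real.pi * s) → R (s, t) ∈ V := by
    intro s t hs
    rw [hVdef, mem_range_aboveIncl, R2, R1]
    have h0 := t.2.1
    have h1 := t.2.2
    have h2 := Real.cos_le_one (2 * Real.pi * s)
    refine ⟨?_, ?_, _, rfl⟩ <;> nlinarith
  have memU : ∀ s : I, Real.cos (2 * Real.pi * s) ≤ 0 → R (s, 1) ∈ beside C k := by
    intro s hs
    rw [mem_beside_of_collar C k (R1 s 1), R2]
    simp only [Set.Icc.coe_one]
    refine ⟨by linarith, ?_⟩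
    rcases eq_or_lt_of_le hs with hs | hs
    · right
      have h1 := Real.sin_sq_add_cos_sq (2 * Real.pi * s)
      rw [hs] at h1
      rw [lt_abs]
      have h2 : (Real.sin (2 * Real.pi * s) - 1) * (Real.sin (2 * Real.pi * s) + 1) = 0 := by
        linarith
      rcases mul_eq_zero.1 h2 with h | h
      · right
        have : Real.sin (2 * Real.pi * s) = 1 := by linarith
        rw [this]
        norm_num
      · left
        have : Real.sin (2 * Real.pi * s) = -1 := by linarith
        rw [this]
        norm_num
    · left
      linarith
  have hpi := Real.pi_pos
  have cos1 : ∀ s : I, (s : ℝ) ≤ 1 / 4 → 0 ≤ Real.cos (2 * Real.pi * s) := by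
    intro s hs
    have := s.2.1
    exact Real.cos_nonneg_of_neg_pi_div_two_le_of_le (by nlinarith) (by nlinarith)
  have cos2 : ∀ s : I, 1 / 4 ≤ (s : ℝ) → (s : ℝ) ≤ 3 / 4 → Real.cos (2 * Real.pi * s) ≤ 0 := by
    intro s hs hs'
    exact Real.cos_nonpos_of_pi_div_two_le_of_le (by nlinarith) (by nlinarith)
  have cos3 : ∀ s : I, 3 / 4 ≤ (s : ℝ) → 0 ≤ Real.cos (2 * Real.pi * s) := by
    intro s hs
    have := s.2.2
    rw [← Real.cos_sub_two_pi]
    exact Real.cos_nonneg_of_neg_pi_div_two_le_of_le (by nlinarith) (by nlinarith)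
  let s₁ : I := ⟨1 / 4, by norm_num, by norm_num⟩
  let s₂ : I := ⟨3 / 4, by norm_num, by norm_num⟩
  have sin1 : Real.sin (2 * Real.pi * s₁) = 1 := by
    rw [show 2 * Real.pi * (s₁ : ℝ) = Real.pi / 2 by simp only [s₁]; ring, Real.sin_pi_div_two]
  have sin2 : Real.sin (2 * Real.pi * s₂) = -1 := by
    rw [show 2 * Real.pi * (s₂ : ℝ) = Real.pi / 2 + Real.pi by simp only [s₂]; ring,
      Real.sin_add_pi, Real.sin_pi_div_two]
  -- monodromy along the torus
  have merid : SameCoset E (cV (R (0, 1)) ≫ cls M) (cV (R (0, 1))) := by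
    -- The label at the top of the torus is itself the class of a path, and that path is the one to
    -- which `hE` is applied.
    obtain ⟨w, hw⟩ := cls_surjective (cV (torusPt C k 1 1))
    have hlong : SameCoset E (cls w ≫ cls (longitude C k)) (cls w) := by
      rw [hw]
      refine hV (longitude C k) fun t => ?_
      rw [hVdef, mem_range_aboveIncl]
      change -(1 / 4) < lev k (torusPt C k _ 1).1.2 ∧ lev k (torusPt C k _ 1).1.2 ≤ 2 ∧ _
      rw [lev_torusPt]
      norm_num
      exact ⟨_, _, rfl⟩
    have hmer := hE w hlong
    rw [hw] at hmer
    have hν : SameCoset E (cV (torusPt C k 1 1) ≫ cls ν) (cV (R (0, 1))) :=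
      hV ν fun t => memV 0 t (by simp)
    have sq : cls (meridian C k) ≫ cls ν = cls ν ≫ cls M :=
      cls_square R (meridian C k) ν ν M (fun t => (R0 t).symm)
        (fun t => Exterior.ext' (by change (R (0, t)).1.1 = _; rw [R1, R1]; simp) (by
          change (R (0, t)).1.2 = _
          rw [← lvl_lev k (R _).1.2, R2, ← lvl_lev k (R _).1.2, R2]; simp))
        (fun t => rfl) (fun t => rfl)
    have h1 := (hν.comp (cls M)).symm
    have h2 := hmer.comp (cls ν)
    rw [Category.assoc, sq] at h2
    rw [Category.assoc] at h1
    exact (h1.trans h2).trans hν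
  have agree2 : SameCoset E (cU (M s₂)) (cV (M s₂)) := by
    obtain ⟨w, hw⟩ : M s₂ ∈ V := memV s₂ 1 (cos3 _ le_rfl)
    have hr : w.1.1.2 = 3 / 2 := by
      have h1 : (C k).collar w.1.1 = (M s₂).1.1 := congrArg (fun p => p.1.1) hw
      rw [hM, R1] at h1
      have h2 := congrArg Prod.snd ((C k).isOpenEmbedding.injective h1)
      rw [h2, sin2]
      norm_num
    rw [← hw]
    exact right w (by rw [hr]; norm_num)
  have agree1 : SameCoset E (cU (M s₁)) (cV (M s₁)) := by
    have a1 : SameCoset E (cV (R (0, 1)) ≫ cls ((M.subpath 0 s₁).cast M.source.symm rfl))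
        (cV (M s₁)) := by
      refine hV _ fun t => ?_
      obtain ⟨u, -, hu, e⟩ := exists_subpath_eq M (show (0 : I) ≤ s₁ from s₁.2.1) t
      change M.subpath 0 s₁ t ∈ V
      rw [e]
      exact memV u 1 (cos1 u hu)
    have a2 : SameCoset E (cU (M s₁) ≫ cls (M.subpath s₁ s₂)) (cU (M s₂)) := by
      refine hU _ fun t => ?_
      obtain ⟨u, hu1, hu2, e⟩ := exists_subpath_eq M
        (show s₁ ≤ s₂ from Subtype.coe_le_coe.1 (by norm_num [s₁, s₂])) t
      rw [e]
      exact memU u (cos2 u hu1 hu2)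
    have a3 : SameCoset E (cV (M s₂) ≫ cls ((M.subpath s₂ 1).cast rfl M.target.symm))
        (cV (R (0, 1))) := by
      refine hV _ fun t => ?_
      obtain ⟨u, hu, -, e⟩ := exists_subpath_eq M (show s₂ ≤ (1 : I) from s₂.2.2) t
      change M.subpath s₂ 1 t ∈ V
      rw [e]
      exact memV u 1 (cos3 u hu)
    -- Compare at the top after following `M` through the bottom and the right: `cU` is carried to
    -- the label `cV`, and trivial monodromy replaces it by `cV` carried once around `M`, which on
    -- the first quarter is `cV` at the left point.
    refine SameCoset.of_comp (cls (M.subpath s₁ s₂) ≫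
      cls ((M.subpath s₂ 1).cast rfl M.target.symm)) ?_
    have b1 := (a2.comp (cls ((M.subpath s₂ 1).cast rfl M.target.symm))).trans
      ((agree2.comp _).trans (a3.trans merid.symm))
    rw [cls_eq_subpaths M s₁ s₂] at b1
    have b2 := a1.comp (cls (M.subpath s₁ s₂) ≫ cls ((M.subpath s₂ 1).cast rfl M.target.symm))
    rw [Category.assoc] at b1 b2
    exact b1.trans b2
  -- The overlap to the left of the torus is path connected, so agreement at one point of it
  -- spreads.
  have left : ∀ w : Above k, w.1.1.2 < -1 →
      SameCoset E (cU (aboveIncl C k w)) (cV (aboveIncl C k w)) := by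
    have := pathConnectedSpace_above_left
    have hb : ∀ z : Circle × Set.Iio (-1 : ℝ) × Set.Ioc (-(1 / 4) : ℝ) 2,
        -2 ≤ (z.2.2 : ℝ) ∧ (z.2.2 : ℝ) ≤ 2 ∧ 1 ≤ (z.2.2 : ℝ) ^ 2 + (z.2.1 : ℝ) ^ 2 := by
      intro z
      have h1 : (z.2.1 : ℝ) < -1 := z.2.1.2
      have h2 := z.2.2.2
      exact ⟨by linarith [h2.1], h2.2, by nlinarith [sq_nonneg (z.2.2 : ℝ)]⟩
    let f : Circle × Set.Iio (-1 : ℝ) × Set.Ioc (-(1 / 4) : ℝ) 2 → Exterior C := fun z =>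
      Exterior.mk' C ((C k).collar (z.1, z.2.1)) (lvl k z.2.2)
        (collar_band_mem C k _ (hb z).1 (hb z).2.1 (hb z).2.2)
    have hf : Continuous f := continuous_exterior_mk
      ((C k).isOpenEmbedding.continuous.comp (by fun_prop)) ((continuous_lvl k).comp (by fun_prop)) _
    have hfm : ∀ z, f z ∈ beside C k ∩ V := by
      intro z
      have hl : lev k (f z).1.2 = z.2.2 := lev_lvl k (hb z).1 (hb z).2.1
      have h1 : (z.2.1 : ℝ) < -1 := z.2.1.2
      constructor
      · rw [mem_beside_of_collar C k (rfl : (f z).1.1 = (C k).collar (z.1, z.2.1)), hl]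
        exact ⟨(hb z).2.1, Or.inr (lt_abs.2 (Or.inr (by linarith)))⟩
      · rw [hVdef, mem_range_aboveIncl, hl]
        exact ⟨z.2.2.2.1, z.2.2.2.2, _, rfl⟩
    have hrange : ∀ w : Above k, w.1.1.2 < -1 → aboveIncl C k w ∈ Set.range f := by
      intro w hw
      refine ⟨(w.1.1.1, ⟨w.1.1.2, hw⟩, ⟨lev k w.1.2, w.2.1, w.2.2.1⟩), Exterior.ext' rfl ?_⟩
      exact lvl_lev k w.1.2
    intro w hw
    obtain ⟨w₁, hw₁⟩ : M s₁ ∈ V := memV s₁ 1 (cos1 _ le_rfl)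
    have hr : w₁.1.1.2 = -(3 / 2) := by
      have h1 : (C k).collar w₁.1.1 = (M s₁).1.1 := congrArg (fun p => p.1.1) hw₁
      rw [hM, R1] at h1
      have h2 := congrArg Prod.snd ((C k).isOpenEmbedding.injective h1)
      rw [h2, sin1]
      norm_num
    have hj := (isPathConnected_range hf).joinedIn _ (hrange w hw) _
      (hrange w₁ (by rw [hr]; norm_num))
    refine transport hj.somePath (fun t => ?_) (by rw [hw₁]; exact agree1)
    obtain ⟨z, hz⟩ := hj.somePath_mem t
    rw [← hz]
    exact hfm z
  -- agreement everywhere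
  have agree : ∀ p ∈ beside C k ∩ V, SameCoset E (cU p) (cV p) := by
    rintro p ⟨hpU, w, rfl⟩
    have hpU' := (mem_beside_of_collar C k (p := aboveIncl C k w) (θ := w.1.1.1) (r := w.1.1.2)
      rfl).1 hpU
    obtain ⟨-, hpU'⟩ := hpU'
    change lev k w.1.2 < 0 ∨ 1 < |w.1.1.2| at hpU'
    -- Between levels `-1/4` and `0` no point of the exterior has `r = 0`, so `r` has a sign; moving
    -- outwards by `2` keeps the point in the overlap and brings it to `|r| > 1`.
    obtain ⟨e, he, hr⟩ : ∃ e : ℝ, (e = 1 ∨ e = -1) ∧ 0 < e * w.1.1.2 := by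
      have hne : w.1.1.2 ≠ 0 := by
        intro h0
        have h1 := w.2.2.2
        have h2 := w.2.1
        rw [h0] at hpU' h1
        rw [abs_zero] at hpU'
        rcases hpU' with h | h
        · nlinarith
        · linarith
      rcases lt_or_gt_of_ne hne with h | h
      · exact ⟨-1, Or.inr rfl, by linarith⟩
      · exact ⟨1, Or.inl rfl, by linarith⟩
    have habs : ∀ t : I, |w.1.1.2| ≤ |w.1.1.2 + 2 * e * t| := by
      intro t
      rw [← sq_le_sq]
      have := t.2.1
      nlinarith [sq_nonneg (e * (t : ℝ)), mul_nonneg hr.le this]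
    let b : I → Above k := fun t => ⟨((w.1.1.1, w.1.1.2 + 2 * e * t), w.1.2), w.2.1, w.2.2.1, by
      have h1 := w.2.2.2
      have h2 := sq_le_sq.2 (habs t)
      change 1 ≤ lev k w.1.2 ^ 2 + (w.1.1.2 + 2 * e * t) ^ 2
      linarith⟩
    have hb : Continuous b := Continuous.subtype_mk (by fun_prop) _
    let a : Path (aboveIncl C k w) (aboveIncl C k (b 1)) :=
      ⟨⟨fun t => aboveIncl C k (b t), (isEmbedding_aboveIncl C k).continuous.comp hb⟩, by
        refine Exterior.ext' ?_ rfl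
        change (C k).collar (w.1.1.1, w.1.1.2 + 2 * e * ((0 : I) : ℝ)) = _
        simp [aboveIncl, Exterior.mk'], rfl⟩
    refine transport a (fun t => ⟨?_, ⟨b t, rfl⟩⟩) ?_
    · rw [mem_beside_of_collar C k (p := a t) (θ := w.1.1.1) (r := w.1.1.2 + 2 * e * t) rfl]
      refine ⟨w.2.2.1, ?_⟩
      rcases hpU' with h | h
      · exact Or.inl h
      · exact Or.inr (h.trans_le (habs t))
    · have h1 : (b 1).1.1.2 = w.1.1.2 + 2 * e := by simp [b]
      rcases he with rfl | rfl
      · exact right _ (by rw [h1]; linarith)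
      · exact left _ (by rw [h1]; linarith)
  refine ⟨fun p => if p ∈ beside C k then cU p else cV p, ?_, ?_⟩
  · have hlev : Continuous fun p : Exterior C => lev k p.1.2 :=
      (continuous_lev k).comp (continuous_subtype_val.comp
        (continuous_snd.comp (Exterior.continuous_val C)))
    have hfst : Continuous fun p : Exterior C => p.1.1 :=
      continuous_fst.comp (Exterior.continuous_val C)
    refine Flat.glue (U := beside C k) (V := V)
      (OU := {p | lev k p.1.2 < 0 ∨ p.1.1 ∉ (C k).collar '' {q | |q.2| ≤ 1}})
      (OV := {p | -(1 / 4) < lev k p.1.2 ∧ p.1.1 ∈ Set.range (C k).collar}) ?_ ?_ ?_ ?_ ?_ ?_ ?_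
    · refine hU.congr fun p hp => ?_
      simp only [if_pos hp]
      exact SameCoset.refl _
    · refine hV.congr fun p hp => ?_
      by_cases h : p ∈ beside C k
      · simp only [if_pos h]
        exact agree p ⟨h, hp⟩
      · simp only [if_neg h]
        exact SameCoset.refl _
    · exact (isOpen_lt hlev continuous_const).union
        (((C k).isClosed_collar hn).isOpen_compl.preimage hfst)
    · exact (isOpen_lt continuous_const hlev).inter
        ((C k).isOpenEmbedding.isOpen_range.preimage hfst)
    · intro p hp
      by_cases h : lev k p.1.2 < 0 ∨ p.1.1 ∉ (C k).collar '' {q | |q.2| ≤ 1}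
      · exact Or.inl h
      · rw [not_or, not_not, not_lt] at h
        obtain ⟨h1, q, -, h2⟩ := h
        exact Or.inr ⟨by linarith, q, h2⟩
    · rintro p ⟨h1, h2⟩
      exact ⟨h1, h2⟩
    · rintro p ⟨h1, h2, h3⟩
      rw [hVdef, mem_range_aboveIncl]
      exact ⟨h2, h1, h3⟩
  · have hx : x₀ ∈ beside C k := ⟨by linarith, Or.inl (by linarith)⟩
    simp only [if_pos hx]
    exact (SameCoset.of_pull hcU ⟨x₀, hx⟩ (Hfix ⟨x₀, hx⟩ hx₀)).trans hcx

end Generation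

open CategoryTheory unitInterval

/-! ### Induction over the layers: the exterior is connected and generated from the bottom -/

section Generation

variable {n K : ℕ}

/-- The part of the exterior between the bottom and the `j`-th torus (counted from `0`). -/
def lowerPart (C : Fin K → FramedCurve n) (j : ℕ) : Set (Exterior C) :=
  {p | (K + 1) * (p.1.2 : ℝ) ≤ j + 1 / 2}

theorem lowerPart_castSucc (C : Fin K → FramedCurve n) (k : Fin K) :
    lowerPart C k = {p | lev k p.1.2 ≤ -2} := by
  ext p
  change (K + 1) * (p.1.2 : ℝ) ≤ (k : ℕ) + 1 / 2 ↔ lev k p.1.2 ≤ -2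
  unfold lev
  constructor <;> intro h <;> linarith

theorem lowerPart_succ (C : Fin K → FramedCurve n) (k : Fin K) :
    lowerPart C ((k : ℕ) + 1) = {p | lev k p.1.2 ≤ 2} := by
  ext p
  change (K + 1) * (p.1.2 : ℝ) ≤ ((k : ℕ) + 1 : ℕ) + 1 / 2 ↔ lev k p.1.2 ≤ 2
  unfold lev
  push_cast
  constructor <;> intro h <;> linarith

/-- Vertical descent to height `σ₀`, for slabs free of tori: below the first torus (`σ₀ = 0`) and
above the last one. -/
theorem exists_push_bottom (C : Fin K → FramedCurve n) {σ₀ : ℝ} (h0 : 0 ≤ σ₀)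
    {A : Set (Exterior C)} (hA : ∀ p ∈ A, ∀ s : I, σ₀ ≤ s → (s : ℝ) ≤ p.1.2 →
      ∀ k θ r, p.1.1 = (C k).collar (θ, r) → 1 ≤ lev k s ^ 2 + r ^ 2) :
    ∃ H : C(A × I, Exterior C), (∀ w, H (w, 0) = w.1) ∧
      (∀ w, ((H (w, 1)).1.2 : ℝ) = min (w.1.1.2 : ℝ) σ₀) ∧
      ∀ w t, (w.1.1.2 : ℝ) ≤ σ₀ → H (w, t) = w.1 := by
  have hm : ∀ z : A × I, (1 - (z.2 : ℝ)) * (z.1.1.1.2 : ℝ) + z.2 * min (z.1.1.1.2 : ℝ) σ₀ ∈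
      Set.Icc (0 : ℝ) 1 := by
    intro z
    have h1 := z.2.2.1
    have h2 := z.2.2.2
    have h3 := z.1.1.1.2.2.1
    have h4 := z.1.1.1.2.2.2
    have h5 : 0 ≤ min (z.1.1.1.2 : ℝ) σ₀ := le_min h3 h0
    have h6 : min (z.1.1.1.2 : ℝ) σ₀ ≤ 1 := (min_le_left _ _).trans h4
    constructor <;> nlinarith
  let s : A × I → I := fun z => ⟨_, hm z⟩
  have hfix : ∀ z : A × I, (z.1.1.1.2 : ℝ) ≤ σ₀ → s z = z.1.1.1.2 := by
    intro z hz
    apply Subtype.ext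
    simp only [s, min_eq_left hz]
    ring
  have hv : Continuous fun z : A × I => z.1.1.1 :=
    (Exterior.continuous_val C).comp (continuous_subtype_val.comp continuous_fst)
  have hs : Continuous s := Continuous.subtype_mk (by fun_prop) _
  have hmem : ∀ z k θ r, z.1.1.1.1 = (C k).collar (θ, r) → 1 ≤ lev k (s z) ^ 2 + r ^ 2 := by
    intro z k θ r h
    rcases le_total (z.1.1.1.2 : ℝ) σ₀ with hz | hz
    · rw [hfix z hz]
      exact z.1.1.one_le h
    · have h1 := z.2.2.1
      have h2 := z.2.2.2
      refine hA _ z.1.2 _ ?_ ?_ k θ r h <;> simp only [s, min_eq_right hz] <;> nlinarith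
  refine ⟨⟨_, continuous_exterior_mk (C := C) (y := fun z => z.1.1.1.1) (s := s)
    (continuous_fst.comp hv) hs hmem⟩, fun w => ?_, fun w => ?_, fun w t hw => ?_⟩
  · refine Exterior.ext' rfl (Subtype.ext ?_)
    change (1 - ((0 : I) : ℝ)) * _ + ((0 : I) : ℝ) * _ = _
    simp
  · change (1 - ((1 : I) : ℝ)) * _ + ((1 : I) : ℝ) * _ = _
    simp
  · exact Exterior.ext' rfl (hfix (w, t) hw)

theorem lowerPart_zero_mem (C : Fin K → FramedCurve n) (p : Exterior C) (hp : p ∈ lowerPart C 0)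
    (s : I) (_ : (0 : ℝ) ≤ s) (hs : (s : ℝ) ≤ p.1.2) (k : Fin K) (θ : Circle) (r : ℝ)
    (_ : p.1.1 = (C k).collar (θ, r)) : 1 ≤ lev k s ^ 2 + r ^ 2 := by
  apply one_le_sq_of_two_le
  left
  have hp' : (K + 1) * (p.1.2 : ℝ) ≤ (0 : ℕ) + 1 / 2 := hp
  have h1 : (K + 1) * (s : ℝ) ≤ (K + 1) * p.1.2 := by gcongr
  have hk : (0 : ℝ) ≤ (k : ℕ) := Nat.cast_nonneg _
  unfold lev
  push_cast at hp'
  linarith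

theorem lowerPart_top_mem (C : Fin K → FramedCurve n) (p : Exterior C)
    (s : I) (hs : ((K : ℝ) + 1 / 2) / (K + 1) ≤ s) (k : Fin K) (θ : Circle) (r : ℝ)
    (_ : p.1.1 = (C k).collar (θ, r)) : 1 ≤ lev k s ^ 2 + r ^ 2 := by
  apply one_le_sq_of_two_le
  right
  have hK : (0 : ℝ) < K + 1 := by positivity
  rw [div_le_iff₀ hK] at hs
  have hk : ((k : ℕ) : ℝ) + 1 ≤ K := by exact_mod_cast k.2
  unfold lev
  linarith

/-- The tracks of the deformations used for the labellings join every point to the bottom, layer by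
layer. -/
theorem pathConnectedSpace_exterior (C : Fin K → FramedCurve n) :
    PathConnectedSpace (Exterior C) := by
  have hS := pathConnectedSpace_surface n
  have step : ∀ j : ℕ, j ≤ K → ∀ p ∈ lowerPart C j, Joined (inclBottom C (base n)) p := by
    intro j
    induction j with
    | zero =>
      intro _ p hp
      obtain ⟨H, H0, H1, -⟩ := exists_push_bottom C le_rfl (lowerPart_zero_mem C)
      let w : lowerPart C 0 := ⟨p, hp⟩
      have e : H (w, 1) = inclBottom C (H (w, 1)).1.1 := by
        refine Exterior.ext' rfl (Subtype.ext ?_)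
        rw [H1, min_eq_right p.1.2.2.1]
        rfl
      have h1 : Joined p (H (w, 1)) := ⟨⟨⟨fun t => H (w, t), by fun_prop⟩, H0 w, rfl⟩⟩
      have h2 : Joined (inclBottom C (base n)) (H (w, 1)) := by
        rw [e]
        exact ⟨(PathConnectedSpace.somePath (base n) _).map (inclBottom C).continuous⟩
      exact h2.trans h1.symm
    | succ j ih =>
      intro hj p hp
      let k : Fin K := ⟨j, hj⟩
      have ih' : ∀ p, lev k p.1.2 ≤ -2 → Joined (inclBottom C (base n)) p := fun q hq =>
        ih (by omega) q (by rw [lowerPart_castSucc C k]; exact hq)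
      have hp' : lev k p.1.2 ≤ 2 := by
        rw [show j + 1 = (k : ℕ) + 1 from rfl, lowerPart_succ] at hp
        exact hp
      obtain ⟨H, H0, H1, -⟩ := exists_push_down C k
      obtain ⟨G, G0, G1, -⟩ := exists_push_up C k
      have hbes : ∀ q ∈ beside C k, Joined (inclBottom C (base n)) q := by
        intro q hq
        let w : beside C k := ⟨q, hq⟩
        have h1 : Joined q (H (w, 1)) := ⟨⟨⟨fun t => H (w, t), by fun_prop⟩, H0 w, rfl⟩⟩
        exact (ih' _ (H1 w)).trans h1.symm
      by_cases hb : p ∈ beside C k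
      · exact hbes p hb
      · have hV : p ∈ Set.range (aboveIncl C k) := by
          have : ¬ (lev k p.1.2 < 0 ∨ p.1.1 ∉ (C k).collar '' {q | |q.2| ≤ 1}) := fun h =>
            hb ⟨hp', h⟩
          rw [not_or, not_not, not_lt] at this
          obtain ⟨h1, q, -, h2⟩ := this
          rw [mem_range_aboveIncl]
          exact ⟨by linarith, hp', q, h2⟩
        obtain ⟨w, rfl⟩ := hV
        have h1 : Joined (aboveIncl C k w) (G (w, 1)) :=
          ⟨⟨⟨fun t => G (w, t), by fun_prop⟩, G0 w, rfl⟩⟩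
        exact (hbes _ (G1 w)).trans h1.symm
  have hσ : (0 : ℝ) ≤ ((K : ℝ) + 1 / 2) / (K + 1) := by positivity
  have all : ∀ p : Exterior C, Joined (inclBottom C (base n)) p := by
    intro p
    obtain ⟨H, H0, H1, -⟩ := exists_push_bottom C (A := Set.univ) hσ
      fun p _ s hs _ => lowerPart_top_mem C p s hs
    let w : (Set.univ : Set (Exterior C)) := ⟨p, trivial⟩
    have h1 : Joined p (H (w, 1)) := ⟨⟨⟨fun t => H (w, t), by fun_prop⟩, H0 w, rfl⟩⟩
    refine (step K le_rfl _ ?_).trans h1.symm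
    have hK : (0 : ℝ) < K + 1 := by positivity
    have h2 : ((H (w, 1)).1.2 : ℝ) ≤ ((K : ℝ) + 1 / 2) / (K + 1) := by
      rw [H1]
      exact min_le_right _ _
    rw [le_div_iff₀ hK] at h2
    change (K + 1) * ((H (w, 1)).1.2 : ℝ) ≤ K + 1 / 2
    linarith
  exact ⟨⟨inclBottom C (base n)⟩, fun p q => (all p).symm.trans (all q)⟩

/-- The fundamental group of the exterior is generated by the bottom surface and the meridians;
moreover each meridian is only needed when the corresponding longitude has been obtained. -/
theorem subgroup_exterior_eq_top (hn : 1 ≤ n) (C : Fin K → FramedCurve n)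
    (E : Subgroup (FundamentalGroup (Exterior C) (inclBottom C (base n))))
    (hbot : ∀ a : Path (base n) (base n), cls (a.map (inclBottom C).continuous) ∈ E)
    (hE : ∀ (k : Fin K) (w : Path (inclBottom C (base n)) (torusPt C k 1 1)),
      cls (w.trans ((longitude C k).trans w.symm)) ∈ E →
      cls (w.trans ((meridian C k).trans w.symm)) ∈ E) : E = ⊤ := by
  have hS := pathConnectedSpace_surface n
  have hX := pathConnectedSpace_exterior C
  have hE' : ∀ (k : Fin K) (w : Path (inclBottom C (base n)) (torusPt C k 1 1)),
      SameCoset E (cls w ≫ cls (longitude C k)) (cls w) →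
      SameCoset E (cls w ≫ cls (meridian C k)) (cls w) := by
    intro k w h
    have h1 := hE k w
    rw [cls_trans, cls_trans, cls_trans, cls_trans, cls_symm] at h1
    unfold SameCoset at h ⊢
    rw [Category.assoc] at h ⊢
    exact h1 h
  let c₀ : Labelling (inclBottom C (base n)) := fun p =>
    cls (PathConnectedSpace.somePath (inclBottom C (base n)) p)
  have hemb : Topology.IsEmbedding (inclBottom C) := by
    refine Topology.IsEmbedding.of_comp (inclBottom C).continuous (projMap C).continuous ?_
    exact Topology.IsEmbedding.id
  obtain ⟨c₁, hc₁, hx₁⟩ := exists_flat_range (E := E) c₀ hemb (y₀ := base n) rfl hbot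
  have step : ∀ j : ℕ, j ≤ K → ∃ c, Flat E c (lowerPart C j) ∧
      SameCoset E (c (inclBottom C (base n))) (𝟙 _) := by
    intro j
    induction j with
    | zero =>
      intro _
      obtain ⟨H, H0, H1, Hfix⟩ := exists_push_bottom C le_rfl (lowerPart_zero_mem C)
      have hmem : ∀ w, H (w, 1) ∈ Set.range (inclBottom C) := by
        intro w
        refine ⟨(H (w, 1)).1.1, Exterior.ext' rfl (Subtype.ext ?_)⟩
        rw [H1, min_eq_right w.1.1.2.2.1]
        rfl
      obtain ⟨c, hc, hc'⟩ := hc₁.pull (κ := (Subtype.val : lowerPart C 0 → Exterior C))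
        Topology.IsEmbedding.subtypeVal H H0 hmem
      rw [Subtype.range_val] at hc
      refine ⟨c, hc, ?_⟩
      have hx : inclBottom C (base n) ∈ lowerPart C 0 := by
        change (K + 1) * ((0 : I) : ℝ) ≤ _
        simp
      have hfix : ∀ t, H (⟨_, hx⟩, t) = inclBottom C (base n) := fun t =>
        Hfix ⟨_, hx⟩ t le_rfl
      exact (SameCoset.of_pull hc' _ hfix).trans hx₁
    | succ j ih =>
      intro hj
      let k : Fin K := ⟨j, hj⟩
      obtain ⟨c, hc, hx⟩ := ih (by omega)
      rw [show j = (k : ℕ) from rfl, lowerPart_castSucc] at hc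
      rw [show j + 1 = (k : ℕ) + 1 from rfl, lowerPart_succ]
      refine layer_step hn C k ?_ (hE' k) hc hx
      change lev k ((0 : I) : ℝ) ≤ -2
      have : (0 : ℝ) ≤ (k : ℕ) := Nat.cast_nonneg _
      unfold lev
      simp only [Set.Icc.coe_zero]
      linarith
  obtain ⟨c, hc, hx⟩ := step K le_rfl
  have hσ : (0 : ℝ) ≤ ((K : ℝ) + 1 / 2) / (K + 1) := by positivity
  have hK : (0 : ℝ) < K + 1 := by positivity
  obtain ⟨H, H0, H1, Hfix⟩ := exists_push_bottom C (A := Set.univ) hσ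
      fun p _ s hs _ => lowerPart_top_mem C p s hs
  have hmem : ∀ w, H (w, 1) ∈ lowerPart C K := by
    intro w
    have h2 : ((H (w, 1)).1.2 : ℝ) ≤ ((K : ℝ) + 1 / 2) / (K + 1) := by
      rw [H1]
      exact min_le_right _ _
    rw [le_div_iff₀ hK] at h2
    change (K + 1) * ((H (w, 1)).1.2 : ℝ) ≤ K + 1 / 2
    linarith
  obtain ⟨c', hc', hpull⟩ := hc.pull (κ := fun z : (Set.univ : Set (Exterior C)) => z.1)
    Topology.IsEmbedding.subtypeVal H H0 hmem
  have hc' : Flat E c' Set.univ := hc'.mono fun z _ => ⟨⟨z, trivial⟩, rfl⟩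
  have hx' : SameCoset E (c' (inclBottom C (base n))) (𝟙 _) :=
    (SameCoset.of_pull hpull ⟨inclBottom C (base n), trivial⟩ fun t =>
      Hfix ⟨inclBottom C (base n), trivial⟩ t hσ).trans hx
  -- Over the whole exterior a loop carries the label of the base point to itself, and that label is
  -- the coset of the identity; so every loop lies in `E`.
  rw [eq_top_iff]
  intro f _
  obtain ⟨a, rfl⟩ := cls_surjective (p := inclBottom C (base n)) (q := inclBottom C (base n)) f
  have h1 := hc' a fun _ => trivial
  have h2 := (hx'.comp (cls a)).symm.trans (h1.trans hx')
  unfold SameCoset at h2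
  simpa using h2

end Generation

/-! ### Circle subgroups of `SU(2)` and abelian representations -/

section Circles

/-- Purely imaginary unit quaternions. -/
def IsUnitIm (Q : ℍ[ℝ]) : Prop := Q.re = 0 ∧ ‖Q‖ = 1

theorem norm_sq_quaternion (q : ℍ[ℝ]) :
    ‖q‖ ^ 2 = q.re ^ 2 + q.imI ^ 2 + q.imJ ^ 2 + q.imK ^ 2 := by
  rw [sq, ← Quaternion.normSq_eq_norm_mul_self, Quaternion.normSq_def']

theorem IsUnitIm.sum_sq {Q : ℍ[ℝ]} (h : IsUnitIm Q) : Q.imI ^ 2 + Q.imJ ^ 2 + Q.imK ^ 2 = 1 := by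
  have := norm_sq_quaternion Q
  rw [h.1, h.2] at this
  linarith

theorem SU2.sum_sq (q : SU2) : (q : ℍ[ℝ]).re ^ 2 + (q : ℍ[ℝ]).imI ^ 2 + (q : ℍ[ℝ]).imJ ^ 2 +
    (q : ℍ[ℝ]).imK ^ 2 = 1 := by
  have h := congrArg (fun x : ℍ[ℝ] => x.re) (Unitary.star_mul_self_of_mem q.2)
  simp only [Quaternion.re_mul, Quaternion.re_star, Quaternion.imI_star, Quaternion.imJ_star,
    Quaternion.imK_star, Quaternion.re_one] at h
  linarith

theorem mem_unitary_of_sum_sq {q : ℍ[ℝ]} (h : q.re ^ 2 + q.imI ^ 2 + q.imJ ^ 2 + q.imK ^ 2 = 1) :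
    q ∈ unitary ℍ[ℝ] := by
  have h1 : Quaternion.normSq q = 1 := by rw [Quaternion.normSq_def', h]
  rw [Unitary.mem_iff, Quaternion.star_mul_self, Quaternion.self_mul_star, h1]
  simp

/-- The homomorphism from the circle to `SU(2)` with `e^{iα} ↦ e^{αQ}`. -/
def circHom (Q : ℍ[ℝ]) (hQ : IsUnitIm Q) : Circle →* SU2 where
  toFun z := ⟨((z : ℂ).re : ℍ[ℝ]) + (z : ℂ).im • Q, by
    apply mem_unitary_of_sum_sq
    have h1 := hQ.sum_sq
    have h2 := Circle.normSq_coe z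
    rw [Complex.normSq_apply] at h2
    simp [hQ.1]
    linear_combination h2 + (z : ℂ).im ^ 2 * h1⟩
  map_one' := by
    apply Subtype.ext
    simp
  map_mul' z w := by
    apply Subtype.ext
    have h1 := hQ.sum_sq
    ext <;> simp [hQ.1]
    · linear_combination (z : ℂ).im * (w : ℂ).im * h1
    all_goals ring

theorem circHom_re (Q : ℍ[ℝ]) (hQ : IsUnitIm Q) (z : Circle) :
    ((circHom Q hQ z : SU2) : ℍ[ℝ]).re = (z : ℂ).re := by
  change (((z : ℂ).re : ℍ[ℝ]) + (z : ℂ).im • Q).re = _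
  simp [hQ.1]

theorem circHom_exp (Q : ℍ[ℝ]) (hQ : IsUnitIm Q) (a : ℝ) :
    ((circHom Q hQ (Circle.exp a) : SU2) : ℍ[ℝ]) = expIm a Q := by
  change (((Circle.exp a : ℂ)).re : ℍ[ℝ]) + (Circle.exp a : ℂ).im • Q = _
  rw [Circle.coe_exp, Complex.exp_ofReal_mul_I_re, Complex.exp_ofReal_mul_I_im]
  rfl

theorem circHom_injective (Q : ℍ[ℝ]) (hQ : IsUnitIm Q) : Function.Injective (circHom Q hQ) := by
  intro z w h
  have h1 : ((z : ℂ).re : ℍ[ℝ]) + (z : ℂ).im • Q = ((w : ℂ).re : ℍ[ℝ]) + (w : ℂ).im • Q :=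
    congrArg Subtype.val h
  have h2 := congrArg (fun q : ℍ[ℝ] => q.re) h1
  have h3 := congrArg (fun q : ℍ[ℝ] => q.imI) h1
  have h4 := congrArg (fun q : ℍ[ℝ] => q.imJ) h1
  have h5 := congrArg (fun q : ℍ[ℝ] => q.imK) h1
  simp [hQ.1] at h2 h3 h4 h5
  apply Circle.ext
  apply Complex.ext h2
  have hs := hQ.sum_sq
  rcases h3 with h | h3
  · exact h
  rcases h4 with h | h4
  · exact h
  rcases h5 with h | h5
  · exact h
  rw [h3, h4, h5] at hs
  norm_num at hs

/-- The elements that commute with a purely imaginary unit quaternion form its circle. -/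
theorem exists_circHom_of_commute {Q : ℍ[ℝ]} (hQ : IsUnitIm Q) (x : SU2)
    (h : (x : ℍ[ℝ]) * Q = Q * x) : ∃ z, circHom Q hQ z = x := by
  have h3 := congrArg (fun q : ℍ[ℝ] => q.imI) h
  have h4 := congrArg (fun q : ℍ[ℝ] => q.imJ) h
  have h5 := congrArg (fun q : ℍ[ℝ] => q.imK) h
  simp only [Quaternion.imI_mul, Quaternion.imJ_mul, Quaternion.imK_mul, hQ.1] at h3 h4 h5
  have hs := hQ.sum_sq
  have hx := SU2.sum_sq x
  set a := (x : ℍ[ℝ]).re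
  -- Commuting with `Q` means that the imaginary part of `x` has zero cross product with `Q`; it is
  -- therefore `b Q`, with `b` the inner product.
  set b := (x : ℍ[ℝ]).imI * Q.imI + (x : ℍ[ℝ]).imJ * Q.imJ + (x : ℍ[ℝ]).imK * Q.imK with hb
  have e1 : (x : ℍ[ℝ]).imI = b * Q.imI := by
    linear_combination (exp := 1) -(x : ℍ[ℝ]).imI * hs - Q.imI * hb + Q.imJ * h5 / 2 - Q.imK * h4 / 2
  have e2 : (x : ℍ[ℝ]).imJ = b * Q.imJ := by
    linear_combination (exp := 1) -(x : ℍ[ℝ]).imJ * hs - Q.imJ * hb + Q.imK * h3 / 2 - Q.imI * h5 / 2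
  have e3 : (x : ℍ[ℝ]).imK = b * Q.imK := by
    linear_combination (exp := 1) -(x : ℍ[ℝ]).imK * hs - Q.imK * hb + Q.imI * h4 / 2 - Q.imJ * h3 / 2
  have hab : a ^ 2 + b ^ 2 = 1 := by
    rw [e1, e2, e3] at hx
    linear_combination hx - b ^ 2 * hs
  let z : Circle := ⟨⟨a, b⟩, by
    refine mem_sphere_zero_iff_norm.2 ?_
    rw [Complex.norm_eq_sqrt_sq_add_sq]
    simp [hab]⟩
  refine ⟨z, ?_⟩
  apply Subtype.ext
  change ((a : ℝ) : ℍ[ℝ]) + b • Q = _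
  ext <;> simp [hQ.1, ← e1, ← e2, ← e3, a]

/-- Every unit quaternion lies on a circle. -/
theorem exists_circHom_eq (x : SU2) : ∃ (Q : ℍ[ℝ]) (hQ : IsUnitIm Q) (z : Circle),
    circHom Q hQ z = x := by
  have hx := SU2.sum_sq x
  set N := (x : ℍ[ℝ]).imI ^ 2 + (x : ℍ[ℝ]).imJ ^ 2 + (x : ℍ[ℝ]).imK ^ 2 with hN
  have hN0 : 0 ≤ N := by positivity
  obtain ⟨Q, hQ, hc⟩ : ∃ Q : ℍ[ℝ], IsUnitIm Q ∧ (x : ℍ[ℝ]) * Q = Q * x := by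
    have mk : ∀ Q : ℍ[ℝ], Q.re = 0 → Q.imI ^ 2 + Q.imJ ^ 2 + Q.imK ^ 2 = 1 → IsUnitIm Q := by
      intro Q h1 h2
      refine ⟨h1, ?_⟩
      have := norm_sq_quaternion Q
      rw [h1] at this
      have h3 : ‖Q‖ ^ 2 = 1 := by linarith
      exact (pow_eq_one_iff_of_nonneg (norm_nonneg _) two_ne_zero).1 h3
    have ex : ∀ a b c : ℝ, ∃ Q : ℍ[ℝ], Q.re = 0 ∧ Q.imI = a ∧ Q.imJ = b ∧ Q.imK = c :=
      fun a b c => ⟨⟨0, a, b, c⟩, rfl, rfl, rfl, rfl⟩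
    -- For a real `x` any `Q` will do; otherwise `Q` is the normalized imaginary part.
    rcases eq_or_lt_of_le hN0 with h | h
    · have h1 : (x : ℍ[ℝ]).imI = 0 := by nlinarith [sq_nonneg (x : ℍ[ℝ]).imJ, sq_nonneg (x : ℍ[ℝ]).imK]
      have h2 : (x : ℍ[ℝ]).imJ = 0 := by nlinarith [sq_nonneg (x : ℍ[ℝ]).imI, sq_nonneg (x : ℍ[ℝ]).imK]
      have h3 : (x : ℍ[ℝ]).imK = 0 := by nlinarith [sq_nonneg (x : ℍ[ℝ]).imI, sq_nonneg (x : ℍ[ℝ]).imJ]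
      obtain ⟨Q, q0, q1, q2, q3⟩ := ex 1 0 0
      refine ⟨Q, mk _ q0 (by rw [q1, q2, q3]; norm_num), ?_⟩
      ext <;> simp [h1, h2, h3, q0, q1, q2, q3]
    · have hs : (Real.sqrt N) ^ 2 = N := Real.sq_sqrt hN0
      have hs0 : Real.sqrt N ≠ 0 := (Real.sqrt_pos.2 h).ne'
      obtain ⟨Q, q0, q1, q2, q3⟩ := ex ((x : ℍ[ℝ]).imI / Real.sqrt N)
        ((x : ℍ[ℝ]).imJ / Real.sqrt N) ((x : ℍ[ℝ]).imK / Real.sqrt N)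
      refine ⟨Q, mk _ q0 ?_, ?_⟩
      · simp only [q1, q2, q3, div_pow, hs]
        rw [← add_div, ← add_div, ← hN, div_self h.ne']
      · ext <;> simp [q0, q1, q2, q3] <;> ring
  obtain ⟨z, hz⟩ := exists_circHom_of_commute hQ x hc
  exact ⟨Q, hQ, z, hz⟩

theorem circHom_eq_of_im_ne_zero {Q : ℍ[ℝ]} (hQ : IsUnitIm Q) {z : Circle} (hz : (z : ℂ).im ≠ 0)
    (x : SU2) (h : x * circHom Q hQ z = circHom Q hQ z * x) : (x : ℍ[ℝ]) * Q = Q * x := by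
  have h1 : (x : ℍ[ℝ]) * (((z : ℂ).re : ℍ[ℝ]) + (z : ℂ).im • Q) =
      (((z : ℂ).re : ℍ[ℝ]) + (z : ℂ).im • Q) * x := congrArg Subtype.val h
  rw [mul_add, add_mul, Quaternion.coe_commutes, add_right_inj, mul_smul_comm, smul_mul_assoc] at h1
  exact smul_right_injective _ hz h1

variable {G : Type} [Group G]

/-- The image of an abelian representation lies in a circle. -/
theorem IsAbelianRep.exists_circHom {ρ : G →* SU2} (h : IsAbelianRep ρ) :
    ∃ (Q : ℍ[ℝ]) (hQ : IsUnitIm Q), ∀ g, ∃ z, circHom Q hQ z = ρ g := by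
  obtain ⟨e⟩ := h
  have hinf : Infinite Circle := by
    have h1 : Infinite (Set.Ioc (-Real.pi) Real.pi) :=
      (Set.Ioc_infinite (by linarith [Real.pi_pos])).to_subtype
    exact Infinite.of_injective (fun x : Set.Ioc (-Real.pi) Real.pi => Circle.exp x) (by
      intro x y hxy
      exact Subtype.ext (Circle.exp_injOn_Ioc (by linarith) x.2 y.2 hxy))
  have hinf' : (Set.univ : Set (stabilizer ρ)).Infinite := by
    have : Infinite (stabilizer ρ) := Infinite.of_injective e.symm e.symm.injective
    exact Set.infinite_univ
  have hinf2 : (((↑) : stabilizer ρ → SU2) '' Set.univ).Infinite :=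
    hinf'.image Subtype.val_injective.injOn
  have hneg : (-1 : ℍ[ℝ]) ∈ unitary ℍ[ℝ] := by
    rw [Unitary.mem_iff]
    simp
  -- An infinite stabilizer contains an element other than `±1`. Such an element lies on a single
  -- circle, and everything that commutes with it lies on that circle.
  obtain ⟨s, ⟨s', -, rfl⟩, hs⟩ := hinf2.exists_notMem_finite
    (Set.toFinite {(1 : SU2), (⟨-1, hneg⟩ : SU2)})
  obtain ⟨Q, hQ, z, hz⟩ := exists_circHom_eq (s' : SU2)
  have him : (z : ℂ).im ≠ 0 := by
    intro h0
    apply hs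
    have h1 := Circle.normSq_coe z
    rw [Complex.normSq_apply, h0] at h1
    have h2 : ((z : ℂ).re - 1) * ((z : ℂ).re + 1) = 0 := by linarith
    have h3 : ((s' : SU2) : ℍ[ℝ]) = ((z : ℂ).re : ℍ[ℝ]) := by
      rw [← hz]
      change (((z : ℂ).re : ℍ[ℝ]) + (z : ℂ).im • Q) = _
      rw [h0, zero_smul, add_zero]
    rcases mul_eq_zero.1 h2 with h | h
    · left
      apply Subtype.ext
      rw [h3, show (z : ℂ).re = 1 by linarith]
      simp
    · right
      apply Subtype.ext
      rw [h3, show (z : ℂ).re = -1 by linarith]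
      simp
  refine ⟨Q, hQ, fun g => exists_circHom_of_commute hQ _ ?_⟩
  refine circHom_eq_of_im_ne_zero hQ him _ ?_
  rw [hz]
  have := s'.2 g
  rw [mul_inv_eq_iff_eq_mul] at this
  exact this.symm

/-- A representation with image in a circle that hits the imaginary quaternions is abelian. -/
theorem isAbelianRep_of_commute {ρ : G →* SU2} (hρ : ∀ a b, ρ a * ρ b = ρ b * ρ a) {a : G}
    (ha : ((ρ a : SU2) : ℍ[ℝ]).re = 0) : IsAbelianRep ρ := by
  have hQ : IsUnitIm ((ρ a : SU2) : ℍ[ℝ]) := by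
    refine ⟨ha, ?_⟩
    have h1 := norm_sq_quaternion ((ρ a : SU2) : ℍ[ℝ])
    rw [SU2.sum_sq] at h1
    exact (pow_eq_one_iff_of_nonneg (norm_nonneg _) two_ne_zero).1 h1
  have himg : ∀ g, ∃ z, circHom _ hQ z = ρ g := fun g =>
    exists_circHom_of_commute hQ _ (congrArg Subtype.val (hρ g a))
  have hmem : ∀ z, circHom _ hQ z ∈ stabilizer ρ := by
    intro z g
    obtain ⟨w, hw⟩ := himg g
    rw [← hw, ← map_mul, mul_comm, map_mul, mul_inv_cancel_right]
  let f : Circle →* stabilizer ρ := (circHom _ hQ).codRestrict (stabilizer ρ) hmem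
  refine ⟨(MulEquiv.ofBijective f ⟨?_, ?_⟩).symm⟩
  · intro z w h
    exact circHom_injective _ hQ (congrArg Subtype.val h)
  · rintro ⟨x, hx⟩
    have h1 := hx a
    rw [mul_inv_eq_iff_eq_mul] at h1
    obtain ⟨z, hz⟩ := exists_circHom_of_commute hQ x (congrArg Subtype.val h1)
    exact ⟨z, Subtype.ext hz⟩

theorem commute_of_circHom {ρ : G →* SU2} {Q : ℍ[ℝ]} {hQ : IsUnitIm Q}
    (h : ∀ g, ∃ z, circHom Q hQ z = ρ g) (a b : G) : ρ a * ρ b = ρ b * ρ a := by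
  obtain ⟨z, hz⟩ := h a
  obtain ⟨w, hw⟩ := h b
  rw [← hz, ← hw, ← map_mul, ← map_mul, mul_comm]

theorem compactSpace_SU2 : CompactSpace SU2 := by
  have : ProperSpace ℍ[ℝ] := FiniteDimensional.proper ℝ _
  have h : IsCompact (unitary ℍ[ℝ] : Set ℍ[ℝ]) := by
    have e : (unitary ℍ[ℝ] : Set ℍ[ℝ]) = Metric.sphere 0 1 := by
      ext q
      rw [mem_sphere_zero_iff_norm]
      constructor
      · intro h
        have h1 := norm_sq_quaternion q
        rw [SU2.sum_sq ⟨q, h⟩] at h1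
        exact (pow_eq_one_iff_of_nonneg (norm_nonneg _) two_ne_zero).1 h1
      · intro h
        apply mem_unitary_of_sum_sq
        rw [← norm_sq_quaternion, h, one_pow]
    rw [e]
    exact isCompact_sphere _ _
  exact isCompact_iff_compactSpace.1 h

/-- Having stabilizer `U(1)` is not visibly a closed condition, but commuting image is, and together
with `Re ρ(A_1) = 0`, which rules out central representations, it is equivalent. The set is then the
image of a closed subset of a product of copies of `SU(2)`. -/
theorem isCompact_abelian {n : ℕ} (hn : 1 ≤ n) :
    IsCompact (abelianStratum (PiF n) ∩ {m : MF n | traceMap m = 0}) := by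
  have := compactSpace_SU2
  let ι : Rep (PiF n) → (PiF n → SU2) := fun (ρ : PiF n →* SU2) a => ρ a
  have hι : Topology.IsInducing ι := ⟨rfl⟩
  let S : Set (Rep (PiF n)) := {ρ : PiF n →* SU2 | (∀ a b, ρ a * ρ b = ρ b * ρ a) ∧
    ∀ i, ((ρ (genA i) : SU2) : ℍ[ℝ]).re = 0}
  let T : Set (PiF n → SU2) := {f | (∀ a b, f (a * b) = f a * f b) ∧ (∀ a b, f a * f b = f b * f a) ∧
    ∀ i : Fin n, ((f (genA i) : SU2) : ℍ[ℝ]).re = 0}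
  have hre : Continuous fun q : SU2 => (q : ℍ[ℝ]).re :=
    Quaternion.continuous_re.comp continuous_subtype_val
  have isClosed_forall : ∀ {κ : Type} {p : κ → (PiF n → SU2) → Prop},
      (∀ a, IsClosed {f | p a f}) → IsClosed {f | ∀ a, p a f} := by
    intro κ p h
    have e : {f | ∀ a, p a f} = ⋂ a, {f | p a f} := by
      ext f
      simp
    rw [e]
    exact isClosed_iInter h
  have hT : IsClosed T := by
    refine IsClosed.inter ?_ (IsClosed.inter ?_ ?_)
    · exact isClosed_forall fun a => isClosed_forall fun b =>
        isClosed_eq (by fun_prop) (by fun_prop)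
    · exact isClosed_forall fun a => isClosed_forall fun b =>
        isClosed_eq (by fun_prop) (by fun_prop)
    · exact isClosed_forall fun i =>
        isClosed_eq (hre.comp (continuous_apply _)) continuous_const
  have himg : ι '' S = T := by
    ext f
    constructor
    · rintro ⟨ρ, ⟨h1, h2⟩, rfl⟩
      exact ⟨fun a b => MonoidHom.map_mul ρ a b, h1, h2⟩
    · rintro ⟨h1, h2, h3⟩
      exact ⟨MonoidHom.mk' f h1, ⟨h2, h3⟩, rfl⟩
  have hS : IsCompact S := by
    rw [hι.isCompact_iff, himg]
    exact hT.isCompact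
  have e : abelianStratum (PiF n) ∩ {m : MF n | traceMap m = 0} =
      (Quotient.mk (conjSetoid (PiF n)) : Rep (PiF n) → MF n) '' S := by
    ext m
    constructor
    · rintro ⟨⟨ρ, hρ, rfl⟩, hm⟩
      obtain ⟨Q, hQ, h⟩ := hρ.exists_circHom
      exact ⟨ρ, ⟨commute_of_circHom h, fun i => congrFun hm i⟩, rfl⟩
    · rintro ⟨ρ, ⟨h1, h2⟩, rfl⟩
      refine ⟨⟨ρ, isAbelianRep_of_commute h1 (h2 ⟨0, hn⟩), rfl⟩, ?_⟩
      funext i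
      exact h2 i
  rw [e]
  exact hS.image continuous_quotient_mk'

end Circles

open CategoryTheory unitInterval

/-! ### Perturbed representations: uniqueness, and existence for abelian boundary values -/

section Perturbed

/-- The pair `(α, Q)` is determined up to periods and the sign change `(-α, -Q)`, under which the
odd function `sin` is harmless; for central values `Q` is arbitrary, but `sin α = 0`. -/
theorem expIm_eq_expIm {Q R : ℍ[ℝ]} (hQ : IsUnitIm Q) (hR : IsUnitIm R) {α β : ℝ}
    (h : expIm α Q = expIm β R) (t : ℝ) :
    expIm (t * Real.sin α) Q = expIm (t * Real.sin β) R := by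
  have h1 := congrArg (fun q : ℍ[ℝ] => q.re) h
  simp [expIm, hQ.1, hR.1] at h1
  have h2 : Real.sin α • Q = Real.sin β • R := by
    unfold expIm at h
    rw [h1] at h
    exact add_left_cancel h
  have h3 : Real.sin α ^ 2 = Real.sin β ^ 2 := by
    rw [Real.sin_sq, Real.sin_sq, h1]
  rcases eq_or_ne (Real.sin β) 0 with h0 | h0
  · have : Real.sin α = 0 := by
      rw [h0] at h3
      simpa using h3
    rw [this, h0]
    simp [expIm]
  · rcases sq_eq_sq_iff_eq_or_eq_neg.1 h3 with h4 | h4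
    · rw [h4] at h2 ⊢
      rw [smul_right_injective _ h0 h2]
    · rw [h4, neg_smul, ← smul_neg] at h2
      rw [h4, ← smul_right_injective _ h0 h2]
      simp [expIm]

theorem exists_circle_char {G : Type} [Group G] {ρ : G →* SU2} (h : IsAbelianRep ρ) :
    ∃ (Q : ℍ[ℝ]) (hQ : IsUnitIm Q) (χ : G →* Circle), ρ = (circHom Q hQ).comp χ := by
  obtain ⟨Q, hQ, hz⟩ := h.exists_circHom
  choose z hz using hz
  refine ⟨Q, hQ, MonoidHom.mk' z fun a b => circHom_injective Q hQ ?_, ?_⟩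
  · rw [map_mul, hz, hz, hz, map_mul]
  · ext1 g
    exact (hz g).symm

variable {n K : ℕ}

/-- The subgroup where `ρ` and `η` agree contains the bottom, and if it contains a longitude it
contains the meridian, whose value is a function of that of the longitude. -/
theorem Perturbed.ext (hn : 1 ≤ n) {C : Fin K → FramedCurve n} {f : Fin K → ℝ → ℝ}
    {ρ η : PiExt C →* SU2} (hρ : Perturbed C f ρ) (hη : Perturbed C f η)
    (h : ∀ g, ρ (bottomHom C g) = η (bottomHom C g)) : ρ = η := by
  let E : Subgroup (FundamentalGroup (Exterior C) (inclBottom C (base n))) :=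
    { carrier := {g | ρ (MulOpposite.op g) = η (MulOpposite.op g)}
      one_mem' := (map_one ρ).trans (map_one η).symm
      mul_mem' := by
        intro a b ha hb
        change ρ (MulOpposite.op b * MulOpposite.op a) = η (MulOpposite.op b * MulOpposite.op a)
        rw [map_mul, map_mul, hb, ha]
      inv_mem' := by
        intro a ha
        change ρ (MulOpposite.op a)⁻¹ = η (MulOpposite.op a)⁻¹
        rw [map_inv, map_inv, ha] }
  have hE : E = ⊤ := by
    refine subgroup_exterior_eq_top hn C E (fun a => h (loopClass a)) fun k w hl => ?_
    change ρ (loopClass _) = η (loopClass _) at hl ⊢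
    obtain ⟨Q, hQ, z, hz⟩ := exists_circHom_eq (ρ (loopClass (w.trans ((longitude C k).trans w.symm))))
    obtain ⟨α, rfl⟩ : ∃ α, Circle.exp α = z := ⟨_, Circle.exp_arg z⟩
    have h1 := congrArg (fun q : SU2 => (q : ℍ[ℝ])) hz
    simp only [circHom_exp] at h1
    have h2 := hρ k w α Q hQ.1 hQ.2 h1.symm
    have h3 := hη k w α Q hQ.1 hQ.2 (by rw [← hl]; exact h1.symm)
    exact Subtype.ext (h2.trans h3.symm)
  ext1 g
  have : g.unop ∈ E := hE ▸ Subgroup.mem_top _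
  exact this

theorem isUnitIm_conj {Q : ℍ[ℝ]} (hQ : IsUnitIm Q) (g : SU2) :
    IsUnitIm (((g⁻¹ : SU2) : ℍ[ℝ]) * Q * (g : ℍ[ℝ])) := by
  have hQ' : Q ∈ unitary ℍ[ℝ] := by
    apply mem_unitary_of_sum_sq
    rw [← norm_sq_quaternion, hQ.2, one_pow]
  have e : (((g⁻¹ * ⟨Q, hQ'⟩ * g⁻¹⁻¹ : SU2) : SU2) : ℍ[ℝ]) = ((g⁻¹ : SU2) : ℍ[ℝ]) * Q * (g : ℍ[ℝ]) := by
    rw [inv_inv]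
    rfl
  rw [← e]
  refine ⟨(re_conj _ _).trans hQ.1, ?_⟩
  have h1 := norm_sq_quaternion ((g⁻¹ * ⟨Q, hQ'⟩ * g⁻¹⁻¹ : SU2) : ℍ[ℝ])
  rw [SU2.sum_sq] at h1
  exact (pow_eq_one_iff_of_nonneg (norm_nonneg _) two_ne_zero).1 h1

theorem expIm_conj (α : ℝ) (Q : ℍ[ℝ]) (g : SU2) :
    ((g⁻¹ : SU2) : ℍ[ℝ]) * expIm α Q * (g : ℍ[ℝ]) =
      expIm α (((g⁻¹ : SU2) : ℍ[ℝ]) * Q * (g : ℍ[ℝ])) := by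
  have h : ((g⁻¹ : SU2) : ℍ[ℝ]) * (g : ℍ[ℝ]) = 1 := congrArg Subtype.val (inv_mul_cancel g)
  unfold expIm
  rw [mul_add, add_mul, ← Quaternion.coe_commutes, mul_assoc, h, mul_one, mul_smul_comm,
    smul_mul_assoc]

theorem Perturbed.conj {C : Fin K → FramedCurve n} {f : Fin K → ℝ → ℝ}
    {ρ η : PiExt C →* SU2} (hρ : Perturbed C f ρ) {g : SU2} (h : ∀ a, η a = g * ρ a * g⁻¹) :
    Perturbed C f η := by
  intro k w α Q h1 h2 hl
  have hρη : ∀ a, ρ a = g⁻¹ * η a * g := fun a => by rw [h]; group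
  have hQ := isUnitIm_conj ⟨h1, h2⟩ g
  have key := hρ k w α _ hQ.1 hQ.2 (by
    rw [hρη, ← expIm_conj, ← hl]
    rfl)
  rw [← expIm_conj] at key
  rw [h]
  have h3 : ((g : SU2) : ℍ[ℝ]) * ((g⁻¹ : SU2) : ℍ[ℝ]) = 1 := congrArg Subtype.val (mul_inv_cancel g)
  change (g : ℍ[ℝ]) * _ * ((g⁻¹ : SU2) : ℍ[ℝ]) = _
  rw [key, mul_assoc, mul_assoc, mul_assoc, h3, mul_one, ← mul_assoc, h3, one_mul]

/-- The value of `Φ` on the class of the bottom of a perturbed representation is the class of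
its top. -/
theorem PhiPert_eq (hn : 1 ≤ n) {C : Fin K → FramedCurve n} {f : Fin K → ℝ → ℝ}
    {η : PiExt C →* SU2} (hη : Perturbed C f η) :
    PhiPert C f (CharVar.mk (η.comp (bottomHom C))) = CharVar.mk (η.comp (topHom C)) := by
  have hex : ∃ y : PertVar C f, restrictBottom C f y = CharVar.mk (η.comp (bottomHom C)) :=
    ⟨Quotient.mk (pertSetoid C f) ⟨η, hη⟩, rfl⟩
  rw [PhiPert, dif_pos hex]
  have hy := hex.choose_spec
  -- Nothing is known about the chosen class but its bottom; after conjugation it agrees with `η`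
  -- there, and uniqueness identifies the two.
  generalize hex.choose = y at hy
  obtain ⟨⟨ρ, hρ⟩, rfl⟩ := Quotient.exists_rep y
  obtain ⟨g, hg⟩ : Conjugate (ρ.comp (bottomHom C)) (η.comp (bottomHom C)) :=
    Quotient.exact (s := conjSetoid (PiF n)) hy
  let ρ' : PiExt C →* SU2 := (MulAut.conj g).toMonoidHom.comp ρ
  have hρ' : Perturbed C f ρ' := hρ.conj (g := g) fun a => rfl
  have e : ρ' = η := hρ'.ext hn hη fun a => (hg a).symm
  refine Quotient.sound (s := conjSetoid (PiF n)) ⟨g, fun a => ?_⟩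
  rw [← e]
  rfl

/-- The homomorphism induced by the projection to `F`. -/
def projHom (C : Fin K → FramedCurve n) : PiExt C →* PiF n :=
  MonoidHom.op (FundamentalGroup.map (projMap C) (inclBottom C (base n)))

theorem projHom_loopClass (C : Fin K → FramedCurve n)
    (a : Path (inclBottom C (base n)) (inclBottom C (base n))) :
    projHom C (loopClass a) = loopClass (x := base n) (a.map (projMap C).continuous) := rfl

theorem exists_loopClass {X : Type} [TopologicalSpace X] {x : X} (g : Pi1 X x) :
    ∃ a : Path x x, loopClass a = g := by
  obtain ⟨a, ha⟩ := cls_surjective (X := X) (p := x) (q := x) g.unop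
  exact ⟨a, congrArg MulOpposite.op ha⟩

theorem projHom_bottomHom (C : Fin K → FramedCurve n) (g : PiF n) :
    projHom C (bottomHom C g) = g := by
  obtain ⟨a, rfl⟩ := exists_loopClass g
  rfl

theorem projHom_topHom (C : Fin K → FramedCurve n) (g : PiF n) :
    projHom C (topHom C g) = g := by
  obtain ⟨a, rfl⟩ := exists_loopClass g
  have h := topHom_loopClass C a
  rw [← cls_symm, ← cls_trans, ← cls_trans] at h
  have e : topHom C (loopClass a) = loopClass
      ((vertical C).trans ((a.map (inclTop C).continuous).trans (vertical C).symm)) :=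
    congrArg MulOpposite.op h
  rw [e, projHom_loopClass]
  apply congrArg MulOpposite.op
  change cls _ = cls a
  have h1 : cls (((vertical C).trans ((a.map (inclTop C).continuous).trans
      (vertical C).symm)).map (projMap C).continuous) =
      cls (Path.refl (base n)) ≫ cls a ≫ cls (Path.refl (base n)).symm := by
    rw [← cls_trans, ← cls_trans, Path.map_trans, Path.map_trans]
    rfl
  refine h1.trans ?_
  rw [cls_symm, cls_refl, IsIso.inv_id]
  exact (Category.id_comp _).trans (Category.comp_id _)

/-- The number of times that the `k`-th longitude crosses the vertical annulus above the `j`-th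
curve. -/
def crossing (hn : 1 ≤ n) (C : Fin K → FramedCurve n) (j k : Fin K) : ℝ :=
  turn (annulusMap hn C j) (cls (longitude C k))

/-- Triangularity: a longitude never crosses the annulus standing over a higher curve, nor, by the
choice of framing, the one over its own. -/
theorem crossing_of_le (hn : 1 ≤ n) (C : Fin K → FramedCurve n) {j k : Fin K} (h : k ≤ j) :
    crossing hn C j k = 0 := by
  rcases eq_or_lt_of_le h with rfl | h
  · exact turn_annulusMap_longitude_self hn C k
  · exact turn_annulusMap_torus_of_lt hn C h _ fun t => ⟨_, _, rfl⟩

/-- The extension of a character of `π₁(F)` to the exterior with values `e^{i β_k}` on the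
meridians. -/
def extendChar (hn : 1 ≤ n) (C : Fin K → FramedCurve n) (χ : PiF n →* Circle) (β : Fin K → ℝ) :
    PiExt C →* Circle where
  toFun g := χ (projHom C g) * Circle.exp (∑ k, turn (annulusMap hn C k) g.unop * β k)
  map_one' := by
    rw [Finset.sum_eq_zero fun k _ => ?_, map_one, map_one, Circle.exp_zero, mul_one]
    exact (congrArg (· * β k) (turn_id _ _)).trans (zero_mul _)
  map_mul' g h := by
    have : ∀ k, turn (annulusMap hn C k) (g * h).unop =
        turn (annulusMap hn C k) g.unop + turn (annulusMap hn C k) h.unop :=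
      fun k => turn_comp _ g.unop h.unop
    simp only [this, add_mul, Finset.sum_add_distrib, Circle.exp_add, map_mul]
    exact mul_mul_mul_comm _ _ _ _

theorem turn_loopClass_conj {X : Type} [TopologicalSpace X] (u : C(X, Circle)) {x p : X}
    (w : Path x p) (a : Path p p) :
    turn u (loopClass (w.trans (a.trans w.symm))).unop = turn u (cls a) := by
  change turn u (cls _) = _
  rw [cls_trans, cls_trans, cls_symm, turn_conj]

theorem extendChar_bottom (hn : 1 ≤ n) (C : Fin K → FramedCurve n) (χ : PiF n →* Circle)
    (β : Fin K → ℝ) (g : PiF n) : extendChar hn C χ β (bottomHom C g) = χ g := by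
  change χ (projHom C _) * Circle.exp (∑ k, turn (annulusMap hn C k) (bottomHom C g).unop * β k) = _
  simp [turn_annulusMap_bottom, projHom_bottomHom]

theorem extendChar_top (hn : 1 ≤ n) (C : Fin K → FramedCurve n) (χ : PiF n →* Circle)
    (β : Fin K → ℝ) (a : Path (base n) (base n)) :
    extendChar hn C χ β (topHom C (loopClass a)) =
      χ (loopClass a) * Circle.exp (∑ k, turn ((C k).thomMap hn) (cls a) * β k) := by
  change χ (projHom C _) *
    Circle.exp (∑ k, turn (annulusMap hn C k) (topHom C (loopClass a)).unop * β k) = _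
  simp [turn_annulusMap_top, projHom_topHom]

theorem extendChar_longitude (hn : 1 ≤ n) (C : Fin K → FramedCurve n) (χ : PiF n →* Circle)
    (β : Fin K → ℝ) (k : Fin K) (w : Path (inclBottom C (base n)) (torusPt C k 1 1)) :
    extendChar hn C χ β (loopClass (w.trans ((longitude C k).trans w.symm))) =
      χ (projHom C (loopClass (w.trans ((longitude C k).trans w.symm)))) *
        Circle.exp (∑ j, crossing hn C j k * β j) := by
  change χ _ * Circle.exp (∑ j, turn (annulusMap hn C j) _ * β j) = _
  simp only [turn_loopClass_conj]
  rfl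

theorem projHom_meridian (C : Fin K → FramedCurve n) (k : Fin K)
    (w : Path (inclBottom C (base n)) (torusPt C k 1 1)) :
    projHom C (loopClass (w.trans ((meridian C k).trans w.symm))) = 1 := by
  rw [projHom_loopClass]
  apply congrArg MulOpposite.op
  change cls _ = 𝟙 _
  rw [Path.map_trans, Path.map_trans, cls_trans, cls_trans, cls_map_meridian, Category.id_comp,
    ← Path.map_symm, cls_symm, IsIso.hom_inv_id]

/-- The crossing numbers above a curve vanish for meridians of the other curves. -/
theorem turn_annulusMap_meridian (hn : 1 ≤ n) (C : Fin K → FramedCurve n) (j k : Fin K) :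
    turn (annulusMap hn C j) (cls (meridian C k)) = if j = k then 1 else 0 := by
  rcases lt_trichotomy j k with h | rfl | h
  · rw [if_neg h.ne, turn_annulusMap_meridian_of_gt hn C h]
  · rw [if_pos rfl, turn_annulusMap_meridian_self]
  · rw [if_neg h.ne', turn_annulusMap_torus_of_lt hn C h _ fun t => ⟨_, _, rfl⟩]

theorem extendChar_meridian (hn : 1 ≤ n) (C : Fin K → FramedCurve n) (χ : PiF n →* Circle)
    (β : Fin K → ℝ) (k : Fin K) (w : Path (inclBottom C (base n)) (torusPt C k 1 1)) :
    extendChar hn C χ β (loopClass (w.trans ((meridian C k).trans w.symm))) =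
      Circle.exp (β k) := by
  change χ _ * Circle.exp (∑ j, turn (annulusMap hn C j) _ * β j) = _
  simp only [turn_loopClass_conj, turn_annulusMap_meridian, projHom_meridian]
  simp

/-- `c` is an angle of the value of `χ` on the free homotopy class of the curve `C`. -/
def HasAngle (χ : PiF n →* Circle) (C : FramedCurve n) (c : ℝ) : Prop :=
  ∀ w : Path (base n) (C.collar (1, 0)),
    χ (loopClass (w.trans ((C.around 1).trans w.symm))) = Circle.exp c

theorem projHom_longitude (C : Fin K → FramedCurve n) (k : Fin K)
    (w : Path (inclBottom C (base n)) (torusPt C k 1 1)) :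
    ∃ w' : Path (base n) ((C k).collar (1, 0)),
      projHom C (loopClass (w.trans ((longitude C k).trans w.symm))) =
        loopClass (w'.trans (((C k).around 1).trans w'.symm)) := by
  have e : (torusPt C k 1 1).1.1 = (C k).collar (1, 0) := by
    rw [torusPt_fst]
    simp
  have e' : (longitude C k).map (projMap C).continuous = ((C k).around 1).cast e e := by
    ext s
    change (torusPt C k _ 1).1.1 = (C k).collar (1 * _, 0)
    rw [torusPt_fst]
    simp
  have gen : ∀ {p q : Surface n} (e : p = q) (w : Path (base n) p) (a : Path q q), 
      loopClass (w.trans ((a.cast e e).trans w.symm)) =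
        loopClass ((w.cast rfl e.symm).trans (a.trans (w.cast rfl e.symm).symm)) := by
    rintro p q rfl w a
    rfl
  refine ⟨(w.map (projMap C).continuous).cast rfl e.symm, ?_⟩
  rw [projHom_loopClass, Path.map_trans, Path.map_trans, ← Path.map_symm, e']
  exact gen e (w.map (projMap C).continuous) _

/-- The `k`-th longitude has angle `c k` from the surface plus `∑ j, crossing hn C j k * β j` from
the annuli that it crosses, so `hβ` is the perturbation condition in terms of angles. -/
theorem perturbed_extendChar (hn : 1 ≤ n) (C : Fin K → FramedCurve n) (χ : PiF n →* Circle)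
    {Q : ℍ[ℝ]} (hQ : IsUnitIm Q) {c t β : Fin K → ℝ} (hc : ∀ k, HasAngle χ (C k) (c k))
    (hβ : ∀ k, β k = t k * Real.sin (c k + ∑ j, crossing hn C j k * β j)) :
    Perturbed C (fun k α => t k * Real.sin α) ((circHom Q hQ).comp (extendChar hn C χ β)) := by
  intro k w α R h1 h2 hl
  rw [MonoidHom.comp_apply, extendChar_longitude] at hl
  obtain ⟨w', hw'⟩ := projHom_longitude C k w
  rw [hw', hc k w', ← Circle.exp_add, circHom_exp] at hl
  rw [MonoidHom.comp_apply, extendChar_meridian, circHom_exp, hβ k]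
  exact expIm_eq_expIm hQ ⟨h1, h2⟩ hl _

/-- At the top `A_i` passes through all the annuli, and each crossing with the `k`-th one adds `±β
k` to its angle. -/
theorem traceMap_Phi (hn : 1 ≤ n) (C : Fin K → FramedCurve n) (χ : PiF n →* Circle)
    {Q : ℍ[ℝ]} (hQ : IsUnitIm Q) {c t β : Fin K → ℝ} (hc : ∀ k, HasAngle χ (C k) (c k))
    (hβ : ∀ k, β k = t k * Real.sin (c k + ∑ j, crossing hn C j k * β j)) (i : Fin n) {a : ℝ}
    (ha : χ (genA i) = Circle.exp a) :
    traceMap (Phi C (CharVar.mk ((circHom Q hQ).comp χ)) t) i =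
      Real.cos (a + ∑ k, turn ((C k).thomMap hn) (cls (Edge.A i).loop) * β k) := by
  have e : (circHom Q hQ).comp χ = ((circHom Q hQ).comp (extendChar hn C χ β)).comp (bottomHom C) := by
    ext1 g
    change _ = circHom Q hQ (extendChar hn C χ β (bottomHom C g))
    rw [extendChar_bottom]
    rfl
  rw [Phi, e, PhiPert_eq hn (perturbed_extendChar hn C χ hQ hc hβ)]
  change ((circHom Q hQ (extendChar hn C χ β (topHom C (loopClass (Edge.A i).loop))) : SU2) :
    ℍ[ℝ]).re = _
  rw [extendChar_top, circHom_re]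
  change ((χ (genA i) * _ : Circle) : ℂ).re = _
  rw [ha, ← Circle.exp_add, Circle.coe_exp, Complex.exp_ofReal_mul_I_re]

theorem loopClass_conj {X : Type} [TopologicalSpace X] {x p : X} (w w' : Path x p) (a : Path p p) :
    loopClass (w'.trans (a.trans w'.symm)) =
      loopClass (w'.trans w.symm) * loopClass (w.trans (a.trans w.symm)) *
        (loopClass (w'.trans w.symm))⁻¹ := by
  rw [eq_mul_inv_iff_mul_eq]
  apply congrArg MulOpposite.op
  change (cls _ ≫ cls _ : FundamentalGroupoid.mk x ⟶ FundamentalGroupoid.mk x) = cls _ ≫ cls _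
  simp only [cls_trans, cls_symm, Category.assoc, IsIso.inv_hom_id_assoc]

/-- Another connecting path conjugates the loop, which a character does not see. -/
theorem hasAngle_of_eq {χ : PiF n →* Circle} {C : FramedCurve n} {c : ℝ}
    (w : Path (base n) (C.collar (1, 0)))
    (h : χ (loopClass (w.trans ((C.around 1).trans w.symm))) = Circle.exp c) : HasAngle χ C c := by
  intro w'
  rw [← h]
  rw [loopClass_conj w w', map_mul, map_mul, map_inv, mul_inv_cancel_comm]

theorem exists_hasAngle (χ : PiF n →* Circle) (C : FramedCurve n) :
    ∃ c ∈ Set.Icc (-Real.pi) Real.pi, HasAngle χ C c := by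
  have := pathConnectedSpace_surface n
  obtain ⟨w⟩ := PathConnectedSpace.joined (base n) (C.collar (1, 0))
  exact ⟨Complex.arg _, ⟨(Complex.neg_pi_lt_arg _).le, Complex.arg_le_pi _⟩,
    hasAngle_of_eq w (Circle.exp_arg _).symm⟩

/-- The longitudes of `C` are freely homotopic to `C`. -/
theorem HasAngle.longitudeAt {χ : PiF n →* Circle} {C : FramedCurve n} {c : ℝ}
    (hc : HasAngle χ C c) (E : Path (base n) (base n)) (τ : I) (θ : Circle)
    (h : E τ = C.collar (θ, 0)) : χ (C.longitudeAt E τ θ h) = Circle.exp c := by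
  unfold FramedCurve.longitudeAt
  generalize (E.subpath 0 τ).cast E.source.symm h.symm = p
  obtain ⟨b, hb⟩ : ∃ b : ℝ, Circle.exp b * θ = 1 := ⟨Complex.arg (θ⁻¹ : Circle), by
    rw [Circle.exp_arg, inv_mul_cancel]⟩
  have hcont := C.isOpenEmbedding.continuous
  let v : Path (C.collar (θ, 0)) (C.collar (1, 0)) :=
    { toFun := fun s => C.collar (Circle.exp (s * b) * θ, 0)
      continuous_toFun := hcont.comp (by fun_prop)
      source' := by simp
      target' := by simp [hb] }
  have sq : cls (C.around θ) ≫ cls v = cls v ≫ cls (C.around 1) := by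
    refine cls_square ⟨fun st => C.collar (Circle.exp (st.2 * b) * θ *
      Circle.exp (2 * Real.pi * st.1), 0), hcont.comp (by fun_prop)⟩ _ _ _ _ ?_ ?_ ?_ ?_
    · intro t
      change C.collar (θ * _, 0) = C.collar (_, 0)
      simp
    · intro t
      change C.collar (_ * θ, 0) = C.collar (_, 0)
      simp
    · intro t
      change C.collar (_ * θ, 0) = C.collar (_, 0)
      simp
    · intro t
      change C.collar (1 * _, 0) = C.collar (_, 0)
      simp [hb]
  rw [← hc (p.trans v)]
  apply congrArg (fun x => χ (MulOpposite.op x))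
  change cls _ = cls _
  simp only [cls_trans, cls_symm, Category.assoc, IsIso.inv_comp]
  rw [← reassoc_of% sq]
  simp

end Perturbed

open Filter

/-! ### The traces as functions of the perturbation parameters -/

section Calculus

variable {n K : ℕ}

/-- One step of the recursion for the angles of the meridians. -/
def angleStep (L : Fin K → Fin K → ℝ) (c t β : Fin K → ℝ) : Fin K → ℝ :=
  fun k => t k * Real.sin (c k + ∑ j, L j k * β j)

/-- The angles of the meridians. -/
def angles (L : Fin K → Fin K → ℝ) (c t : Fin K → ℝ) : Fin K → ℝ :=
  (angleStep L c t)^[K] 0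

/-- The `k`-th coordinate of a step depends only on the coordinates below `k`, so it is stable after
`k + 1` iterations and all of them are stable after `K`. -/
theorem angles_eq {L : Fin K → Fin K → ℝ} (hL : ∀ j k, k ≤ j → L j k = 0) (c t : Fin K → ℝ) :
    angles L c t = angleStep L c t (angles L c t) := by
  have h : ∀ m : ℕ, ∀ k : Fin K, (k : ℕ) < m →
      (angleStep L c t)^[m + 1] 0 k = (angleStep L c t)^[m] 0 k := by
    intro m
    induction m with
    | zero => intro k hk; omega
    | succ m ih =>
      intro k hk
      rw [Function.iterate_succ_apply', Function.iterate_succ_apply' _ m]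
      refine congrArg (fun s => t k * Real.sin (c k + s)) (Finset.sum_congr rfl fun j _ => ?_)
      rcases le_or_gt k j with hj | hj
      · rw [hL j k hj, zero_mul, zero_mul]
      · have hjm : (j : ℕ) < m := by
          have : (j : ℕ) < k := hj
          omega
        have e := ih j hjm
        rw [Function.iterate_succ_apply'] at e
        exact congrArg (L j k * ·) e
  funext k
  have := h K k k.2
  rw [Function.iterate_succ_apply'] at this
  exact this.symm

theorem contDiff_angles (L : Fin K → Fin K → ℝ) :
    ContDiff ℝ ∞ fun x : (Fin K → ℝ) × (Fin K → ℝ) => angles L x.1 x.2 := by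
  have h : ∀ m : ℕ, ContDiff ℝ ∞ fun x : (Fin K → ℝ) × (Fin K → ℝ) =>
      (angleStep L x.1 x.2)^[m] 0 := by
    intro m
    induction m with
    | zero => exact contDiff_const
    | succ m ih =>
      simp only [Function.iterate_succ_apply']
      rw [contDiff_pi] at ih ⊢
      intro k
      unfold angleStep at ih ⊢
      fun_prop
  exact h K

/-- The traces, as functions of the angles of the boundary values and of the parameters. -/
def traces (L : Fin K → Fin K → ℝ) (N : Fin n → Fin K → ℝ) (p : (Fin n → ℝ) × (Fin K → ℝ))
    (t : Fin K → ℝ) : Fin n → ℝ :=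
  fun i => Real.cos (p.1 i + ∑ k, N i k * angles L p.2 t k)

theorem contDiff_traces (L : Fin K → Fin K → ℝ) (N : Fin n → Fin K → ℝ) :
    ContDiff ℝ ∞ (Function.uncurry (traces L N)) := by
  have h := (contDiff_angles L).comp (contDiff_fst.snd.prodMk contDiff_snd :
    ContDiff ℝ ∞ fun x : ((Fin n → ℝ) × (Fin K → ℝ)) × (Fin K → ℝ) => (x.1.2, x.2))
  have h' := fun k => (contDiff_pi.1 h) k
  rw [contDiff_pi]
  intro i
  unfold Function.uncurry traces
  refine Real.contDiff_cos.comp (ContDiff.add (by fun_prop) (ContDiff.sum fun k _ => ?_))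
  exact contDiff_const.mul (h' k)

theorem contDiff_traces_apply (L : Fin K → Fin K → ℝ) (N : Fin n → Fin K → ℝ)
    (p : (Fin n → ℝ) × (Fin K → ℝ)) : ContDiff ℝ ∞ (traces L N p) :=
  (contDiff_traces L N).comp (contDiff_const.prodMk contDiff_id)

/-- Along the line `s • v` the angle is `s * v k` times a sine, so its derivative at `0` involves
only the value of that sine at `0`, which is `sin (p.2 k)`: the crossings between curves have no
effect to first order. -/
theorem fderiv_traces {L : Fin K → Fin K → ℝ} (hL : ∀ j k, k ≤ j → L j k = 0)
    (N : Fin n → Fin K → ℝ) (p : (Fin n → ℝ) × (Fin K → ℝ)) (v : Fin K → ℝ) (i : Fin n) :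
    fderiv ℝ (traces L N p) 0 v i =
      -Real.sin (p.1 i) * ∑ k, N i k * (Real.sin (p.2 k) * v k) := by
  let β : Fin K → ℝ → ℝ := fun k s => angles L p.2 (s • v) k
  have hβ0 : ∀ k, β k 0 = 0 := by
    intro k
    simp only [β, zero_smul]
    rw [angles_eq hL]
    simp [angleStep]
  have hβ : ∀ k, HasDerivAt (β k) (Real.sin (p.2 k) * v k) 0 := by
    have hd : ∀ k, DifferentiableAt ℝ (β k) 0 := by
      intro k
      have h := (contDiff_angles L).comp (contDiff_const.prodMk (contDiff_id.smul contDiff_const) :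
        ContDiff ℝ ∞ fun s : ℝ => (p.2, s • v))
      exact ((contDiff_pi.1 h) k).differentiable (by simp) 0
    intro k
    have e : β k = fun s => s * v k * Real.sin (p.2 k + ∑ j, L j k * β j s) := by
      funext s
      simp only [β]
      conv_lhs => rw [angles_eq hL]
      rfl
    have h1 : DifferentiableAt ℝ (fun s => Real.sin (p.2 k + ∑ j, L j k * β j s)) 0 := by
      fun_prop
    have h2 := ((hasDerivAt_id (0 : ℝ)).mul_const (v k)).mul h1.hasDerivAt
    rw [e]
    refine h2.congr_deriv ?_
    simp [hβ0]
    ring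
  have h1 : HasDerivAt (fun s : ℝ => traces L N p (s • v) i)
      (-Real.sin (p.1 i + ∑ k, N i k * β k 0) * ∑ k, N i k * (Real.sin (p.2 k) * v k)) 0 := by
    refine HasDerivAt.cos (HasDerivAt.const_add _ ?_)
    exact HasDerivAt.fun_sum fun k _ => (hβ k).const_mul _
  have h2 : HasFDerivAt (traces L N p) (fderiv ℝ (traces L N p) 0) ((0 : ℝ) • v) := by
    rw [zero_smul]
    exact ((contDiff_traces_apply L N p).differentiable (by simp) 0).hasFDerivAt
  have h3 : HasDerivAt (fun s : ℝ => s • v) v 0 := by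
    simpa using (hasDerivAt_id (0 : ℝ)).smul_const v
  have h4 := hasDerivAt_pi.1 (h2.comp_hasDerivAt (0 : ℝ) h3) i
  have h5 := h4.unique h1
  simpa [hβ0] using h5

/-- The differential is onto if each trace is moved at first order by a curve that does not
affect the other traces. -/
theorem surjective_fderiv_traces {L : Fin K → Fin K → ℝ} (hL : ∀ j k, k ≤ j → L j k = 0)
    {N : Fin n → Fin K → ℝ} {p : (Fin n → ℝ) × (Fin K → ℝ)} (hp : ∀ i, Real.cos (p.1 i) = 0)
    (h : ∀ i, ∃ k, Real.sin (p.2 k) ≠ 0 ∧ N i k ≠ 0 ∧ ∀ i', i' ≠ i → N i' k = 0) :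
    Function.Surjective (fderiv ℝ (traces L N p) 0) := by
  choose κ h1 h2 h3 using h
  have hs : ∀ i, Real.sin (p.1 i) ≠ 0 := by
    intro i h0
    have := Real.sin_sq_add_cos_sq (p.1 i)
    rw [h0, hp i] at this
    norm_num at this
  intro y
  -- The curve `κ i` moves the `i`-th trace alone, at the rate whose inverse appears here.
  refine ⟨∑ i, Pi.single (κ i) (-y i / (Real.sin (p.1 i) * (N i (κ i) * Real.sin (p.2 (κ i))))), ?_⟩
  funext l
  rw [map_sum, Finset.sum_apply, Finset.sum_eq_single l]
  · rw [fderiv_traces hL, Finset.sum_eq_single (κ l)]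
    · rw [Pi.single_eq_same]
      have a1 := hs l
      have a2 := h1 l
      have a3 := h2 l
      field_simp
    · intro k _ hk
      rw [Pi.single_eq_of_ne hk, mul_zero, mul_zero]
    · simp
  · intro i _ hi
    rw [fderiv_traces hL, Finset.sum_eq_single (κ i)]
    · rw [h3 i l hi.symm, zero_mul, mul_zero]
    · intro k _ hk
      rw [Pi.single_eq_of_ne hk, mul_zero, mul_zero]
    · simp
  · simp

/-- Surjectivity means rank at least `finrank ℝ W`, and rank is lower semicontinuous. -/
theorem isOpen_setOf_surjective {V W : Type*} [NormedAddCommGroup V] [NormedSpace ℝ V]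
    [NormedAddCommGroup W] [NormedSpace ℝ W] [FiniteDimensional ℝ W] :
    IsOpen {f : V →L[ℝ] W | Function.Surjective f} := by
  have e : {f : V →L[ℝ] W | Function.Surjective f} =
      {f : V →L[ℝ] W | (Module.finrank ℝ W : Cardinal) ≤ (f : V →ₗ[ℝ] W).rank} := by
    ext f
    simp only [Set.mem_ofPred_eq]
    rw [Module.finrank_eq_rank]
    constructor
    · intro h
      exact (rank_range_of_surjective (f : V →ₗ[ℝ] W) h).ge
    · intro h
      have h1 : LinearMap.range (f : V →ₗ[ℝ] W) = ⊤ := by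
        refine Submodule.eq_top_of_finrank_eq ?_
        refine le_antisymm (Submodule.finrank_le _) ?_
        have : Module.rank ℝ W ≤ Module.rank ℝ (LinearMap.range (f : V →ₗ[ℝ] W)) := h
        rwa [← Module.finrank_eq_rank, ← Module.finrank_eq_rank, Nat.cast_le] at this
      exact LinearMap.range_eq_top.1 h1
  rw [e]
  exact isOpen_setOfPred_nat_le_rank _

/-- Submersivity is uniform over compact sets of parameters. -/
theorem exists_open_surjective {P V W : Type*} [NormedAddCommGroup P] [NormedSpace ℝ P]
    [NormedAddCommGroup V] [NormedSpace ℝ V] [NormedAddCommGroup W] [NormedSpace ℝ W]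
    [FiniteDimensional ℝ W] {f : P → V → W} (hf : ContDiff ℝ ∞ (Function.uncurry f)) {S : Set P}
    (hS : IsCompact S) {v : V} (h : ∀ p ∈ S, Function.Surjective (fderiv ℝ (f p) v)) :
    ∃ U : Set V, IsOpen U ∧ v ∈ U ∧ ∀ t ∈ U, ∀ p ∈ S, Function.Surjective (fderiv ℝ (f p) t) := by
  have h0 : ContDiff ℝ ∞ fun y : (V × P) × V => (y.1.2, y.2) := by fun_prop
  have h1 : ContDiff ℝ ∞ (Function.uncurry fun x : V × P => f x.2) :=
    ContDiff.comp (g := Function.uncurry f) hf h0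
  have h2 : (1 : WithTop ℕ∞) ≤ ∞ := by exact_mod_cast le_top
  have hc : Continuous fun x : V × P => fderiv ℝ (f x.2) x.1 :=
    Continuous.fderiv h1 continuous_fst h2
  have ho := isOpen_setOf_surjective.preimage hc
  -- Tube lemma: an open condition on `(t, p)` that holds on `{v} × S` holds near `v`, uniformly
  -- over the compact set `S`.
  have key : ∀ᶠ t in 𝓝 v, ∀ p ∈ S, Function.Surjective (fderiv ℝ (f p) t) :=
    hS.eventually_forall_of_forall_eventually fun p hp => ho.mem_nhds (h p hp)
  obtain ⟨U, hU, hUo, hU0⟩ := eventually_nhds_iff.1 key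
  exact ⟨U, hUo, hU0, hU⟩

end Calculus

/-! ### The curves `C_I(i)` and `C_III(i)` -/

section Special

variable {n K : ℕ}

/-- Intersection numbers of the curves with the loops `A_i`. -/
def meet (hn : 1 ≤ n) (C : Fin K → FramedCurve n) (i : Fin n) (k : Fin K) : ℝ :=
  turn ((C k).thomMap hn) (cls (Edge.A i).loop)

theorem FramedCurve.IsSpecial.turn_thom (hn : 1 ≤ n) {C : FramedCurve n} {l : CurveLabel n}
    (hC : C.IsSpecial l) {R : Row n} (hR : R ∈ l.rows) (hs : R.sign = 1 ∨ R.sign = -1) :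
    turn (C.thomMap hn) (cls R.edge.loop) = R.sign := by
  obtain ⟨τ, θ, h, hcr, -⟩ := hC.1 R hR
  exact C.turn_thom_of_crosses hn _ hs hcr

theorem FramedCurve.IsSpecial.turn_thom_eq_zero (hn : 1 ≤ n) {C : FramedCurve n} {l : CurveLabel n}
    (hC : C.IsSpecial l) (hl : ¬ l.NearBase) {E : Edge n} (hE : ∀ R ∈ l.rows, R.edge ≠ E) :
    turn (C.thomMap hn) (cls E.loop) = 0 :=
  C.turn_thom_of_disjoint hn _ (hC.2 hl E hE)

theorem FramedCurve.IsSpecial.apply_longitude {C : FramedCurve n} {l : CurveLabel n}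
    (hC : C.IsSpecial l) {R : Row n} (hR : R ∈ l.rows) {χ : PiF n →* Circle} {c : ℝ}
    (hc : HasAngle χ C c) : χ R.longitude = Circle.exp c := by
  obtain ⟨τ, θ, h, -, hlong⟩ := hC.1 R hR
  rw [← hlong, hc.longitudeAt]

theorem cos_eq_of_exp_eq {a b : ℝ} (h : Circle.exp a = Circle.exp b) : Real.cos a = Real.cos b := by
  have := congrArg (fun z : Circle => (z : ℂ).re) h
  simpa only [Circle.coe_exp, Complex.exp_ofReal_mul_I_re] using this

/-- If `χ(A_i)` is imaginary, then one of `C_I(i)`, `C_III(i)` has noncentral value. -/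
theorem sin_sq_add_sin_sq {C C' : FramedCurve n} {i : Fin n} (hC : C.IsSpecial (.I i))
    (hC' : C'.IsSpecial (.III i)) {χ : PiF n →* Circle} {a c c' : ℝ} (hc : HasAngle χ C c)
    (hc' : HasAngle χ C' c') (ha : χ (genA i) = Circle.exp a) (h0 : Real.cos a = 0) :
    Real.sin c ^ 2 + Real.sin c' ^ 2 = 1 := by
  have h1 := hC.apply_longitude (R := ⟨.A i, genA i * genD i * (genA i)⁻¹, -1⟩)
    (by simp [CurveLabel.rows]) hc
  have h2 := hC'.apply_longitude (R := ⟨.A i, genA i * genD i, -1⟩)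
    (by simp [CurveLabel.rows]) hc'
  -- Under a character the longitudes become `χ(D_i)` and `χ(A_i) χ(D_i)`, so `c'` is `a + c` modulo
  -- `2π`; with `cos a = 0` this gives `cos c' = -sin a · sin c`.
  simp only [map_mul, map_inv, mul_inv_cancel_comm] at h1 h2
  rw [h1, ha, ← Circle.exp_add] at h2
  have h3 := cos_eq_of_exp_eq h2
  rw [Real.cos_add, h0] at h3
  have h4 := Real.sin_sq_add_cos_sq a
  have h5 := Real.sin_sq_add_cos_sq c'
  rw [h0] at h4
  rw [← h3] at h5
  linear_combination h5 - Real.sin c ^ 2 * h4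

/-- The angles of abelian representations that are imaginary on the `A_i`. -/
def angleSet (κ κ' : Fin n → Fin K) : Set ((Fin n → ℝ) × (Fin K → ℝ)) :=
  {p | (∀ i, p.1 i ∈ Set.Icc (-Real.pi) Real.pi) ∧ (∀ k, p.2 k ∈ Set.Icc (-Real.pi) Real.pi) ∧
    (∀ i, Real.cos (p.1 i) = 0) ∧ ∀ i, Real.sin (p.2 (κ i)) ^ 2 + Real.sin (p.2 (κ' i)) ^ 2 = 1}

theorem isCompact_angleSet (κ κ' : Fin n → Fin K) : IsCompact (angleSet κ κ') := by
  have hbox : IsCompact ((Set.univ.pi fun _ : Fin n => Set.Icc (-Real.pi) Real.pi) ×ˢ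
      (Set.univ.pi fun _ : Fin K => Set.Icc (-Real.pi) Real.pi)) :=
    (isCompact_univ_pi fun _ => isCompact_Icc).prod (isCompact_univ_pi fun _ => isCompact_Icc)
  have h1 : IsClosed (⋂ i : Fin n, {p : (Fin n → ℝ) × (Fin K → ℝ) | Real.cos (p.1 i) = 0}) :=
    isClosed_iInter fun i => isClosed_eq (by fun_prop) continuous_const
  have h2 : IsClosed (⋂ i : Fin n, {p : (Fin n → ℝ) × (Fin K → ℝ) |
      Real.sin (p.2 (κ i)) ^ 2 + Real.sin (p.2 (κ' i)) ^ 2 = 1}) :=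
    isClosed_iInter fun i => isClosed_eq (by fun_prop) continuous_const
  convert hbox.inter_right (h1.inter h2) using 1
  ext p
  simp only [angleSet, Set.mem_inter_iff, Set.mem_prod, Set.mem_univ_pi, Set.mem_iInter,
    Set.mem_ofPred_eq, and_assoc]

/-- This puts `T ∘ Φ(ρ, -)`, for all the relevant `ρ`, into a single smooth family with compact
parameter set, so no topology on the character variety is needed for uniformity. -/
theorem exists_angles (hn : 1 ≤ n) {C : CurveLabel n → FramedCurve n}
    (hC : ∀ l, (C l).IsSpecial l) (ord : Fin K ≃ CurveLabel n) {ρ : PiF n →* SU2}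
    (hρ : IsAbelianRep ρ) (h0 : ∀ i, ((ρ (genA i) : SU2) : ℍ[ℝ]).re = 0) :
    ∃ p ∈ angleSet (fun i => ord.symm (.I i)) (fun i => ord.symm (.III i)),
      (fun t => traceMap (Phi (fun k => C (ord k)) (CharVar.mk ρ) t)) =
        traces (crossing hn fun k => C (ord k)) (meet hn fun k => C (ord k)) p := by
  obtain ⟨Q, hQ, χ, rfl⟩ := exists_circle_char hρ
  choose c hc hca using fun k => exists_hasAngle χ (C (ord k))
  let a : Fin n → ℝ := fun i => Complex.arg (χ (genA i))
  have ha : ∀ i, χ (genA i) = Circle.exp (a i) := fun i => (Circle.exp_arg _).symm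
  have ha0 : ∀ i, Real.cos (a i) = 0 := by
    intro i
    have h := h0 i
    rw [MonoidHom.comp_apply, circHom_re, ha, Circle.coe_exp, Complex.exp_ofReal_mul_I_re] at h
    exact h
  have hlabel : ∀ l, HasAngle χ (C l) (c (ord.symm l)) := by
    intro l
    have := hca (ord.symm l)
    rwa [ord.apply_symm_apply] at this
  refine ⟨(a, c), ⟨fun i => ⟨(Complex.neg_pi_lt_arg _).le, Complex.arg_le_pi _⟩, hc, ha0, fun i =>
    sin_sq_add_sin_sq (hC _) (hC _) (hlabel _) (hlabel _) (ha i) (ha0 i)⟩, ?_⟩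
  funext t i
  exact traceMap_Phi hn _ χ hQ hca
    (congrFun (angles_eq (fun j k h => crossing_of_le hn _ h) c t)) i (ha i)

/-- For each `i` the curve `C_I(i)` is used when the sine of its angle is nonzero, and `C_III(i)`
otherwise; both meet `A_i` with sign `-1` and miss the other loops `A_ℓ`. -/
theorem surjective_of_mem_angleSet (hn : 1 ≤ n) {C : CurveLabel n → FramedCurve n}
    (hC : ∀ l, (C l).IsSpecial l) (ord : Fin K ≃ CurveLabel n) {p : (Fin n → ℝ) × (Fin K → ℝ)}
    (hp : p ∈ angleSet (fun i => ord.symm (.I i)) (fun i => ord.symm (.III i))) :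
    Function.Surjective (fderiv ℝ
      (traces (crossing hn fun k => C (ord k)) (meet hn fun k => C (ord k)) p) 0) := by
  refine surjective_fderiv_traces (fun j k h => crossing_of_le hn _ h) hp.2.2.1 fun i => ?_
  have hmeet : ∀ (i' : Fin n) (l : CurveLabel n), meet hn (fun k => C (ord k)) i' (ord.symm l) =
      turn ((C l).thomMap hn) (cls (Edge.A i').loop) := by
    intro i' l
    simp only [meet, Equiv.apply_symm_apply]
  have h := hp.2.2.2 i
  by_cases hI : Real.sin (p.2 (ord.symm (.I i))) = 0
  · refine ⟨ord.symm (.III i), fun h0 => ?_, ?_, fun i' hi' => ?_⟩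
    · rw [hI, h0] at h
      norm_num at h
    · rw [hmeet, (hC (.III i)).turn_thom hn (R := ⟨.A i, genA i * genD i, -1⟩)
        (by simp [CurveLabel.rows]) (Or.inr rfl)]
      norm_num
    · rw [hmeet, (hC (.III i)).turn_thom_eq_zero hn (fun h => h)]
      simp [CurveLabel.rows, hi'.symm]
  · refine ⟨ord.symm (.I i), hI, ?_, fun i' hi' => ?_⟩
    · rw [hmeet, (hC (.I i)).turn_thom hn (R := ⟨.A i, genA i * genD i * (genA i)⁻¹, -1⟩)
        (by simp [CurveLabel.rows]) (Or.inr rfl)]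
      norm_num
    · rw [hmeet, (hC (.I i)).turn_thom_eq_zero hn (fun h => h)]
      simp [CurveLabel.rows, hi'.symm]

end Special

end TwistAbundance

end

/-! ### The proposition -/

theorem proposition8p3 (n : ℕ) (hn : 1 ≤ n)
    (C : CurveLabel n → FramedCurve n) (hC : ∀ l, (C l).IsSpecial l)
    (K : ℕ) (ord : Fin K ≃ CurveLabel n) :
    (∀ ρ : PiF n →* SU2, IsAbelianRep ρ → (∀ i, ((ρ (genA i) : SU2) : ℍ[ℝ]).re = 0) →
      DifferentiableAt ℝ (fun t : Fin K → ℝ =>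
          traceMap (Phi (fun k => C (ord k)) (CharVar.mk ρ) t)) 0 ∧
        Function.Surjective (fderiv ℝ (fun t : Fin K → ℝ =>
          traceMap (Phi (fun k => C (ord k)) (CharVar.mk ρ) t)) 0)) ∧
    IsCompact (abelianStratum (PiF n) ∩ {m : MF n | traceMap m = 0}) ∧
    ∃ U : Set (Fin K → ℝ), IsOpen U ∧ 0 ∈ U ∧
      ∀ m ∈ abelianStratum (PiF n) ∩ {m : MF n | traceMap m = 0},
        ContDiffOn ℝ ∞ (fun t : Fin K → ℝ => traceMap (Phi (fun k => C (ord k)) m t)) U ∧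
        ∀ t ∈ U, Function.Surjective (fderiv ℝ (fun s : Fin K → ℝ =>
          traceMap (Phi (fun k => C (ord k)) m s)) t) := by
  refine ⟨fun ρ hρ h0 => ?_, isCompact_abelian hn, ?_⟩
  · obtain ⟨p, hp, e⟩ := exists_angles hn hC ord hρ h0
    rw [e]
    exact ⟨(contDiff_traces_apply _ _ p).differentiable (by simp) 0,
      surjective_of_mem_angleSet hn hC ord hp⟩
  -- The neighbourhood is chosen for all of `angleSet` before any representation is considered.
  · obtain ⟨U, hU, h0, h⟩ := exists_open_surjective (contDiff_traces _ _)
      (isCompact_angleSet (fun i => ord.symm (.I i)) (fun i => ord.symm (.III i)))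
      (fun p hp => surjective_of_mem_angleSet hn hC ord hp)
    refine ⟨U, hU, h0, ?_⟩
    rintro _ ⟨⟨ρ, hρ, rfl⟩, hm⟩
    obtain ⟨p, hp, e⟩ := exists_angles hn hC ord hρ fun i => congrFun hm i
    rw [e]
    exact ⟨(contDiff_traces_apply _ _ p).contDiffOn, fun t ht => h t ht p hp⟩
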